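/- **Conventions.** Write $\underline{\mathbb R}=\mathbb R\cup\{-\infty\}$. A rational polyhedral space $(S,\mathcal O_S^\times)$ is a Hausdorff space with a sheaf of real-valued functions that is locally isomorphic, through charts $\psi$, to an open subset of a rational polyhedral subset of some $\underline{\mathbb R}^l$ with the sheaf of real-valued locally affine functions with integral slopes. Let $\Gamma_n\subset\mathbb TP^{n-1}$ ($n\ge 2$) be the closure of $\mathbb R_{\ge0}e_1\cup\dots\cup\mathbb R_{\ge0}e_{n-1}\cup\mathbb R_{\ge0}(-1,\dots,-1)\subset\mathbb R^{n-1}$. A *tropical curve* is a rational polyhedral space in which every point has an open neighbourhood isomorphic to an open subset of some $\Gamma_n$, $n\ge 2$. Put $T^*_{\mathbb Z,x}=(\mathcal O_S^\times/\mathbb R)_x$, $T_xS=\operatorname{Hom}(T^*_{\mathbb Z,x},\mathbb R)$, and let $T^*_xS=T^*_{\mathbb Z,x}\otimes\mathbb R$ be its dual. Let $\operatorname{LC}_xS\subset T_xS$ be the local cone and $\operatorname{SS}(S)_x\subset T_x^*S$ the fibre over $0$ of the micro-support of the sheaf $(\mathbb Z_{T_xS})_{\operatorname{LC}_xS}$ on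 $T_xS$. A function $f$ is *weakly-smooth* if locally $f=\log\circ h\circ\exp\circ\psi$ with $\psi$ a chart, $\exp$ coordinatewise (with $\exp(-\infty)=0$) and $h>0$ a $C^\infty$-function on an open subset of $\mathbb R^l$; these functions form a sheaf $\mathcal A_S^{\rm weak}\supset\mathcal O_S^\times$, and $df(x)\in T^*_xS$ denotes the differential at $0$ of $v\mapsto\log h(\exp(\psi(x)+v))$. A *$C^\infty$-divisor* is an element $s\in H^0(S;\mathcal A_S^{\rm weak}/\mathcal O_S^\times)$; it is given by local data $\{(U_i,f_i)\}$ with $f_i\in\mathcal A_S^{\rm weak}(U_i)$ representing $s|_{U_i}$. It is *prepermissible* if it has local data with $$df_i(x)\notin\bigl(\operatorname{span}_{\mathbb R}\operatorname{SS}(S)_x+T^*_{\mathbb Z,x}\bigr)\setminus T^*_{\mathbb Z,x}\qquad\text{for all } i \text{ and } x\in U_i .$$ With $s_0$ the zero divisor, $s_0\cap s=\{x : df_i(x)\in T^*_{\mathbb Z,x}\text{ for some } i \text{ with } x\in U_i\}$. Two $C^\infty$-divisors are *linearly equivalent* if their difference is the class of a global weakly-smooth function. A $C^\infty$-divisor $s$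 is *permissible* if it is prepermissible, $s_0\cap s$ is finite, and the graded abelian group $\bigoplus_{p\in s_0\cap s}H^\bullet(R\Gamma_{\{f_p\ge f_p(p)\}}\mathbb Z_{U_p})_p$ is finitely generated, where $f_p$ represents $s$ on an open neighbourhood $U_p$ of $p$, $f_p(p)=0$, and $p$ is the only point of $U_p$ with $df_p=0$. Finally, $[s]\in\operatorname{Pic}S=H^1(S;\mathcal O_S^\times)$ is the image of $s$ under the connecting homomorphism of $0\to\mathcal O_S^\times\to\mathcal A_S^{\rm weak}\to\mathcal A_S^{\rm weak}/\mathcal O_S^\times\to0$. **Statement.** Let $C$ be a compact tropical curve. 1. For every $C^\infty$-divisor $s$ on $C$ there is a prepermissible $C^\infty$-divisor $s'$ which is linearly equivalent to $s$ and for which $s_0\cap s'$ is a finite set. 2. Consequently, for every line bundle $\mathcal L\in\operatorname{Pic}C$ there is a permissible $C^\infty$-divisor $s$ on $C$ with $[s]=\mathcal L$. -/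

import Mathlib

open Set Filter Topology TopologicalSpace CategoryTheory CategoryTheory.Limits Opposite
open scoped ContDiff DirectSum

universe u

noncomputable section

/-! ## Local Morse data and micro-support of sheaves of abelian groups -/

namespace MorseSheaf

variable {X : TopCat.{u}}

/-- The functor `j_* j⁻¹` for the inclusion `j` of the open subset `W`. -/
def extendFromOpen (W : Opens X) :
    TopCat.Sheaf AddCommGrpCat.{u} X ⥤ TopCat.Sheaf AddCommGrpCat.{u} X :=
  W.isOpenEmbedding.sheafPullback AddCommGrpCat.{u} ⋙
    TopCat.Sheaf.pushforward AddCommGrpCat.{u} W.inclusion'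

/-- The restriction morphism `F ⟶ j_* j⁻¹ F`, i.e. `F(U) → F(U ∩ W)`. -/
def restrictToOpen (W : Opens X) :
    𝟭 (TopCat.Sheaf AddCommGrpCat.{u} X) ⟶ extendFromOpen W where
  app F :=
    ⟨{ app := fun U => F.obj.map (homOfLE (by
          rintro _ ⟨y, hy, rfl⟩; exact hy) :
          W.isOpenEmbedding.functor.obj ((Opens.map W.inclusion').obj U.unop) ⟶ U.unop).op
       naturality := fun _ _ i =>
          (F.obj.map_comp _ _).symm.trans (F.obj.map_comp _
            (W.isOpenEmbedding.functor.map ((Opens.map W.inclusion').map i.unop)).op) }⟩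
  naturality _ _ f := by
    apply CategoryTheory.Sheaf.hom_ext
    ext U : 2
    exact (f.hom.naturality _).symm

/-- The functor `Γ_Z` of sections supported in the closed set `Z = X ∖ W`: its sections over `U`
are the sections of `F` over `U` that vanish on `U ∩ W`. -/
def supportedSections (W : Opens X) :
    TopCat.Sheaf AddCommGrpCat.{u} X ⥤ TopCat.Sheaf AddCommGrpCat.{u} X where
  obj F := kernel ((restrictToOpen W).app F)
  map f := kernel.map _ _ f _ ((restrictToOpen W).naturality f).symm

/-- The inclusion `Γ_Z F ⟶ F`. -/
def supportedSectionsι (W : Opens X) :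
    supportedSections W ⟶ 𝟭 (TopCat.Sheaf AddCommGrpCat.{u} X) where
  app F := kernel.ι ((restrictToOpen W).app F)
  naturality _ _ _ := kernel.lift_ι _ _ _

instance (W : Opens X) (F : TopCat.Sheaf AddCommGrpCat.{u} X) :
    Mono ((supportedSectionsι W).app F) :=
  inferInstanceAs (Mono (kernel.ι ((restrictToOpen W).app F)))

instance (W : Opens X) : (supportedSections W).Additive where
  map_add {_ G _ _} := by
    rw [← cancel_mono ((supportedSectionsι W).app G), Preadditive.add_comp,
      NatTrans.naturality, NatTrans.naturality, NatTrans.naturality]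
    exact Preadditive.comp_add _ _ _ _ _ _

/-- The open set `{f < f x}`. The interior is only taken so that the definition also makes sense
for functions that are continuous merely near `x`; near `x` it changes nothing for them. -/
def sublevel (f : X → ℝ) (x : X) : Opens X := ⟨interior {y | f y < f x}, isOpen_interior⟩

/-- The local Morse data `LMD^i(F, f, x) = H^i(RΓ_{f ≥ f(x)} F)_x`. -/
def LMD (F : TopCat.Sheaf AddCommGrpCat.{u} X) (f : X → ℝ) (x : X) (i : ℕ) : AddCommGrpCat.{u} :=
  (((supportedSections (sublevel f x)).rightDerived i).obj F).presheaf.stalk x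

/-- The constant sheaf `ℤ_X`. -/
def constZ (X : TopCat.{u}) : TopCat.Sheaf AddCommGrpCat.{u} X :=
  (constantSheaf (Opens.grothendieckTopology X) AddCommGrpCat.{u}).obj
    (AddCommGrpCat.of (ULift.{u} ℤ))

/-- For a closed subset `L` of `E`, the sheaf `(ℤ_E)_L = i_* ℤ_L` (`i : L → E` the inclusion). -/
def constZOn {E : Type u} [TopologicalSpace E] (L : Set E) :
    TopCat.Sheaf AddCommGrpCat.{u} (TopCat.of E) :=
  (TopCat.Sheaf.pushforward AddCommGrpCat.{u}
    (TopCat.ofHom ⟨Subtype.val, continuous_subtype_val⟩ : TopCat.of L ⟶ TopCat.of E)).obj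
      (constZ (TopCat.of L))

/-- The fibre at `x₀` of the micro-support `SS(F) ⊆ T^*E = E × E^*` of a sheaf `F` on a normed
space `E`: a covector `ξ₀` is *not* in it iff for all `(x₁, dψ(x₁))` in some neighbourhood of
`(x₀, ξ₀)`, `ψ` smooth near `x₁`, the local Morse data of `(F, ψ)` at `x₁` vanish. -/
def microsupportAt {E : Type} [NormedAddCommGroup E] [NormedSpace ℝ E]
    (F : TopCat.Sheaf AddCommGrpCat.{0} (TopCat.of E)) (x₀ : E) : Set (E →L[ℝ] ℝ) :=
  {ξ₀ | ¬ ∃ N ∈ 𝓝 ((x₀, ξ₀) : E × (E →L[ℝ] ℝ)),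
    ∀ (x₁ : E) (V : Set E) (ψ : E → ℝ), IsOpen V → x₁ ∈ V → ContDiffOn ℝ ∞ ψ V →
      (x₁, fderiv ℝ ψ x₁) ∈ N → ∀ i : ℕ, IsZero (LMD F ψ x₁ i)}

end MorseSheaf

/-! ## Rational polyhedral spaces and tropical curves -/

namespace Tropical

open MorseSheaf

/-- The tropical affine line `ℝ ∪ {-∞}`, with its order topology. -/
abbrev TropReal := WithBot ℝ

/-- The real value of a tropical number (junk value `0` at `-∞`). -/
def TropReal.toReal (x : TropReal) : ℝ := x.unbotD 0

/-- The exponential map `ℝ ∪ {-∞} → ℝ_{≥ 0}`, with `exp(-∞) = 0`. -/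
def TropReal.exp (x : TropReal) : ℝ := WithBot.recBotCoe 0 (fun r : ℝ => Real.exp r) x

/-- The coordinatewise exponential map. -/
def expMap {n : ℕ} (x : Fin n → TropReal) : Fin n → ℝ := fun i => TropReal.exp (x i)

/-- A rational polyhedron in `(ℝ ∪ {-∞})^n`: the closure of a rational polyhedron (finitely many
inequalities with integral slopes) in one of the strata `ℝ^{n - |I|}`. -/
def IsRationalPolyhedron {n : ℕ} (P : Set (Fin n → TropReal)) : Prop :=
  ∃ (I : Set (Fin n)) (k : ℕ) (A : Fin k → Fin n → ℤ) (b : Fin k → ℝ),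
    P = closure {x | (∀ i, x i = ⊥ ↔ i ∈ I) ∧ ∀ j, ∑ i, (A j i : ℝ) * (x i).toReal ≤ b j}

/-- A rational polyhedral set: a finite union of rational polyhedra. -/
def IsRationalPolyhedralSet {n : ℕ} (P : Set (Fin n → TropReal)) : Prop :=
  ∃ (N : ℕ) (Q : Fin N → Set (Fin n → TropReal)),
    (∀ j, IsRationalPolyhedron (Q j)) ∧ P = ⋃ j, Q j

/-- A sheaf of abelian groups of real-valued functions on `S`, given by its stalks inside the germs
of functions: `f` is a section over an open set `U` iff its germ at each point of `U` belongs to the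
stalk there. -/
structure FunctionSheaf (S : Type u) [TopologicalSpace S] where
  stalk : ∀ x : S, AddSubgroup (Germ (𝓝 x) ℝ)
  eventually_mem : ∀ (x : S) (f : S → ℝ), (f : Germ (𝓝 x) ℝ) ∈ stalk x →
    ∀ᶠ y in 𝓝 x, (f : Germ (𝓝 y) ℝ) ∈ stalk y

section Spaces

variable {S : Type u} [TopologicalSpace S]

/-- A chart of `(S, O)`: an isomorphism of an open subset of `S` with an open subset of a rational
polyhedral set `target` in `(ℝ ∪ {-∞})^dim`, identifying the sections of `O` with the real-valued
functions that are locally affine with integral slopes in the coordinates. -/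
structure Chart (O : FunctionSheaf S) where
  dim : ℕ
  source : Opens S
  toFun : S → Fin dim → TropReal
  target : Set (Fin dim → TropReal)
  target_polyhedral : IsRationalPolyhedralSet target
  mapsTo : ∀ y ∈ source, toFun y ∈ target
  isOpenEmbedding : IsOpenEmbedding
    (fun y : source => (⟨toFun y, mapsTo y y.2⟩ : target))
  stalk_iff : ∀ x ∈ source, ∀ f : S → ℝ, (f : Germ (𝓝 x) ℝ) ∈ O.stalk x ↔
    ∃ (m : Fin dim → ℤ) (a : ℝ), (∀ i, toFun x i = ⊥ → m i = 0) ∧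
      ∀ᶠ y in 𝓝 x, f y = a + ∑ i, (m i : ℝ) * (toFun y i).toReal

/-- `(S, O)` is a rational polyhedral space, `O` being the sheaf of locally integral affine
functions. -/
def IsRationalPolyhedralSpace (O : FunctionSheaf S) : Prop :=
  ∀ x : S, ∃ c : Chart O, x ∈ c.source

/-- The tropical line in `(ℝ ∪ {-∞})^k`: the union of the rays spanned by `e_1, …, e_k` and by
`-(e_1 + ⋯ + e_k)`, together with the end point `(-∞, …, -∞)` of the last ray. For `k = n - 1` this
is the part of the projective line `Γ_n ⊆ 𝕋P^{n-1}` in one standard affine chart `𝕋^{n-1}`. -/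
def tropicalLine (k : ℕ) : Set (Fin k → TropReal) :=
  {x | ∃ (i : Fin k) (t : ℝ), 0 ≤ t ∧ x = fun j => ((Pi.single i t : Fin k → ℝ) j : TropReal)} ∪
    {x | ∃ t : TropReal, t ≤ 0 ∧ x = fun _ => t}

/-- A tropical curve (one-dimensional tropical manifold): a rational polyhedral space in which every
point has an open neighbourhood isomorphic to an open subset of some `Γ_n`, `n ≥ 2`. -/
def IsTropicalCurve (O : FunctionSheaf S) : Prop :=
  ∀ x : S, ∃ c : Chart O, x ∈ c.source ∧ 1 ≤ c.dim ∧ c.target = tropicalLine c.dim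

variable (O : FunctionSheaf S)

/-! ### Tangent and cotangent spaces, the local cone and its micro-support -/

/-- The germs of constant functions. -/
def constGerms (x : S) : AddSubgroup (Germ (𝓝 x) ℝ) :=
  ((Germ.coeAddHom (𝓝 x)).comp (Pi.constAddMonoidHom S ℝ)).range

/-- The stalk at `x` of the sheaf `O / ℝ` of integral cotangent vectors. -/
abbrev IntegralCotangent (x : S) : Type u :=
  O.stalk x ⧸ (constGerms x).addSubgroupOf (O.stalk x)

/-- The tangent space `T_x S = Hom((O / ℝ)_x, ℝ)`. -/
abbrev TangentSpaceAt (x : S) : Type u := IntegralCotangent O x →+ ℝ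

/-- The real cotangent space `T_x^* S`, the dual of `T_x S`. -/
abbrev CotangentSpaceAt (x : S) : Type u := Module.Dual ℝ (TangentSpaceAt O x)

/-- An integral cotangent vector as an element of the real cotangent space. -/
def integralToReal (x : S) : IntegralCotangent O x →+ CotangentSpaceAt O x where
  toFun m := { toFun := fun v => v m, map_add' := fun _ _ => rfl, map_smul' := fun _ _ => rfl }
  map_zero' := by ext v; exact v.map_zero
  map_add' m m' := by ext v; exact v.map_add m m'

/-- The lattice of integral cotangent vectors in the real cotangent space. -/
def integralCovectors (x : S) : AddSubgroup (CotangentSpaceAt O x) := (integralToReal O x).range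

variable {O}

lemma Chart.coord_mem (c : Chart O) {x : S} (hx : x ∈ c.source) {i : Fin c.dim}
    (hi : c.toFun x i ≠ ⊥) :
    ((fun y => (c.toFun y i).toReal : S → ℝ) : Germ (𝓝 x) ℝ) ∈ O.stalk x := by
  refine (c.stalk_iff x hx _).2 ⟨Pi.single i 1, 0, fun j hj => ?_, .of_forall fun y => ?_⟩
  · rcases eq_or_ne j i with rfl | h
    · exact absurd hj hi
    · simp [h]
  · simp [Pi.single_apply]

open Classical in
/-- The differential at `x` of the `i`-th coordinate of a chart, if that coordinate is finite at
`x`; by convention `0` otherwise. -/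
def Chart.dcoord (c : Chart O) {x : S} (hx : x ∈ c.source) (i : Fin c.dim) :
    IntegralCotangent O x :=
  if hi : c.toFun x i = ⊥ then 0 else QuotientAddGroup.mk ⟨_, c.coord_mem hx hi⟩

open Classical in
/-- The point `ψ(x) + v` of `(ℝ ∪ {-∞})^dim`, in the same stratum as `ψ(x)`. -/
def Chart.translate (c : Chart O) {x : S} (hx : x ∈ c.source) (v : TangentSpaceAt O x) :
    Fin c.dim → TropReal :=
  fun i => if c.toFun x i = ⊥ then ⊥ else (((c.toFun x i).toReal + v (c.dcoord hx i) : ℝ))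

variable (O)

/-- The local cone `LC_x S ⊆ T_x S`: the directions `v` such that `ψ(x) + t v` stays in the
polyhedral set for small `t > 0`. -/
def localCone (x : S) : Set (TangentSpaceAt O x) :=
  {v | ∃ (c : Chart O) (hx : x ∈ c.source), ∀ᶠ t : ℝ in 𝓝[>] 0, c.translate hx (t • v) ∈ c.target}

/-- `SS(S)_x = SS((ℤ_{T_x S})_{LC_x S})_0 ⊆ T_x^* S`; the manifold structure of `T_x S` is the one
given by a linear isomorphism with `ℝ^n`. -/
def SS (x : S) : Set (CotangentSpaceAt O x) :=
  {ξ | ∃ (n : ℕ) (e : TangentSpaceAt O x ≃ₗ[ℝ] (Fin n → ℝ)),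
    LinearMap.toContinuousLinearMap (ξ ∘ₗ (e.symm : (Fin n → ℝ) →ₗ[ℝ] TangentSpaceAt O x)) ∈
      microsupportAt (constZOn (e '' localCone O x)) 0}

/-! ### Weakly-smooth functions -/

variable {O}

/-- `(c, W, h)` is a primitive datum of `f`: on the source of the chart `c = ψ` one has
`f = log ∘ h ∘ exp ∘ ψ` with `h` smooth and positive on the open set `W`. -/
structure IsPrimitiveDatum (f : S → ℝ) (c : Chart O) (W : Set (Fin c.dim → ℝ))
    (h : (Fin c.dim → ℝ) → ℝ) : Prop where
  isOpen : IsOpen W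
  smooth : ContDiffOn ℝ ∞ h W
  pos : ∀ z ∈ W, 0 < h z
  mem : ∀ y ∈ c.source, expMap (c.toFun y) ∈ W
  eq : ∀ y ∈ c.source, f y = Real.log (h (expMap (c.toFun y)))

variable (O)

/-- `f` is weakly-smooth at `x` (a condition on the germ of `f` at `x`). -/
def IsWeaklySmoothAt (f : S → ℝ) (x : S) : Prop :=
  ∃ (c : Chart O) (W : Set (Fin c.dim → ℝ)) (h : (Fin c.dim → ℝ) → ℝ),
    x ∈ c.source ∧ IsPrimitiveDatum f c W h

/-- `f` is a weakly-smooth function on the open set `U` (its values elsewhere are irrelevant). -/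
def IsWeaklySmoothOn (f : S → ℝ) (U : Opens S) : Prop := ∀ x ∈ U, IsWeaklySmoothAt O f x

/-- `ξ` is the differential vector `df(x)` of the weakly-smooth function `f` at `x`, i.e. the
differential at `0` of `v ↦ log h(exp(ψ(x) + v))` on `T_x S`. -/
def HasDifferentialAt (f : S → ℝ) (x : S) (ξ : CotangentSpaceAt O x) : Prop :=
  ∃ (c : Chart O) (W : Set (Fin c.dim → ℝ)) (h : (Fin c.dim → ℝ) → ℝ) (hx : x ∈ c.source),
    IsPrimitiveDatum f c W h ∧
      ∀ v : TangentSpaceAt O x, ξ v =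
        fderiv ℝ (fun z => Real.log (h z)) (expMap (c.toFun x))
          (fun i => TropReal.exp (c.toFun x i) * v (c.dcoord hx i))

/-- `x` is a critical point of `f`. -/
def IsCriticalPoint (f : S → ℝ) (x : S) : Prop := HasDifferentialAt O f x 0

/-- The prepermissibility condition at `x`:
`df(x) ∉ (span_ℝ SS(S)_x + T^*_{ℤ,x}) ∖ T^*_{ℤ,x}`. -/
def IsPrepermissibleAt (f : S → ℝ) (x : S) : Prop :=
  ∃ ξ, HasDifferentialAt O f x ξ ∧
    ξ ∉ (((Submodule.span ℝ (SS O x)).toAddSubgroup ⊔ integralCovectors O x :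
      AddSubgroup (CotangentSpaceAt O x)) : Set (CotangentSpaceAt O x)) \ integralCovectors O x

/-! ### `C^∞`-divisors -/

/-- A `C^∞`-divisor: a global section of the quotient sheaf `A^weak / O`, i.e. a family of classes
of germs modulo `O` that is locally represented by weakly-smooth functions. -/
@[ext]
structure CInftyDivisor where
  toFun : ∀ x : S, Germ (𝓝 x) ℝ ⧸ O.stalk x
  locally_weaklySmooth : ∀ x : S, ∃ (U : Opens S) (f : S → ℝ), x ∈ U ∧ IsWeaklySmoothOn O f U ∧
    ∀ y ∈ U, toFun y = QuotientAddGroup.mk (f : Germ (𝓝 y) ℝ)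

/-- The principal `C^∞`-divisor of a weakly-smooth function on `S`. -/
def CInftyDivisor.principal (f : S → ℝ) (hf : IsWeaklySmoothOn O f ⊤) : CInftyDivisor O where
  toFun x := QuotientAddGroup.mk (f : Germ (𝓝 x) ℝ)
  locally_weaklySmooth _ := ⟨⊤, f, trivial, hf, fun _ _ => rfl⟩

namespace CInftyDivisor

variable {O}

/-- `f` is a weakly-smooth function on `U` with `s|_U = (f)^sm`. -/
def IsRepresentedOn (s : CInftyDivisor O) (U : Opens S) (f : S → ℝ) : Prop :=
  IsWeaklySmoothOn O f U ∧ ∀ y ∈ U, s.toFun y = QuotientAddGroup.mk (f : Germ (𝓝 y) ℝ)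

/-- `{(U_i, f_i)}` is a local data for `s`. -/
def IsLocalData (s : CInftyDivisor O) {ι : Type u} (U : ι → Opens S) (f : ι → S → ℝ) : Prop :=
  (∀ x, ∃ i, x ∈ U i) ∧ ∀ i, s.IsRepresentedOn (U i) (f i)

/-- Linear equivalence: the difference is the principal divisor of a weakly-smooth function. -/
def LinearlyEquivalent (s s' : CInftyDivisor O) : Prop :=
  ∃ (f : S → ℝ) (hf : IsWeaklySmoothOn O f ⊤),
    ∀ x, s.toFun x - s'.toFun x = (principal O f hf).toFun x

/-- `s` has a local data consisting of prepermissible functions. -/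
def IsPrepermissible (s : CInftyDivisor O) : Prop :=
  ∃ (ι : Type u) (U : ι → Opens S) (f : ι → S → ℝ), s.IsLocalData U f ∧
    ∀ i, ∀ x ∈ U i, IsPrepermissibleAt O (f i) x

/-- The intersection `s₀ ∩ s` with the zero divisor `s₀`: the points where the differential of a
local representative of `s` is integral. -/
def zeroIntersection (s : CInftyDivisor O) : Set S :=
  {x | ∃ (U : Opens S) (f : S → ℝ), x ∈ U ∧ s.IsRepresentedOn U f ∧
    ∃ ξ ∈ integralCovectors O x, HasDifferentialAt O f x ξ}

/-- Intersection data for `s`. -/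
structure IntersectionData (s : CInftyDivisor O) where
  U : s.zeroIntersection → Opens S
  f : s.zeroIntersection → S → ℝ
  mem : ∀ p, (p : S) ∈ U p
  represents : ∀ p, s.IsRepresentedOn (U p) (f p)
  critical_iff : ∀ p, ∀ y ∈ U p, IsCriticalPoint O (f p) y ↔ y = p
  eq_zero : ∀ p, f p p = 0

/-- The graded abelian group `LMD^•(S; s) = ⨁_p LMD^•(ℤ_{U_p}, f_p, p)`, as the direct sum over all
`p ∈ s₀ ∩ s` and all degrees. -/
abbrev IntersectionData.LMD {s : CInftyDivisor O} (D : s.IntersectionData) : Type u :=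
  ⨁ q : s.zeroIntersection × ℕ,
    (MorseSheaf.LMD (constZ (TopCat.of (D.U q.1))) (fun y => D.f q.1 y.1)
      ⟨(q.1 : S), D.mem q.1⟩ q.2 : AddCommGrpCat.{u})

/-- The permissibility condition: `s` is prepermissible, `s₀ ∩ s` is finite and `LMD^•(S; s)` is
finitely generated. -/
def IsPermissible (s : CInftyDivisor O) : Prop :=
  s.IsPrepermissible ∧ s.zeroIntersection.Finite ∧
    ∃ D : s.IntersectionData, Module.Finite ℤ D.LMD

end CInftyDivisor

/-! ### Line bundles -/

/-- A line bundle on `S`, given by transition functions: a Čech 1-cocycle with values in `O` on an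
open cover, representing an element of `Pic S = H^1(S; O)`. -/
structure LineBundle where
  index : Type u
  cover : index → Opens S
  covers : ∀ x, ∃ i, x ∈ cover i
  trans : index → index → S → ℝ
  trans_mem : ∀ i j, ∀ y ∈ cover i ⊓ cover j, (trans i j : Germ (𝓝 y) ℝ) ∈ O.stalk y
  cocycle : ∀ i j k, ∀ y ∈ cover i ⊓ cover j ⊓ cover k, trans i j y + trans j k y = trans i k y

variable {O} in
/-- `[s] = [L]` in `Pic S`: the image of `s` under the connecting homomorphism of
`0 → O → A^weak → A^weak / O → 0` is the class of `L`. That is, on some refinement of the cover of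
`L` there is a local data `(V_k, f_k)` of `s` with `f_l - f_k` the transition functions of `L`
(coboundaries are absorbed by the choice of the `f_k`). -/
def CInftyDivisor.HasClass (s : CInftyDivisor O) (L : LineBundle O) : Prop :=
  ∃ (κ : Type u) (V : κ → Opens S) (r : κ → L.index) (f : κ → S → ℝ),
    (∀ k, V k ≤ L.cover (r k)) ∧ s.IsLocalData V f ∧
      ∀ k l, ∀ y ∈ V k ⊓ V l, f l y - f k y = L.trans (r k) (r l) y

end Spaces

end Tropical

end

/-! The proof is Morse theory in one variable, modulo integral affine functions. Call a point real
if some chart with values in `ℝ ∪ {-∞}` gives it a finite coordinate. Non-real points can only be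
vertices or points at infinity, and compactness leaves finitely many of them. Near a real point a
divisor is represented by a C² function `F` of the coordinate, unique up to integral affine
functions, and the point lies in `s₀ ∩ s` exactly when `F'` is an integer there. The local cone at a
real point is the whole tangent line, so `SS` is contained in `{0}` and prepermissibility holds
automatically.

Nondegeneracy of a divisor (`IsNondegenerateAt`) means: at a real point, `F'` is not an integer or
`F''` does not vanish; at a non-real point, the divisor is represented by a standard function, which
is nonnegative, zero and critical at the point, and has non-integral slope at all other nearby
points. The standard functions are the exponential of the coordinate at infinity and the sum of
squares of the coordinates at a vertex.

Every divisor is linearly equivalent to an everywhere nondegenerate one (`exists_nondegenerate`). A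
bump function exchanges the given representative for the standard one near each non-real point. On
the rest one adds small multiples of cut-off coordinates: by Sard almost every multiple is good
where the cut-off is 1 (`volume_not_isMorseAt_add`), and nondegeneracy on a compact set already
treated survives small perturbations (`eventually_addPrincipal`), so finitely many steps suffice.

A nondegenerate divisor is permissible (`isPermissible_of_isNondegenerateAt`). Its intersection
points are isolated, hence finite in number, and the representative with zero differential has a
local minimum or a strict local maximum at each of them. The local Morse data are then cyclic and
live in degrees 0 and 1. This is computed from an injective resolution, using that injective sheaves
are flasque and that constant sheaves are acyclic on open subsets of an interval.

For a line bundle, a partition of unity turns the transition functions into a divisor with the given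
class (`exists_hasClass`), and linear equivalence does not change the class.

Weak smoothness and differentials are defined through an arbitrary chart. Normal charts, in which
the exponential coordinates of all other charts become monomials, allow everything to be computed in
one chart. -/

noncomputable section

/-! ## Sections of sheaves of abelian groups -/

namespace SheafSection

variable {X : TopCat.{u}}

/-- The sections of a sheaf of abelian groups over an open set. -/
def Sec (F : TopCat.Sheaf AddCommGrpCat.{u} X) (U : Opens X) : Type u := F.obj.obj (op U)

instance (F : TopCat.Sheaf AddCommGrpCat.{u} X) (U : Opens X) : AddCommGroup (Sec F U) :=
  inferInstanceAs (AddCommGroup (F.obj.obj (op U)))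

/-- Restriction of sections. -/
def res (F : TopCat.Sheaf AddCommGrpCat.{u} X) {U V : Opens X} (h : V ≤ U) :
    Sec F U →+ Sec F V := (F.obj.map (homOfLE h).op).hom

/-- The map on sections induced by a morphism of sheaves. -/
def app {F G : TopCat.Sheaf AddCommGrpCat.{u} X} (φ : F ⟶ G) (U : Opens X) :
    Sec F U →+ Sec G U := (φ.hom.app (op U)).hom

variable {F G H : TopCat.Sheaf AddCommGrpCat.{u} X} {U V W : Opens X}

@[simp] lemma res_res (hWV : W ≤ V) (hVU : V ≤ U) (s : Sec F U) :
    res F hWV (res F hVU s) = res F (hWV.trans hVU) s :=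
  (ConcreteCategory.congr_hom (F.obj.map_comp (homOfLE hVU).op (homOfLE hWV).op) s).symm

lemma app_res (φ : F ⟶ G) (h : V ≤ U) (s : Sec F U) :
    app φ V (res F h s) = res G h (app φ U s) :=
  ConcreteCategory.congr_hom (φ.hom.naturality (homOfLE h).op) s

lemma app_comp (φ : F ⟶ G) (ψ : G ⟶ H) (s : Sec F U) :
    app (φ ≫ ψ) U s = app ψ U (app φ U s) := rfl

lemma app_zero (s : Sec F U) : app (0 : F ⟶ G) U s = 0 := rfl

lemma app_eq_zero_of_comp {φ : F ⟶ G} {ψ : G ⟶ H} (h : φ ≫ ψ = 0) (s : Sec F U) :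
    app ψ U (app φ U s) = 0 := by
  rw [← app_comp, h, app_zero]

lemma sec_ext {s t : Sec F U}
    (h : ∀ x ∈ U, ∃ (V : Opens X) (hV : V ≤ U), x ∈ V ∧ res F hV s = res F hV t) : s = t := by
  choose V hV hx hst using h
  refine F.eq_of_locally_eq' (fun x : U => V x x.2) U (fun x => homOfLE (hV x x.2)) ?_ s t
    fun x => hst x x.2
  exact fun x hxU => Opens.mem_iSup.2 ⟨⟨x, hxU⟩, hx x hxU⟩

lemma glue {ι : Type*} (A : ι → Opens X) (hA : ∀ i, A i ≤ U) (hU : U ≤ iSup A)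
    (s : ∀ i, Sec F (A i))
    (h : ∀ i j, res F (inf_le_left : A i ⊓ A j ≤ A i) (s i) =
      res F (inf_le_right : A i ⊓ A j ≤ A j) (s j)) :
    ∃ t : Sec F U, ∀ i, res F (hA i) t = s i := by
  obtain ⟨t, ht, -⟩ := F.existsUnique_gluing' A U (fun i => homOfLE (hA i)) hU s h
  exact ⟨t, ht⟩

lemma app_injective (φ : F ⟶ G) [Mono φ] (U : Opens X) : Function.Injective (app φ U) := by
  rw [injective_iff_map_eq_zero]
  intro s hs
  have hex : (ShortComplex.mk (0 : F ⟶ F) φ zero_comp).Exact :=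
    (ShortComplex.exact_iff_mono _ rfl).2 inferInstance
  have hex' := (ShortComplex.mk (kernel.ι φ) φ (kernel.condition φ)).exact_of_f_is_kernel
    (kernelIsKernel φ)
  obtain ⟨t, ht⟩ := TopCat.Sheaf.sections_exact_of_left_exact hex' inferInstance s hs
  rw [← ht]
  have : kernel.ι φ = 0 := kernel.ι_of_mono φ
  exact congrArg (fun ψ => app ψ U t) this

lemma exists_app_eq {S : ShortComplex (TopCat.Sheaf AddCommGrpCat.{u} X)} (hS : S.Exact)
    [Mono S.f] (s : Sec S.X₂ U) (h : app S.g U s = 0) : ∃ t, app S.f U t = s :=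
  TopCat.Sheaf.sections_exact_of_left_exact hS inferInstance s h

lemma exists_local_lift (φ : F ⟶ G) [hφ : Epi φ] (s : Sec G U) {x : X} (hx : x ∈ U) :
    ∃ (V : Opens X) (hV : V ≤ U) (t : Sec F V), x ∈ V ∧ app φ V t = res G hV s := by
  have := (TopCat.Presheaf.isLocallySurjective_iff _).1
    ((TopCat.Sheaf.isLocallySurjective_iff_epi φ).2 hφ) U s x hx
  obtain ⟨V, hV, ⟨t, ht⟩, hxV⟩ := this
  exact ⟨V, hV, t, hxV, ht⟩

/-- Exactness makes the map onto the kernel of `S.g` an epimorphism, and epimorphisms of sheaves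
lift sections only locally. -/
lemma exists_local_app_eq {S : ShortComplex (TopCat.Sheaf AddCommGrpCat.{u} X)} (hS : S.Exact)
    (s : Sec S.X₂ U) (h : app S.g U s = 0) {x : X} (hx : x ∈ U) :
    ∃ (V : Opens X) (hV : V ≤ U) (t : Sec S.X₁ V), x ∈ V ∧ app S.f V t = res S.X₂ hV s := by
  have hker := (ShortComplex.mk (kernel.ι S.g) S.g (kernel.condition S.g)).exact_of_f_is_kernel
    (kernelIsKernel S.g)
  obtain ⟨s', hs'⟩ := exists_app_eq hker s h
  have := hS.epi_kernelLift
  obtain ⟨V, hV, t, hxV, ht⟩ := exists_local_lift (kernel.lift S.g S.f S.zero) s' hx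
  refine ⟨V, hV, t, hxV, ?_⟩
  rw [← hs', ← app_res, ← ht, ← app_comp, kernel.lift_ι]

/-- A sheaf all of whose restriction maps are surjective, in terms of sections. -/
lemma exists_extension [F.IsFlasque] (h : V ≤ U) (s : Sec F V) : ∃ t : Sec F U, res F h t = s :=
  (AddCommGrpCat.epi_iff_surjective _).1
    (TopCat.Presheaf.IsFlasque.epi (F := F.obj) (homOfLE h).op) s

lemma isFlasque_of_extension (h : ∀ (U V : Opens X) (h : V ≤ U) (s : Sec F V),
    ∃ t : Sec F U, res F h t = s) : F.IsFlasque where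
  epi i := (AddCommGrpCat.epi_iff_surjective _).2 (h _ _ (leOfHom i.unop))

lemma exists_app_eq_of_isFlasque {S : ShortComplex (TopCat.Sheaf AddCommGrpCat.{u} X)}
    (hS : S.ShortExact) [S.X₁.IsFlasque] (s : Sec S.X₃ U) : ∃ t, app S.g U t = s :=
  (AddCommGrpCat.epi_iff_surjective _).1 (TopCat.Sheaf.IsFlasque.epi_of_shortExact hS) s

/-! ### Injective sheaves are flasque -/

/-- The presheaf `j_! ℤ_U`. -/
def freePresheaf (U : Opens X) : (Opens X)ᵒᵖ ⥤ AddCommGrpCat.{u} :=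
  yoneda.obj U ⋙ AddCommGrpCat.free

/-- The inclusion `j_! ℤ_V ⟶ j_! ℤ_U` of presheaves for `V ≤ U`. -/
def freePresheafMap (h : V ≤ U) : freePresheaf V ⟶ freePresheaf U :=
  Functor.whiskerRight (yoneda.map (homOfLE h)) AddCommGrpCat.free

instance (h : V ≤ U) : Mono (freePresheafMap h) := by
  have : ∀ W, Mono ((freePresheafMap h).app W) := by
    intro W
    have : Mono ((yoneda.map (homOfLE h)).app W) := inferInstance
    exact (inferInstance : Mono (AddCommGrpCat.free.map ((yoneda.map (homOfLE h)).app W)))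
  exact NatTrans.mono_of_mono_app _

/-- The sheaf `j_! ℤ_U`. -/
def freeSheaf (U : Opens X) : TopCat.Sheaf AddCommGrpCat.{u} X :=
  (presheafToSheaf (Opens.grothendieckTopology X) AddCommGrpCat.{u}).obj (freePresheaf U)

/-- The inclusion `j_! ℤ_V ⟶ j_! ℤ_U` of sheaves for `V ≤ U`. -/
def freeSheafMap (h : V ≤ U) : freeSheaf V ⟶ freeSheaf U :=
  (presheafToSheaf (Opens.grothendieckTopology X) AddCommGrpCat.{u}).map (freePresheafMap h)

instance (h : V ≤ U) : Mono (freeSheafMap h) :=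
  inferInstanceAs (Mono ((presheafToSheaf (Opens.grothendieckTopology X) AddCommGrpCat.{u}).map
    (freePresheafMap h)))

/-- Morphisms from the sheaf `j_! ℤ_U` to a sheaf are its sections over `U`. -/
def freeSheafHomEquiv (U : Opens X) (F : TopCat.Sheaf AddCommGrpCat.{u} X) :
    (freeSheaf U ⟶ F) ≃ Sec F U :=
  ((sheafificationAdjunction (Opens.grothendieckTopology X) AddCommGrpCat.{u}).homEquiv
    (freePresheaf U) F).trans
    (((AddCommGrpCat.adj.whiskerRight (Opens X)ᵒᵖ).homEquiv (yoneda.obj U) F.obj).trans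
      yonedaEquiv)

lemma freeSheafHomEquiv_comp (h : V ≤ U) (f : freeSheaf U ⟶ F) :
    freeSheafHomEquiv V F (freeSheafMap h ≫ f) = res F h (freeSheafHomEquiv U F f) := by
  have h₁ := Adjunction.homEquiv_naturality_left
    (sheafificationAdjunction (Opens.grothendieckTopology X) AddCommGrpCat.{u})
    (freePresheafMap h) f
  have h₂ := Adjunction.homEquiv_naturality_left (AddCommGrpCat.adj.whiskerRight (Opens X)ᵒᵖ)
    (yoneda.map (homOfLE h)) ((sheafificationAdjunction (Opens.grothendieckTopology X)
      AddCommGrpCat.{u}).homEquiv (freePresheaf U) F f)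
  exact (congrArg (fun g => yonedaEquiv
    ((AddCommGrpCat.adj.whiskerRight (Opens X)ᵒᵖ).homEquiv (yoneda.obj V) F.obj g)) h₁).trans
    ((congrArg yonedaEquiv h₂).trans (yonedaEquiv_naturality _ _).symm)

/-- A section over `V` is a morphism from `j_! ℤ_V`; injectivity extends it along the monomorphism
`j_! ℤ_V ⟶ j_! ℤ_U`, which yields a section over `U`. -/
lemma isFlasque_of_injective (F : TopCat.Sheaf AddCommGrpCat.{u} X) [hF : Injective F] :
    F.IsFlasque := by
  refine isFlasque_of_extension fun U V h s => ?_
  obtain ⟨g, hg⟩ := hF.factors ((freeSheafHomEquiv V F).symm s) (freeSheafMap h)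
  refine ⟨freeSheafHomEquiv U F g, ?_⟩
  rw [← freeSheafHomEquiv_comp, hg, Equiv.apply_symm_apply]

end SheafSection

end

/-! ### Derived functors of `Γ_Z` in terms of cocycles of an injective resolution. -/

noncomputable section

namespace SheafSection

open MorseSheaf

variable {X : TopCat.{u}} {F : TopCat.Sheaf AddCommGrpCat.{u} X} {U V W : Opens X}

/-- The sections of `j_* j⁻¹ F` over `V` are those of `F` over an open set that equals `V ⊓ W` only
propositionally; restriction along the two inequalities transports the vanishing. -/
lemma restrictToOpen_app_eq_zero_iff (σ : Sec F V) :
    app ((restrictToOpen W).app F) V σ = 0 ↔ res F (inf_le_left : V ⊓ W ≤ V) σ = 0 := by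
  have hle : W.isOpenEmbedding.functor.obj ((Opens.map W.inclusion').obj V) ≤ V := by
    rintro _ ⟨y, hy, rfl⟩; exact hy
  have heq : W.isOpenEmbedding.functor.obj ((Opens.map W.inclusion').obj V) = V ⊓ W := by
    ext y
    constructor
    · rintro ⟨y, hy, rfl⟩; exact ⟨hy, y.2⟩
    · rintro ⟨hy, hw⟩; exact ⟨⟨y, hw⟩, hy, rfl⟩
  change res F hle σ = 0 ↔ _
  constructor
  · intro h
    rw [← res_res heq.ge hle, h, map_zero]
  · intro h
    rw [← res_res heq.le inf_le_left, h, map_zero]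

lemma exists_supportedSections_iff (σ : Sec F V) :
    (∃ z : Sec ((supportedSections W).obj F) V, app ((supportedSectionsι W).app F) V z = σ) ↔
      res F (inf_le_left : V ⊓ W ≤ V) σ = 0 := by
  rw [← restrictToOpen_app_eq_zero_iff]
  constructor
  · rintro ⟨z, rfl⟩
    exact app_eq_zero_of_comp (φ := kernel.ι ((restrictToOpen W).app F)) (kernel.condition _) z
  · intro h
    exact exists_app_eq (S := ShortComplex.mk (kernel.ι ((restrictToOpen W).app F))
      ((restrictToOpen W).app F) (kernel.condition _))
      (ShortComplex.exact_of_f_is_kernel _ (kernelIsKernel _)) σ h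

variable (I : InjectiveResolution F)

/-- The cocycles of degree `i` over `V` of an injective resolution that vanish on `W`. -/
def supportedCocycles (W : Opens X) (i : ℕ) (V : Opens X) :
    AddSubgroup (Sec (I.cocomplex.X i) V) where
  carrier := {σ | app (I.cocomplex.d i (i + 1)) V σ = 0 ∧
    res (I.cocomplex.X i) (inf_le_left : V ⊓ W ≤ V) σ = 0}
  zero_mem' := ⟨map_zero _, map_zero _⟩
  add_mem' h h' := ⟨by rw [map_add, h.1, h'.1, add_zero], by rw [map_add, h.2, h'.2, add_zero]⟩
  neg_mem' h := ⟨by rw [map_neg, h.1, neg_zero], by rw [map_neg, h.2, neg_zero]⟩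

variable {I} in
lemma res_mem_supportedCocycles {i : ℕ} (h : V ≤ U) {σ : Sec (I.cocomplex.X i) U}
    (hσ : σ ∈ supportedCocycles I W i U) :
    res _ h σ ∈ supportedCocycles I W i V := by
  obtain ⟨h₁, h₂⟩ := hσ
  refine ⟨?_, ?_⟩
  · rw [app_res, h₁, map_zero]
  · rw [res_res, ← res_res (inf_le_inf_right W h) inf_le_left, h₂, map_zero]

/-- The complex `Γ_Z I`. -/
abbrev supportedComplex (W : Opens X) : CochainComplex (TopCat.Sheaf AddCommGrpCat.{u} X) ℕ :=
  ((supportedSections W).mapHomologicalComplex _).obj I.cocomplex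

/-- The inclusion of the terms of `Γ_Z I` into those of `I`. -/
def supportedComplexι (W : Opens X) (i : ℕ) : (supportedComplex I W).X i ⟶ I.cocomplex.X i :=
  (supportedSectionsι W).app (I.cocomplex.X i)

instance (W : Opens X) (i : ℕ) : Mono (supportedComplexι I W i) :=
  inferInstanceAs (Mono ((supportedSectionsι W).app (I.cocomplex.X i)))

lemma supportedComplexι_comm (W : Opens X) (i j : ℕ) :
    (supportedComplex I W).d i j ≫ supportedComplexι I W j =
      supportedComplexι I W i ≫ I.cocomplex.d i j :=
  (supportedSectionsι W).naturality (I.cocomplex.d i j)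

/-- The inclusion of the cocycles of `Γ_Z I` into `I`. -/
def cocyclesι (W : Opens X) (i : ℕ) : (supportedComplex I W).cycles i ⟶ I.cocomplex.X i :=
  (supportedComplex I W).iCycles i ≫ supportedComplexι I W i

instance (W : Opens X) (i : ℕ) : Mono (cocyclesι I W i) := mono_comp _ _

/-- Both conditions defining the cocycles of `Γ_Z I` are kernels, and taking sections is left exact,
so no sheafification intervenes. -/
lemma exists_cocyclesι_iff {i : ℕ} (σ : Sec (I.cocomplex.X i) V) :
    (∃ z, app (cocyclesι I W i) V z = σ) ↔ σ ∈ supportedCocycles I W i V := by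
  constructor
  · rintro ⟨z, rfl⟩
    refine ⟨?_, ?_⟩
    · apply app_eq_zero_of_comp
      rw [cocyclesι, Category.assoc, ← supportedComplexι_comm, HomologicalComplex.iCycles_d_assoc, zero_comp]
    · exact (exists_supportedSections_iff _).1 ⟨app ((supportedComplex I W).iCycles i) V z, rfl⟩
  · rintro ⟨h₁, h₂⟩
    obtain ⟨y, rfl⟩ := (exists_supportedSections_iff (W := W) σ).2 h₂
    have hy : app ((supportedComplex I W).d i (i + 1)) V y = 0 := by
      apply app_injective (supportedComplexι I W (i + 1)) V
      refine Eq.trans ?_ (map_zero _).symm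
      refine (congrArg (fun ψ => app ψ V y) (supportedComplexι_comm I W i (i + 1))).trans h₁
    obtain ⟨z, hz⟩ := exists_app_eq (S := ShortComplex.mk ((supportedComplex I W).iCycles i)
      ((supportedComplex I W).d i (i + 1)) (HomologicalComplex.iCycles_d _ _ _))
      (ShortComplex.exact_of_f_is_kernel _
        ((supportedComplex I W).cyclesIsKernel i (i + 1) (by simp))) y hy
    exact ⟨z, congrArg (app ((supportedSectionsι W).app (I.cocomplex.X i)) V) hz⟩

/-- The right derived functors of `Γ_Z` as the cohomology of `Γ_Z I`. -/
def homologyIso (W : Opens X) (i : ℕ) :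
    (supportedComplex I W).homology i ≅ ((supportedSections W).rightDerived i).obj F :=
  (I.isoRightDerivedObj (supportedSections W) i).symm

/-- The projection from the cocycles of `Γ_Z I` onto the derived functor. -/
def cocyclesπ (W : Opens X) (i : ℕ) :
    (supportedComplex I W).cycles i ⟶ ((supportedSections W).rightDerived i).obj F :=
  (supportedComplex I W).homologyπ i ≫ (homologyIso I W i).hom

instance (W : Opens X) (i : ℕ) : Epi (cocyclesπ I W i) := epi_comp _ _

/-- The stalks of the derived functors of `Γ_Z` in terms of cocycles of an injective resolution. -/
lemma exists_cocycle_class (W : Opens X) (i : ℕ) (p : X) :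
    ∃ φ : ∀ V : Opens X, p ∈ V → supportedCocycles I W i V →+
        (((supportedSections W).rightDerived i).obj F).presheaf.stalk p,
      (∀ (U V : Opens X) (hU : p ∈ U) (hV : p ∈ V) (h : V ≤ U) (σ : supportedCocycles I W i U),
        φ V hV ⟨res _ h σ.1, res_mem_supportedCocycles h σ.2⟩ = φ U hU σ) ∧
      (∀ s, ∃ V hV σ, φ V hV σ = s) ∧
      ∀ (j : ℕ) (V : Opens X) (hV : p ∈ V) (σ : supportedCocycles I W i V)
        (τ : Sec (I.cocomplex.X j) V), res _ (inf_le_left : V ⊓ W ≤ V) τ = 0 →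
        app (I.cocomplex.d j i) V τ = σ → φ V hV σ = 0 := by
  let R := ((supportedSections W).rightDerived i).obj F
  let lft : ∀ V : Opens X, supportedCocycles I W i V ≃+ Sec ((supportedComplex I W).cycles i) V :=
    fun V => (AddEquiv.ofBijective (((app (cocyclesι I W i) V).codRestrict
      (supportedCocycles I W i V) fun z => (exists_cocyclesι_iff I _).1 ⟨z, rfl⟩))
      ⟨fun z z' h => app_injective (cocyclesι I W i) V (Subtype.ext_iff.1 h),
        fun σ => by
          obtain ⟨z, hz⟩ := (exists_cocyclesι_iff I σ.1).2 σ.2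
          exact ⟨z, Subtype.ext hz⟩⟩).symm
  have hlft : ∀ V σ, app (cocyclesι I W i) V (lft V σ) = σ.1 := by
    intro V σ
    have := (lft V).symm_apply_apply σ
    exact congrArg Subtype.val this
  -- Only compatibility with restriction, surjectivity and vanishing on coboundaries are recorded.
  -- Injectivity modulo coboundaries is not needed, because only upper bounds on local cohomology
  -- are used.
  refine ⟨fun V hV => ((R.presheaf.germ V p hV).hom.comp (app (cocyclesπ I W i) V)).comp
    (lft V).toAddMonoidHom, ?_, ?_, ?_⟩
  · intro U V hU hV h σ
    have hl : lft V ⟨res _ h σ.1, res_mem_supportedCocycles h σ.2⟩ = res _ h (lft U σ) := by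
      apply app_injective (cocyclesι I W i) V
      rw [hlft, app_res, hlft]
    change R.presheaf.germ V p hV (app (cocyclesπ I W i) V (lft V _)) =
      R.presheaf.germ U p hU (app (cocyclesπ I W i) U (lft U σ))
    rw [hl, app_res]
    exact TopCat.Presheaf.germ_res_apply R.presheaf (homOfLE h) p hV _
  · intro s
    obtain ⟨U, hU, t, rfl⟩ := R.presheaf.exists_germ_eq s
    obtain ⟨V, hVU, z, hV, hz⟩ := exists_local_lift (cocyclesπ I W i) t hU
    refine ⟨V, hV, (lft V).symm z, ?_⟩
    change R.presheaf.germ V p hV (app (cocyclesπ I W i) V (lft V _)) = _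
    rw [AddEquiv.apply_symm_apply, hz]
    exact TopCat.Presheaf.germ_res_apply R.presheaf (homOfLE hVU) p hV _
  · intro j V hV σ τ hτ hd
    obtain ⟨y, hy⟩ := (exists_supportedSections_iff (W := W) τ).2 hτ
    have hl : lft V σ = app ((supportedComplex I W).toCycles j i) V y := by
      apply app_injective (cocyclesι I W i) V
      have hc : (supportedComplex I W).toCycles j i ≫ cocyclesι I W i =
          supportedComplexι I W j ≫ I.cocomplex.d j i := by
        rw [cocyclesι, HomologicalComplex.toCycles_i_assoc, supportedComplexι_comm]
      refine Eq.trans ?_ (congrArg (fun ψ => app ψ V y) hc).symm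
      rw [hlft, ← hd, ← hy]
      rfl
    change R.presheaf.germ V p hV (app (cocyclesπ I W i) V (lft V _)) = _
    have hc : (supportedComplex I W).toCycles j i ≫ cocyclesπ I W i = 0 := by
      rw [cocyclesπ, HomologicalComplex.toCycles_comp_homologyπ_assoc, zero_comp]
    have hz : app (cocyclesπ I W i) V (app ((supportedComplex I W).toCycles j i) V y) = 0 :=
      app_eq_zero_of_comp hc y
    rw [hl, hz]
    exact map_zero _

end SheafSection

end

noncomputable section

namespace SheafSection

open MorseSheaf

variable {X : TopCat.{u}} {F : TopCat.Sheaf AddCommGrpCat.{u} X} {U V W : Opens X}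

/-! ### Sheaves that are locally generated by a nowhere torsion global section -/

/-- The global section `u` of `F` exhibits `F` as a constant sheaf with fibre `ℤ`. -/
structure IsGenerator (F : TopCat.Sheaf AddCommGrpCat.{u} X) (u : Sec F ⊤) : Prop where
  local_eq : ∀ (V : Opens X) (σ : Sec F V), ∀ p ∈ V, ∃ (V' : Opens X) (h : V' ≤ V) (k : ℤ),
    p ∈ V' ∧ res F h σ = k • res F le_top u
  eq_zero : ∀ (V : Opens X) (k : ℤ), (V : Set X).Nonempty → k • res F (le_top : V ≤ ⊤) u = 0 → k = 0

variable {u : Sec F ⊤}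

/-- The local coefficient of `σ` with respect to `u` is unique on nonempty sets, hence locally
constant: the loci where it equals `k` and where it differs from `k` are open, disjoint and cover
the connected set `V`. -/
lemma IsGenerator.exists_eq_zsmul (hu : IsGenerator F u) (hV : IsPreconnected (V : Set X))
    (σ : Sec F V) : ∃ k : ℤ, σ = k • res F le_top u := by
  rcases (V : Set X).eq_empty_or_nonempty with h | ⟨p, hp⟩
  · exact ⟨0, sec_ext fun x hx => absurd hx (h ▸ notMem_empty x : x ∉ (V : Set X))⟩
  obtain ⟨V₀, hV₀, k, hpV₀, hk⟩ := hu.local_eq V σ p hp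
  let A : Set X := {x | ∃ (V' : Opens X) (h : V' ≤ V), x ∈ V' ∧ res F h σ = k • res F le_top u}
  let B : Set X := {x | ∃ (V' : Opens X) (h : V' ≤ V) (m : ℤ),
    m ≠ k ∧ x ∈ V' ∧ res F h σ = m • res F le_top u}
  have hA : IsOpen A := isOpen_iff_mem_nhds.2 fun x ⟨V', h, hx, e⟩ =>
    mem_of_superset (V'.isOpen.mem_nhds hx) fun y hy => ⟨V', h, hy, e⟩
  have hB : IsOpen B := isOpen_iff_mem_nhds.2 fun x ⟨V', h, m, hm, hx, e⟩ =>
    mem_of_superset (V'.isOpen.mem_nhds hx) fun y hy => ⟨V', h, m, hm, hy, e⟩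
  have hAB : (V : Set X) ⊆ A ∪ B := by
    intro x hx
    obtain ⟨V', h, m, hx', e⟩ := hu.local_eq V σ x hx
    by_cases hm : m = k
    · exact Or.inl ⟨V', h, hx', hm ▸ e⟩
    · exact Or.inr ⟨V', h, m, hm, hx', e⟩
  have hVB : (V ∩ B : Set X) = ∅ := by
    by_contra hne
    obtain ⟨x, -, ⟨V₁, h₁, hx₁, e₁⟩, ⟨V₂, h₂, m, hm, hx₂, e₂⟩⟩ :=
      hV A B hA hB hAB ⟨p, hp, V₀, hV₀, hpV₀, hk⟩ (nonempty_iff_ne_empty.2 hne)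
    apply hm
    have e₁' := congrArg (res F (inf_le_left : V₁ ⊓ V₂ ≤ V₁)) e₁
    have e₂' := congrArg (res F (inf_le_right : V₁ ⊓ V₂ ≤ V₂)) e₂
    simp only [map_zsmul, res_res] at e₁' e₂'
    have := hu.eq_zero (V₁ ⊓ V₂) (m - k) ⟨x, hx₁, hx₂⟩ (by
      rw [sub_smul, ← e₁', ← e₂', sub_self])
    omega
  refine ⟨k, sec_ext fun x hx => ?_⟩
  rcases hAB hx with ⟨V', h, hx', e⟩ | h
  · exact ⟨V', h, hx', by rw [e, map_zsmul, res_res]⟩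
  · exact (hVB.le ⟨hx, h⟩).elim

/-- Unique continuation: `σ` has one integral coefficient on all of `V`, and its value is detected
on any nonempty open subset. -/
lemma IsGenerator.eq_zero_of_res (hu : IsGenerator F u) (hV : IsPreconnected (V : Set X))
    (h : W ≤ V) (hW : (W : Set X).Nonempty) {σ : Sec F V} (hσ : res F h σ = 0) : σ = 0 := by
  obtain ⟨k, rfl⟩ := hu.exists_eq_zsmul hV σ
  rw [map_zsmul, res_res] at hσ
  rw [hu.eq_zero W k hW hσ, zero_smul]

/-- The constant section `1` of the constant sheaf. -/
def constOne (X : TopCat.{u}) : Sec (constZ X) ⊤ :=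
  ((toSheafify (Opens.grothendieckTopology X) ((Functor.const (Opens X)ᵒᵖ).obj
    (AddCommGrpCat.of (ULift.{u} ℤ)))).app (op ⊤)).hom (ULift.up 1)

/-- The unit of sheafification is locally surjective and locally injective; these are the two axioms
of `IsGenerator`. -/
lemma isGenerator_constOne (X : TopCat.{u}) : IsGenerator (constZ X) (constOne X) := by
  let P : (Opens X)ᵒᵖ ⥤ AddCommGrpCat.{u} :=
    (Functor.const (Opens X)ᵒᵖ).obj (AddCommGrpCat.of (ULift.{u} ℤ))
  let η := toSheafify (Opens.grothendieckTopology X) P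
  have hη : ∀ (V : Opens X) (k : ℤ),
      (η.app (op V)).hom (ULift.up k) = k • res (constZ X) le_top (constOne X) := by
    intro V k
    have h₁ : (ULift.up k : ULift.{u} ℤ) = k • ULift.up 1 := by
      ext; simp
    have h₂ : (η.app (op V)).hom (ULift.up 1) = res (constZ X) le_top (constOne X) :=
      ConcreteCategory.congr_hom (η.naturality (homOfLE (le_top : V ≤ ⊤)).op)
        (ULift.up 1 : ULift.{u} ℤ)
    rw [h₁, ← h₂]
    exact map_zsmul (η.app (op V)).hom k (ULift.up 1 : ULift.{u} ℤ)
  constructor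
  · intro V σ p hp
    have hs : Presheaf.IsLocallySurjective (Opens.grothendieckTopology X) η := inferInstance
    obtain ⟨V', i, ⟨t, ht⟩, hp'⟩ := hs.imageSieve_mem σ p hp
    exact ⟨V', leOfHom i, t.down, hp', ht.symm.trans (hη V' t.down)⟩
  · rintro V k ⟨p, hp⟩ h
    have hi : Presheaf.IsLocallyInjective (Opens.grothendieckTopology X) η := inferInstance
    have := hi.equalizerSieve_mem (X := op V) (ULift.up k : ULift.{u} ℤ) (ULift.up 0)
      (by
        refine (hη V k).trans (h.trans ?_)
        exact (map_zero (η.app (op V)).hom).symm)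
    obtain ⟨V', i, hi, -⟩ := this p hp
    exact congrArg ULift.down hi

lemma IsGenerator.pushforward {Y : TopCat.{u}} (f : X ⟶ Y) (hf : IsHomeomorph f)
    (hu : IsGenerator F u) :
    IsGenerator ((TopCat.Sheaf.pushforward AddCommGrpCat.{u} f).obj F) u := by
  constructor
  · intro V σ p hp
    obtain ⟨q, rfl⟩ := hf.surjective p
    obtain ⟨V', h, k, hq, e⟩ := hu.local_eq ((Opens.map f).obj V) σ q hp
    have hle : (Opens.map f).obj ⟨f '' V', hf.isOpenMap _ V'.isOpen⟩ ≤ V' := by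
      rintro x ⟨y, hy, hxy⟩
      exact hf.injective hxy ▸ hy
    refine ⟨⟨f '' V', hf.isOpenMap _ V'.isOpen⟩, ?_, k, ⟨q, hq, rfl⟩, ?_⟩
    · rintro _ ⟨y, hy, rfl⟩; exact h hy
    · exact (res_res (F := F) hle h σ).symm.trans ((congrArg (res F hle) e).trans
        ((map_zsmul _ _ _).trans (congrArg (k • ·) (res_res (F := F) hle le_top u))))
  · rintro V k ⟨p, hp⟩ h
    obtain ⟨q, rfl⟩ := hf.surjective p
    exact hu.eq_zero ((Opens.map f).obj V) k ⟨q, hp⟩ h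

end SheafSection

end

/-! ### Lifting sections modulo a constant sheaf over open subsets of a tree. -/

noncomputable section

namespace SheafSection

open MorseSheaf

variable {X : TopCat.{u}} {F : TopCat.Sheaf AddCommGrpCat.{u} X} {U V W : Opens X}

/-- Connected components of open sets, as open sets. -/
def componentIn [LocallyConnectedSpace X] (U : Opens X) (x : X) : Opens X :=
  ⟨connectedComponentIn U x, U.isOpen.connectedComponentIn⟩

lemma componentIn_le [LocallyConnectedSpace X] (U : Opens X) (x : X) : componentIn U x ≤ U :=
  connectedComponentIn_subset _ _

lemma mem_componentIn [LocallyConnectedSpace X] {x : X} (hx : x ∈ U) : x ∈ componentIn U x :=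
  mem_connectedComponentIn hx

lemma isPreconnected_componentIn [LocallyConnectedSpace X] (U : Opens X) (x : X) :
    IsPreconnected (componentIn U x : Set X) :=
  isPreconnected_connectedComponentIn

/-- Intersections of open connected sets are connected (as in a tree). -/
def PreconnectedInter (X : Type*) [TopologicalSpace X] : Prop :=
  ∀ A B : Set X, IsOpen A → IsOpen B → IsPreconnected A → IsPreconnected B →
    IsPreconnected (A ∩ B)

lemma glue₂ (s : Sec F V) (t : Sec F W)
    (h : res F (inf_le_left : V ⊓ W ≤ V) s = res F (inf_le_right : V ⊓ W ≤ W) t) :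
    ∃ r : Sec F (V ⊔ W), res F le_sup_left r = s ∧ res F le_sup_right r = t := by
  let A : Bool → Opens X := fun b => bif b then V else W
  obtain ⟨r, hr⟩ := glue (F := F) (U := V ⊔ W) A (by rintro (_ | _); exacts [le_sup_right, le_sup_left])
    (sup_le (le_iSup A true) (le_iSup A false))
    (fun b => match b with
      | true => s
      | false => t) (by
      rintro (_ | _) (_ | _)
      · rfl
      · have hc : W ⊓ V ≤ V ⊓ W := (inf_comm W V).le
        have := congrArg (res F hc) h
        rw [res_res, res_res] at this
        exact this.symm
      · exact h
      · rfl)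
  exact ⟨r, hr true, hr false⟩

variable {S : ShortComplex (TopCat.Sheaf AddCommGrpCat.{u} X)} {u : Sec S.X₁ ⊤}

lemma exists_app_eq_sub (hS : S.ShortExact) {t t' : Sec S.X₂ V}
    (h : app S.g V t = app S.g V t') : ∃ e, app S.f V e = t - t' :=
  have := hS.mono_f
  exists_app_eq hS.exact _ (by rw [map_sub, h, sub_self])

/-- Lifts of `s` over connected open neighbourhoods of `x₀` that agree with `t₀` near `x₀`. -/
structure PointedLift (s : Sec S.X₃ U) (t₀ : Sec S.X₂ V) (x₀ : X) where
  dom : Opens X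
  sec : Sec S.X₂ dom
  pre : IsPreconnected (dom : Set X)
  mem : x₀ ∈ dom
  le : dom ≤ U
  app_eq : app S.g dom sec = res S.X₃ le s
  germ_eq : ∃ (V' : Opens X) (h : V' ≤ dom) (h' : V' ≤ V), x₀ ∈ V' ∧ res _ h sec = res _ h' t₀

/-- The difference of the two lifts on the connected intersection of their domains comes from a
section of the constant sheaf `S.X₁`. It vanishes near `x₀`, hence everywhere by unique
continuation. Therefore all pointed lifts glue to a largest one. -/
lemma PointedLift.compatible (hX : PreconnectedInter X)
    (hS : S.ShortExact) (hu : IsGenerator S.X₁ u) {s : Sec S.X₃ U} {t₀ : Sec S.X₂ V} {x₀ : X}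
    (q q' : PointedLift s t₀ x₀) :
    res S.X₂ (inf_le_left : q.dom ⊓ q'.dom ≤ q.dom) q.sec =
      res S.X₂ (inf_le_right : q.dom ⊓ q'.dom ≤ q'.dom) q'.sec := by
  have := hS.mono_f
  obtain ⟨V₁, h₁, h₁', hx₁, e₁⟩ := q.germ_eq
  obtain ⟨V₂, h₂, h₂', hx₂, e₂⟩ := q'.germ_eq
  obtain ⟨e, he⟩ := exists_app_eq_sub hS (V := q.dom ⊓ q'.dom)
    (t := res S.X₂ inf_le_left q.sec) (t' := res S.X₂ inf_le_right q'.sec)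
    (by rw [app_res, app_res, q.app_eq, q'.app_eq, res_res, res_res])
  have hle : V₁ ⊓ V₂ ≤ q.dom ⊓ q'.dom := inf_le_inf h₁ h₂
  have he0 : e = 0 := by
    refine hu.eq_zero_of_res (hX _ _ q.dom.isOpen q'.dom.isOpen q.pre q'.pre) hle
      ⟨x₀, hx₁, hx₂⟩ ?_
    apply app_injective S.f
    have e₁' := congrArg (res S.X₂ (inf_le_left : V₁ ⊓ V₂ ≤ V₁)) e₁
    have e₂' := congrArg (res S.X₂ (inf_le_right : V₁ ⊓ V₂ ≤ V₂)) e₂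
    rw [res_res, res_res] at e₁' e₂'
    rw [app_res, he, map_sub, res_res, res_res, e₁', e₂', sub_self, map_zero]
  rw [he0, map_zero] at he
  exact sub_eq_zero.1 he.symm

/-- If `S.X₁` is constant, sections of `S.X₃` lift to `S.X₂` over connected components. -/
lemma exists_lift_componentIn [LocallyConnectedSpace X] (hX : PreconnectedInter X)
    (hS : S.ShortExact) (hu : IsGenerator S.X₁ u) (s : Sec S.X₃ U) {x₀ : X} (hx₀ : x₀ ∈ U) :
    ∃ t, app S.g (componentIn U x₀) t = res S.X₃ (componentIn_le U x₀) s := by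
  have := hS.mono_f
  have := hS.epi_g
  obtain ⟨V₀, hV₀, t₀, hxV₀, ht₀⟩ := exists_local_lift S.g s hx₀
  let ι := PointedLift s t₀ x₀
  let A : ι → Opens X := PointedLift.dom
  let D : Opens X := iSup A
  obtain ⟨t, ht⟩ := glue (F := S.X₂) (U := D) A (le_iSup A) le_rfl PointedLift.sec
    (PointedLift.compatible hX hS hu)
  have hDU : D ≤ U := iSup_le PointedLift.le
  have htg : app S.g D t = res S.X₃ hDU s := by
    refine sec_ext fun x hx => ?_
    obtain ⟨q, hq⟩ := Opens.mem_iSup.1 hx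
    refine ⟨A q, le_iSup A q, hq, ?_⟩
    rw [← app_res, ht q, q.app_eq, res_res]
  have hx₀D : x₀ ∈ D ∧ ∃ (V' : Opens X) (h : V' ≤ D) (h' : V' ≤ V₀), x₀ ∈ V' ∧
      res _ h t = res _ h' t₀ := by
    let q₀ : ι :=
      { dom := componentIn V₀ x₀
        sec := res _ (componentIn_le V₀ x₀) t₀
        pre := isPreconnected_componentIn _ _
        mem := mem_componentIn hxV₀
        le := (componentIn_le _ _).trans hV₀
        app_eq := by rw [app_res, ht₀, res_res]
        germ_eq := ⟨componentIn V₀ x₀, le_rfl, componentIn_le _ _, mem_componentIn hxV₀,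
          by rw [res_res]⟩ }
    have hm : x₀ ∈ A q₀ := mem_componentIn hxV₀
    exact ⟨Opens.mem_iSup.2 ⟨q₀, hm⟩, A q₀, le_iSup A q₀, componentIn_le _ _, hm, ht q₀⟩
  have hDc : IsPreconnected (D : Set X) := by
    rw [show (D : Set X) = ⋃ q, (A q : Set X) from Opens.coe_iSup _]
    exact isPreconnected_iUnion ⟨x₀, mem_iInter.2 PointedLift.mem⟩ PointedLift.pre
  -- The open set `D` meets the connected component at `x₀`, so it suffices that `D` is relatively
  -- closed in it.
  have hCD : componentIn U x₀ ≤ D := by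
    refine (isPreconnected_componentIn U x₀).subset_of_closure_inter_subset D.isOpen
      ⟨x₀, mem_componentIn hx₀, hx₀D.1⟩ ?_
    rintro y ⟨hyD, hyC⟩
    obtain ⟨B₀, hB₀, t', hyB₀, ht'⟩ := exists_local_lift S.g s (componentIn_le U x₀ hyC)
    let B := componentIn B₀ y
    have hBB₀ : B ≤ B₀ := componentIn_le _ _
    have hBc : IsPreconnected (B : Set X) := isPreconnected_componentIn _ _
    have hyB : y ∈ B := mem_componentIn hyB₀
    have hne : ((D ⊓ B : Opens X) : Set X).Nonempty := by
      obtain ⟨z, hz, hz'⟩ := mem_closure_iff.1 hyD B B.isOpen hyB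
      exact ⟨z, hz', hz⟩
    obtain ⟨e, he⟩ := exists_app_eq_sub hS (V := D ⊓ B)
      (t := res S.X₂ inf_le_left t) (t' := res S.X₂ (inf_le_right.trans hBB₀) t')
      (by rw [app_res, app_res, htg, ht', res_res, res_res])
    obtain ⟨k, rfl⟩ := hu.exists_eq_zsmul (hX _ _ D.isOpen B.isOpen hDc hBc) e
    -- On the connected set `D ⊓ B` the lifts `t` and `t'` differ by the constant `k`. Adding this
    -- constant to `t'` on all of `B` makes the two glue, and maximality of `D` gives `y ∈ D`.
    obtain ⟨r, hr₁, hr₂⟩ := glue₂ t (res S.X₂ hBB₀ t' + app S.f B (k • res S.X₁ le_top u)) (by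
      rw [map_add, res_res, ← app_res, map_zsmul, res_res]
      rw [he]; abel)
    have hDBU : D ⊔ B ≤ U := sup_le hDU (hBB₀.trans hB₀)
    obtain ⟨V', h, h', hxV', e'⟩ := hx₀D.2
    let q : ι :=
      { dom := D ⊔ B
        sec := r
        pre := hDc.union' hne hBc
        mem := Or.inl hx₀D.1
        le := hDBU
        app_eq := by
          refine sec_ext fun x hx => ?_
          rcases hx with hx | hx
          · exact ⟨D, le_sup_left, hx, by rw [← app_res, hr₁, htg, res_res]⟩
          · refine ⟨B, le_sup_right, hx, ?_⟩
            rw [← app_res, hr₂, map_add, app_eq_zero_of_comp S.zero, add_zero, app_res, ht',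
              res_res, res_res]
        germ_eq := ⟨V', h.trans le_sup_left, h', hxV', by rw [← e', ← hr₁, res_res]⟩ }
    exact Opens.mem_iSup.2 ⟨q, Or.inr hyB⟩
  exact ⟨res S.X₂ hCD t, by rw [app_res, htg, res_res]⟩

/-- If `S.X₁` is constant, sections of `S.X₃` over open subsets of a tree lift to `S.X₂`. -/
lemma exists_lift_of_isGenerator [LocallyConnectedSpace X] (hX : PreconnectedInter X)
    (hS : S.ShortExact) (hu : IsGenerator S.X₁ u) (s : Sec S.X₃ U) :
    ∃ t, app S.g U t = s := by
  let ι := {A : Opens X // ∃ x ∈ U, A = componentIn U x}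
  have hle : ∀ q : ι, q.1 ≤ U := by
    rintro ⟨_, x, -, rfl⟩; exact componentIn_le U x
  have hl : ∀ q : ι, ∃ t, app S.g q.1 t = res S.X₃ (hle q) s := by
    rintro ⟨_, x, hx, rfl⟩; exact exists_lift_componentIn hX hS hu s hx
  choose t ht using hl
  have hcov : U ≤ iSup fun q : ι => q.1 := fun x hx =>
    Opens.mem_iSup.2 ⟨⟨_, x, hx, rfl⟩, mem_componentIn hx⟩
  obtain ⟨r, hr⟩ := glue (F := S.X₂) (U := U) (fun q : ι => q.1) hle hcov t (by
    intro q q'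
    by_cases h : q = q'
    · subst h; rfl
    refine sec_ext fun x hx => absurd ?_ h
    obtain ⟨A, y, hy, rfl⟩ := q
    obtain ⟨A', y', hy', rfl⟩ := q'
    have h₁ : connectedComponentIn (U : Set X) y = _ := connectedComponentIn_eq hx.1
    have h₂ : connectedComponentIn (U : Set X) y' = _ := connectedComponentIn_eq hx.2
    exact Subtype.ext (Opens.ext (h₁.trans h₂.symm)))
  refine ⟨r, sec_ext fun x hx => ?_⟩
  obtain ⟨q, hq⟩ := Opens.mem_iSup.1 (hcov hx)
  exact ⟨q.1, hle q, hq, by rw [← app_res, hr, ht]⟩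

end SheafSection

end

noncomputable section

namespace SheafSection

open MorseSheaf

variable {X : TopCat.{u}} {F : TopCat.Sheaf AddCommGrpCat.{u} X} {U V W : Opens X}

/-! ### Acyclicity of constant sheaves on trees -/

variable (I : InjectiveResolution F)

/-- The sheaf of cocycles of degree `i` of a resolution. -/
def cocycleSheaf (i : ℕ) : TopCat.Sheaf AddCommGrpCat.{u} X := kernel (I.cocomplex.d i (i + 1))

/-- The inclusion of the cocycles. -/
def cocycleSheafι (i : ℕ) : cocycleSheaf I i ⟶ I.cocomplex.X i :=
  kernel.ι (I.cocomplex.d i (i + 1))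

instance (i : ℕ) : Mono (cocycleSheafι I i) :=
  inferInstanceAs (Mono (kernel.ι (I.cocomplex.d i (i + 1))))

lemma cocycleSheafι_d (i : ℕ) : cocycleSheafι I i ≫ I.cocomplex.d i (i + 1) = 0 :=
  kernel.condition _

/-- The differential, as a map to cocycles. -/
def toCocycleSheaf (i : ℕ) : I.cocomplex.X i ⟶ cocycleSheaf I (i + 1) :=
  kernel.lift _ (I.cocomplex.d i (i + 1)) (I.cocomplex.d_comp_d _ _ _)

lemma toCocycleSheaf_ι (i : ℕ) :
    toCocycleSheaf I i ≫ cocycleSheafι I (i + 1) = I.cocomplex.d i (i + 1) :=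
  kernel.lift_ι _ _ _

instance (i : ℕ) : Epi (toCocycleSheaf I i) := (I.exact_succ i).epi_kernelLift

/-- The augmentation of a resolution. -/
def aug : F ⟶ I.cocomplex.X 0 := I.ι.f 0

instance : Mono (aug I) := inferInstanceAs (Mono (I.ι.f 0))

lemma aug_d : aug I ≫ I.cocomplex.d 0 1 = 0 := I.ι_f_zero_comp_complex_d

lemma comp_toCocycleSheaf {G : TopCat.Sheaf AddCommGrpCat.{u} X} {i : ℕ}
    (φ : G ⟶ I.cocomplex.X i) (h : φ ≫ I.cocomplex.d i (i + 1) = 0) :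
    φ ≫ toCocycleSheaf I i = 0 := by
  refine (cancel_mono (cocycleSheafι I (i + 1))).1 ?_
  rw [Category.assoc, toCocycleSheaf_ι, h, zero_comp]

lemma shortExact_zero :
    (ShortComplex.mk (aug I) (toCocycleSheaf I 0) (comp_toCocycleSheaf I _ (aug_d I))).ShortExact
    where
  exact := ShortComplex.exact_of_f_is_kernel _
    (isKernelOfComp _ _ I.isLimitKernelFork (comp_toCocycleSheaf I _ (aug_d I))
      (toCocycleSheaf_ι I 0))
  mono_f := inferInstanceAs (Mono (aug I))
  epi_g := inferInstanceAs (Epi (toCocycleSheaf I 0))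

lemma shortExact_succ (i : ℕ) :
    (ShortComplex.mk (cocycleSheafι I i)
      (toCocycleSheaf I i) (comp_toCocycleSheaf I _ (cocycleSheafι_d I _))).ShortExact where
  exact := ShortComplex.exact_of_f_is_kernel _
    (isKernelOfComp _ _ (kernelIsKernel (I.cocomplex.d i (i + 1))) (comp_toCocycleSheaf I _ (cocycleSheafι_d I _))
      (toCocycleSheaf_ι I i))
  mono_f := inferInstanceAs (Mono (cocycleSheafι I i))
  epi_g := inferInstanceAs (Epi (toCocycleSheaf I i))

lemma exists_extension_injective (i : ℕ) (h : V ≤ U) (s : Sec (I.cocomplex.X i) V) :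
    ∃ t, res (I.cocomplex.X i) h t = s :=
  have := I.injective i
  have := isFlasque_of_injective (I.cocomplex.X i)
  exists_extension h s

lemma app_aug_d (s : Sec F V) : app (I.cocomplex.d 0 1) V (app (aug I) V s) = 0 :=
  app_eq_zero_of_comp (aug_d I) s

lemma res_app_aug (h : V ≤ U) (s : Sec F U) :
    res _ h (app (aug I) U s) = app (aug I) V (res F h s) := (app_res _ _ _).symm

lemma app_d_d (i j k : ℕ) (s : Sec (I.cocomplex.X i) V) :
    app (I.cocomplex.d j k) V (app (I.cocomplex.d i j) V s) = 0 :=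
  app_eq_zero_of_comp (I.cocomplex.d_comp_d i j k) s

lemma exists_aug_eq {σ : Sec (I.cocomplex.X 0) V} (h : app (I.cocomplex.d 0 1) V σ = 0) :
    ∃ s : Sec F V, app (aug I) V s = σ := by
  have hm := (shortExact_zero I).mono_f
  refine exists_app_eq (shortExact_zero I).exact σ ?_
  apply app_injective (cocycleSheafι I (0 + 1))
  refine Eq.trans ?_ (map_zero _).symm
  exact (congrArg (fun ψ => app ψ V σ) (toCocycleSheaf_ι I 0)).trans h

lemma exists_local_d_eq {i : ℕ} {σ : Sec (I.cocomplex.X (i + 1)) U}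
    (h : app (I.cocomplex.d (i + 1) (i + 2)) U σ = 0) {x : X} (hx : x ∈ U) :
    ∃ (V : Opens X) (hV : V ≤ U) (τ : Sec (I.cocomplex.X i) V), x ∈ V ∧
      app (I.cocomplex.d i (i + 1)) V τ = res _ hV σ :=
  exists_local_app_eq (I.exact_succ i) σ h hx

variable {u : Sec F ⊤}

/-- The first cocycle sheaf is the quotient of the flasque sheaf `I⁰` by `F`, and its sections lift
to `I⁰` because `F` is constant and the space is tree-like; the lift extends and is projected back.
From then on each cocycle sheaf is a quotient of a flasque sheaf by a flasque one. -/
lemma isFlasque_cocycleSheaf [LocallyConnectedSpace X] (hX : PreconnectedInter X)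
    (hu : IsGenerator F u) (i : ℕ) : (cocycleSheaf I (i + 1)).IsFlasque := by
  induction i with
  | zero =>
    refine isFlasque_of_extension fun U V h s => ?_
    obtain ⟨t, ht⟩ := exists_lift_of_isGenerator hX (shortExact_zero I) hu s
    obtain ⟨t', rfl⟩ := exists_extension_injective I 0 h t
    exact ⟨app (toCocycleSheaf I 0) U t', by rw [← app_res]; exact ht⟩
  | succ i ih =>
    refine isFlasque_of_extension fun U V h s => ?_
    have hfl : TopCat.Sheaf.IsFlasque (ShortComplex.mk (cocycleSheafι I (i + 1)) _
      (comp_toCocycleSheaf I _ (cocycleSheafι_d I _))).X₁ := ih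
    obtain ⟨t, ht⟩ := exists_app_eq_of_isFlasque (shortExact_succ I (i + 1)) s
    obtain ⟨t', rfl⟩ := exists_extension_injective I (i + 1) h t
    exact ⟨app (toCocycleSheaf I (i + 1)) U t', by rw [← app_res]; exact ht⟩

/-- The positive cohomology of a constant sheaf on an open subset of a tree vanishes. -/
lemma exists_d_eq [LocallyConnectedSpace X] (hX : PreconnectedInter X)
    (hu : IsGenerator F u) {i : ℕ} {σ : Sec (I.cocomplex.X (i + 1)) V}
    (h : app (I.cocomplex.d (i + 1) (i + 2)) V σ = 0) :
    ∃ τ, app (I.cocomplex.d i (i + 1)) V τ = σ := by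
  obtain ⟨s, rfl⟩ := exists_app_eq (S := ShortComplex.mk (cocycleSheafι I (i + 1))
    (I.cocomplex.d (i + 1) (i + 2)) (cocycleSheafι_d I _))
    (ShortComplex.exact_of_f_is_kernel _ (kernelIsKernel _)) σ h
  have : ∃ τ, app (toCocycleSheaf I i) V τ = s := by
    cases i with
    | zero => exact exists_lift_of_isGenerator hX (shortExact_zero I) hu s
    | succ i =>
      have hfl : TopCat.Sheaf.IsFlasque (ShortComplex.mk (cocycleSheafι I (i + 1)) _
        (comp_toCocycleSheaf I _ (cocycleSheafι_d I _))).X₁ := isFlasque_cocycleSheaf I hX hu i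
      exact exists_app_eq_of_isFlasque (shortExact_succ I (i + 1)) s
  obtain ⟨τ, rfl⟩ := this
  exact ⟨τ, (congrArg (fun ψ => app ψ V τ) (toCocycleSheaf_ι I i)).symm⟩

/-! ### Local cohomology of constant sheaves on trees -/

/-- The stalk at `p` of `R^i Γ_Z F`. -/
abbrev localCohomology (F : TopCat.Sheaf AddCommGrpCat.{u} X) (W : Opens X) (p : X) (i : ℕ) :
    AddCommGrpCat.{u} :=
  (((supportedSections W).rightDerived i).obj F).presheaf.stalk p

/-- This is the sequence `H^{i+1}(V ∩ W) → H^{i+2}_Z(V) → H^{i+2}(V)` with both ends zero. A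
primitive `τ` of the cocycle is closed on `V ∩ W`, hence equals some `dη` there; after extending `η`
to `V`, the primitive `τ - dη` vanishes on `W`. -/
lemma localCohomology_subsingleton_of_two_le [LocallyConnectedSpace X] (hX : PreconnectedInter X)
    (hu : IsGenerator F u) (W : Opens X) (p : X) (i : ℕ) :
    Subsingleton (localCohomology F W p (i + 2)) := by
  let I := injectiveResolution F
  obtain ⟨φ, -, hsurj, hzero⟩ := exists_cocycle_class I W (i + 2) p
  refine subsingleton_of_forall_eq 0 fun s => ?_
  obtain ⟨V, hV, ⟨σ, hσ, hσW⟩, rfl⟩ := hsurj s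
  obtain ⟨τ, hτ⟩ := exists_d_eq I hX hu (i := i + 1) hσ
  obtain ⟨η, hη⟩ := exists_d_eq I hX hu (V := V ⊓ W) (i := i) (σ := res _ inf_le_left τ) (by
    rw [app_res, hτ]; exact hσW)
  obtain ⟨η, rfl⟩ := exists_extension_injective I i (inf_le_left : V ⊓ W ≤ V) η
  refine hzero (i + 1) V hV _ (τ - app (I.cocomplex.d i (i + 1)) V η) ?_ ?_
  · rw [map_sub, ← app_res, hη, sub_self]
  · rw [map_sub, app_d_d, sub_zero]
    exact hτ

/-- Every connected neighbourhood of `p` meets `W`, so a section of `F` vanishing on `W` is zero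
there by unique continuation. -/
lemma localCohomology_zero_subsingleton [LocallyConnectedSpace X]
    (hu : IsGenerator F u) (W : Opens X) (p : X) (hp : p ∈ closure (W : Set X)) :
    Subsingleton (localCohomology F W p 0) := by
  let I := injectiveResolution F
  obtain ⟨φ, hres, hsurj, -⟩ := exists_cocycle_class I W 0 p
  refine subsingleton_of_forall_eq 0 fun s => ?_
  obtain ⟨U, hU, σ, rfl⟩ := hsurj s
  rw [← hres U (componentIn U p) hU (mem_componentIn hU) (componentIn_le U p) σ]
  have hσ' := res_mem_supportedCocycles (componentIn_le U p) σ.2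
  set V := componentIn U p
  obtain ⟨s, hs⟩ := exists_aug_eq I hσ'.1
  have hs0 : s = 0 := by
    refine hu.eq_zero_of_res (W := V ⊓ W) (isPreconnected_componentIn U p) inf_le_left ?_ ?_
    · exact mem_closure_iff.1 hp V V.isOpen (mem_componentIn hU)
    · apply app_injective (aug I)
      rw [map_zero, app_res]
      exact (congrArg _ hs).trans hσ'.2
  have h0 : (⟨_, hσ'⟩ : supportedCocycles I W 0 V) = 0 := by
    refine Subtype.ext (hs.symm.trans ?_)
    rw [hs0, map_zero]; rfl
  rw [h0, map_zero]

/-- The first local cohomology measures the failure of sections on `V ∩ W` to extend to `V`. When `V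
∩ W` is connected they are multiples of the global section `u`, so all of them extend. -/
lemma localCohomology_one_subsingleton (hu : IsGenerator F u) (W : Opens X) (p : X)
    (hW : ∀ U : Opens X, p ∈ U → ∃ V ≤ U, p ∈ V ∧ IsPreconnected ((V ⊓ W : Opens X) : Set X)) :
    Subsingleton (localCohomology F W p 1) := by
  let I := injectiveResolution F
  obtain ⟨φ, hres, hsurj, hzero⟩ := exists_cocycle_class I W 1 p
  refine subsingleton_of_forall_eq 0 fun s => ?_
  obtain ⟨U, hU, σ, rfl⟩ := hsurj s
  obtain ⟨U₁, hU₁, τ, hpU₁, hτ⟩ := exists_local_d_eq I (i := 0) σ.2.1 hU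
  obtain ⟨V, hV, hpV, hVW⟩ := hW U₁ hpU₁
  rw [← hres U V hU hpV (hV.trans hU₁) σ]
  have hσ' := res_mem_supportedCocycles (hV.trans hU₁) σ.2
  obtain ⟨c, hc⟩ := exists_aug_eq I (V := V ⊓ W) (σ := res _ (inf_le_left.trans hV) τ) (by
    rw [app_res, hτ, res_res, ← res_res inf_le_left (hV.trans hU₁)]
    exact hσ'.2)
  obtain ⟨k, rfl⟩ := hu.exists_eq_zsmul hVW c
  refine hzero 0 V hpV _ (res _ hV τ - app (aug I) V (k • res F le_top u)) ?_ ?_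
  · rw [map_sub, res_res, ← hc]
    rw [res_app_aug, map_zsmul (res F inf_le_left), res_res, sub_self]
  · rw [map_sub, app_aug_d, sub_zero, app_res, hτ, res_res]

/-- If the open set `W` looks like a half line near its boundary point `p`, the local cohomology of
a constant sheaf vanishes. -/
theorem isZero_localCohomology [LocallyConnectedSpace X] (hX : PreconnectedInter X)
    (hu : IsGenerator F u) (W : Opens X) (p : X) (hp : p ∈ closure (W : Set X))
    (hW : ∀ U : Opens X, p ∈ U → ∃ V ≤ U, p ∈ V ∧ IsPreconnected ((V ⊓ W : Opens X) : Set X))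
    (i : ℕ) : IsZero (localCohomology F W p i) := by
  have : Subsingleton (localCohomology F W p i) := by
    match i with
    | 0 => exact localCohomology_zero_subsingleton hu W p hp
    | 1 => exact localCohomology_one_subsingleton hu W p hW
    | i + 2 => exact localCohomology_subsingleton_of_two_le hX hu W p i
  exact AddCommGrpCat.isZero_of_subsingleton _

-- The class `e` is the coboundary of the section that is 0 on `A` and `u` on `B`, extended to a
-- global section of `I⁰`. Any section near `p` on `W` is `m u` on `A` and `n u` on `B`; since `m u`
-- extends across `p`, only the jump `n - m` matters.
set_option maxHeartbeats 1000000 in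
lemma exists_cocycle_two_sided (hu : IsGenerator F u) {W A B : Opens X} {p : X}
    (hAB : W = A ⊔ B) (hdisj : A ⊓ B = ⊥)
    (hW : ∀ U : Opens X, p ∈ U → ∃ V ≤ U, p ∈ V ∧ IsPreconnected ((V ⊓ A : Opens X) : Set X) ∧
      IsPreconnected ((V ⊓ B : Opens X) : Set X)) :
    ∃ e ∈ supportedCocycles I W 1 ⊤, ∀ U : Opens X, p ∈ U → ∀ σ ∈ supportedCocycles I W 1 U,
      ∃ (V : Opens X) (h : V ≤ U) (k : ℤ) (τ : Sec (I.cocomplex.X 0) V), p ∈ V ∧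
        res _ (inf_le_left : V ⊓ W ≤ V) τ = 0 ∧
        app (I.cocomplex.d 0 1) V τ = res _ h σ - k • res _ le_top e := by
  subst hAB
  obtain ⟨e, heA, heB⟩ := glue₂ (F := F) (V := A) (W := B) 0 (res F le_top u)
    (by rw [map_zero, res_res]
        refine sec_ext fun x hx => ?_
        exact absurd hx (by rw [hdisj]; exact id))
  obtain ⟨η, hη⟩ := exists_extension_injective I 0 (le_top : A ⊔ B ≤ ⊤) (app (aug I) _ e)
  have hdη : app (I.cocomplex.d 0 1) ⊤ η ∈ supportedCocycles I (A ⊔ B) 1 ⊤ := by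
    refine ⟨app_d_d I 0 1 2 η, ?_⟩
    rw [← app_res, ← res_res (inf_le_right : ⊤ ⊓ (A ⊔ B) ≤ A ⊔ B) le_top, hη, app_res, app_aug_d,
      map_zero]
  refine ⟨_, hdη, fun U hU σ hσ => ?_⟩
  obtain ⟨U₁, hU₁, τ, hpU₁, hτ⟩ := exists_local_d_eq I (i := 0) hσ.1 hU
  obtain ⟨V, hV, hpV, hVA, hVB⟩ := hW U₁ hpU₁
  have hσ' := res_mem_supportedCocycles (hV.trans hU₁) hσ
  obtain ⟨c, hc⟩ := exists_aug_eq I (V := V ⊓ (A ⊔ B)) (σ := res _ (inf_le_left.trans hV) τ) (by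
    rw [app_res, hτ, res_res, ← res_res inf_le_left (hV.trans hU₁)]
    exact hσ'.2)
  obtain ⟨m, hm⟩ := hu.exists_eq_zsmul hVA (res F (inf_le_inf_left V le_sup_left) c)
  obtain ⟨n, hn⟩ := hu.exists_eq_zsmul hVB (res F (inf_le_inf_left V le_sup_right) c)
  have hce : c = m • res F le_top u +
      (n - m) • res F (inf_le_right : V ⊓ (A ⊔ B) ≤ A ⊔ B) e := by
    refine sec_ext fun x hx => ?_
    rcases hx.2 with hxA | hxB
    · refine ⟨V ⊓ A, inf_le_inf_left V le_sup_left, ⟨hx.1, hxA⟩, ?_⟩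
      have h0 : res F (inf_le_right.trans le_sup_left : V ⊓ A ≤ A ⊔ B) e = 0 := by
        rw [← res_res inf_le_right le_sup_left, heA, map_zero]
      rw [map_add, map_zsmul, map_zsmul, res_res, res_res, hm, h0, smul_zero, add_zero]
    · refine ⟨V ⊓ B, inf_le_inf_left V le_sup_right, ⟨hx.1, hxB⟩, ?_⟩
      have h0 : res F (inf_le_right.trans le_sup_right : V ⊓ B ≤ A ⊔ B) e = res F le_top u := by
        rw [← res_res inf_le_right le_sup_right, heB, res_res]
      rw [map_add, map_zsmul, map_zsmul, res_res, res_res, hn, h0, ← add_smul, add_sub_cancel]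
  -- The primitive `τ` is corrected by `m u`, which is closed, and by `(n - m) η`; the result
  -- vanishes on `W`, and its coboundary has changed by `(n - m) dη` only.
  refine ⟨V, hV.trans hU₁, n - m, res _ hV τ - app (aug I) V (m • res F le_top u) -
    (n - m) • res _ le_top η, hpV, ?_, ?_⟩
  · have h₂ : res (I.cocomplex.X 0) (le_top : V ⊓ (A ⊔ B) ≤ ⊤) η =
        app (aug I) (V ⊓ (A ⊔ B)) (res F inf_le_right e) := by
      rw [← res_res inf_le_right le_top, hη, res_app_aug]
    rw [map_sub, map_sub, map_zsmul (res (I.cocomplex.X 0) _), res_res, res_res, ← hc, res_app_aug,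
      h₂, map_zsmul (res F _), res_res]
    rw [hce, map_add, map_zsmul (app (aug I) _) (n - m), add_sub_cancel_left, sub_self]
  · have hlin : ∀ (f : Sec (I.cocomplex.X 0) V →+ Sec (I.cocomplex.X 1) V)
        (a b c : Sec (I.cocomplex.X 0) V), f b = 0 →
        f (a - b - (n - m) • c) = f a - (n - m) • f c := fun f a b c hb => by
      rw [map_sub, map_sub, hb, sub_zero, map_zsmul]
    refine (hlin _ _ _ _ (app_aug_d I _)).trans ?_
    have h₁ : app (I.cocomplex.d 0 1) V (res _ hV τ) = res _ (hV.trans hU₁) σ := by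
      rw [app_res]
      exact (congrArg _ hτ).trans (res_res _ _ _)
    rw [h₁, app_res]

/-- If `W` is the union of two disjoint half lines near `p`, the first local cohomology of
a constant sheaf is cyclic. -/
lemma localCohomology_one_cyclic (hu : IsGenerator F u) {W A B : Opens X} {p : X}
    (hAB : W = A ⊔ B) (hdisj : A ⊓ B = ⊥)
    (hW : ∀ U : Opens X, p ∈ U → ∃ V ≤ U, p ∈ V ∧ IsPreconnected ((V ⊓ A : Opens X) : Set X) ∧
      IsPreconnected ((V ⊓ B : Opens X) : Set X)) :
    ∃ e : localCohomology F W p 1, ∀ s, ∃ k : ℤ, s = k • e := by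
  let I := injectiveResolution F
  obtain ⟨φ, hres, hsurj, hzero⟩ := exists_cocycle_class I W 1 p
  obtain ⟨e, he, h⟩ := exists_cocycle_two_sided I hu hAB hdisj hW
  refine ⟨φ ⊤ trivial ⟨e, he⟩, fun s => ?_⟩
  obtain ⟨U, hU, σ, rfl⟩ := hsurj s
  obtain ⟨V, hVU, k, τ, hpV, hτ, hd⟩ := h U hU σ.1 σ.2
  refine ⟨k, ?_⟩
  let x : supportedCocycles I W 1 V := ⟨_, res_mem_supportedCocycles hVU σ.2⟩
  let y : supportedCocycles I W 1 V := ⟨_, res_mem_supportedCocycles (le_top : V ≤ ⊤) he⟩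
  have hx : φ V hpV x = φ U hU σ := hres U V hU hpV hVU σ
  have hy : φ V hpV y = φ ⊤ trivial ⟨e, he⟩ := hres ⊤ V trivial hpV le_top ⟨e, he⟩
  have h₀ : φ V hpV (x - k • y) = 0 := hzero 0 V hpV (x - k • y) τ hτ (by
    rw [AddSubgroup.coe_sub, AddSubgroup.coe_zsmul]
    exact hd)
  rw [map_sub, map_zsmul, hx, hy, sub_eq_zero] at h₀
  exact h₀

/-- For `W = ∅` there is no support condition, so degree 0 is generated by the germ of `u`. -/
lemma localCohomology_bot_zero_cyclic (hu : IsGenerator F u) (p : X) :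
    ∃ e : localCohomology F ⊥ p 0, ∀ s, ∃ k : ℤ, s = k • e := by
  let I := injectiveResolution F
  obtain ⟨φ, hres, hsurj, -⟩ := exists_cocycle_class I ⊥ 0 p
  have hι : ∀ (V : Opens X) (s : Sec F V), app (aug I) V s ∈ supportedCocycles I ⊥ 0 V :=
    fun V s => ⟨app_aug_d I s, sec_ext fun x hx => absurd hx.2 id⟩
  refine ⟨φ ⊤ trivial ⟨_, hι ⊤ u⟩, fun s => ?_⟩
  obtain ⟨U, hU, σ, rfl⟩ := hsurj s
  obtain ⟨s, hs⟩ := exists_aug_eq I σ.2.1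
  obtain ⟨V, hV, k, hpV, hk⟩ := hu.local_eq U s p hU
  refine ⟨k, ?_⟩
  rw [← hres U V hU hpV hV σ, ← hres ⊤ V trivial hpV le_top, ← map_zsmul]
  congr 1
  refine Subtype.ext ?_
  change res _ hV σ.1 = k • res _ le_top (app (aug I) ⊤ u)
  rw [← hs]
  refine (app_res (aug I) _ _).symm.trans ?_
  rw [hk, map_zsmul]
  exact congrArg _ (app_res (aug I) _ _)

/-- With no support condition the complex is the resolution itself, which is locally exact in
positive degrees. -/
lemma localCohomology_bot_succ_subsingleton (F : TopCat.Sheaf AddCommGrpCat.{u} X) (p : X)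
    (i : ℕ) : Subsingleton (localCohomology F ⊥ p (i + 1)) := by
  let I := injectiveResolution F
  obtain ⟨φ, hres, hsurj, hzero⟩ := exists_cocycle_class I ⊥ (i + 1) p
  refine subsingleton_of_forall_eq 0 fun s => ?_
  obtain ⟨U, hU, σ, rfl⟩ := hsurj s
  obtain ⟨V, hV, τ, hpV, hτ⟩ := exists_local_d_eq I σ.2.1 hU
  rw [← hres U V hU hpV hV σ]
  exact hzero i V hpV _ τ (sec_ext fun x hx => absurd hx.2 id) hτ

end SheafSection

end

noncomputable section

namespace MorseSheaf

open SheafSection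

/-! ### Local Morse data of constant sheaves on intervals -/

variable {X : TopCat.{u}} {F : TopCat.Sheaf AddCommGrpCat.{u} X} {u : Sec F ⊤}

/-- Connected subsets of `ℝ` are the order-connected ones, and these are stable under intersection.
-/
lemma preconnectedInter_of_isOpenEmbedding {φ : X → ℝ} (hφ : IsOpenEmbedding φ) :
    PreconnectedInter X := by
  intro A B _ _ hA hB
  rw [← hφ.isInducing.isPreconnected_image, isPreconnected_iff_ordConnected] at hA hB ⊢
  rw [image_inter hφ.injective]
  exact hA.inter hB

lemma exists_ball_preimage {φ : X → ℝ} (hφ : IsOpenEmbedding φ) {p : X} {s : Set X}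
    (hs : s ∈ 𝓝 p) : ∃ ε > 0, Metric.ball (φ p) ε ⊆ range φ ∧ φ ⁻¹' Metric.ball (φ p) ε ⊆ s := by
  have : φ '' s ∈ 𝓝 (φ p) := hφ.image_mem_nhds.2 hs
  obtain ⟨ε, hε, h⟩ := Metric.mem_nhds_iff.1 this
  refine ⟨ε, hε, h.trans (image_subset_range _ _), fun x hx => ?_⟩
  obtain ⟨y, hy, hyx⟩ := h hx
  exact hφ.injective hyx ▸ hy

lemma isPreconnected_preimage_of_subset_range {φ : X → ℝ} (hφ : IsOpenEmbedding φ) {s : Set ℝ}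
    (hs : s ⊆ range φ) (hc : s.OrdConnected) : IsPreconnected (φ ⁻¹' s) := by
  rw [← hφ.isInducing.isPreconnected_image, image_preimage_eq_of_subset hs]
  exact hc.isPreconnected

/-- The local Morse data of a constant sheaf on an interval vanish for a function that changes
sign at the point. -/
theorem isZero_LMD_of_sign {φ : X → ℝ} (hφ : IsOpenEmbedding φ) (hu : IsGenerator F u)
    {f : X → ℝ} {p : X} (hf : ∀ᶠ y in 𝓝 p, f y < f p ↔ φ y < φ p) (i : ℕ) :
    IsZero (LMD F f p i) := by
  have := hφ.locallyConnectedSpace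
  obtain ⟨ε, hε, hεr, hεf⟩ := exists_ball_preimage hφ hf
  have hmem : ∀ y, φ y ∈ Metric.ball (φ p) ε → (y ∈ sublevel f p ↔ φ y < φ p) := by
    intro y hy
    constructor
    · intro h
      exact (hεf hy).1 (interior_subset (s := {y | f y < f p}) h)
    · intro h
      refine mem_interior.2 ⟨φ ⁻¹' (Metric.ball (φ p) ε ∩ Iio (φ p)), fun z hz => ?_,
        (Metric.isOpen_ball.inter isOpen_Iio).preimage hφ.continuous, hy, h⟩
      exact (hεf hz.1).2 hz.2
  refine isZero_localCohomology (preconnectedInter_of_isOpenEmbedding hφ) hu _ p ?_ ?_ i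
  · refine mem_closure_iff_nhds.2 fun t ht => ?_
    obtain ⟨δ, hδ, hδr, hδt⟩ := exists_ball_preimage hφ ht
    have hm : 0 < min δ ε := lt_min hδ hε
    have hb : ∀ r, min δ ε ≤ r → φ p - min δ ε / 2 ∈ Metric.ball (φ p) r := by
      intro r hr
      rw [Metric.mem_ball, Real.dist_eq, sub_sub_cancel_left, abs_neg, abs_of_pos (half_pos hm)]
      linarith
    obtain ⟨y, hy⟩ := hδr (hb δ (min_le_left _ _))
    refine ⟨y, hδt ?_, (hmem y ?_).2 ?_⟩
    · rw [mem_preimage, hy]; exact hb δ (min_le_left _ _)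
    · rw [hy]; exact hb ε (min_le_right _ _)
    · rw [hy]; linarith
  · intro U hU
    obtain ⟨δ, hδ, hδr, hδU⟩ := exists_ball_preimage hφ
      (inter_mem (U.isOpen.mem_nhds hU) (hφ.continuous.continuousAt (Metric.ball_mem_nhds (φ p) hε)))
    refine ⟨⟨φ ⁻¹' Metric.ball (φ p) δ, Metric.isOpen_ball.preimage hφ.continuous⟩,
      fun x hx => (hδU hx).1, Metric.mem_ball_self hδ, ?_⟩
    have : φ ⁻¹' Metric.ball (φ p) δ ∩ sublevel f p =
        φ ⁻¹' (Metric.ball (φ p) δ ∩ Iio (φ p)) := by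
      ext y
      exact and_congr_right fun hy => hmem y (hδU hy).2
    change IsPreconnected (φ ⁻¹' Metric.ball (φ p) δ ∩ sublevel f p : Set X)
    rw [this]
    refine isPreconnected_preimage_of_subset_range hφ (inter_subset_left.trans hδr) ?_
    rw [Real.ball_eq_Ioo]
    exact ordConnected_Ioo.inter ordConnected_Iio

/-- A finiteness condition on the local Morse data at a point. -/
def CyclicLMD (F : TopCat.Sheaf AddCommGrpCat.{u} X) (f : X → ℝ) (p : X) : Prop :=
  (∀ i, ∃ e : LMD F f p i, ∀ s, ∃ k : ℤ, s = k • e) ∧ ∀ i, Subsingleton (LMD F f p (i + 2))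

lemma exists_generator_of_subsingleton {A : Type*} [AddCommGroup A] [Subsingleton A] :
    ∃ e : A, ∀ s, ∃ k : ℤ, s = k • e :=
  ⟨0, fun _ => ⟨0, Subsingleton.elim _ _⟩⟩

/-- At a minimum the open sublevel set is empty, so the local Morse data form the stalk of `F` in
degree 0. The shape of the space plays no role, so vertices of any valence are covered. -/
theorem cyclicLMD_of_min (hu : IsGenerator F u) {f : X → ℝ} {p : X} (hf : ∀ y, f p ≤ f y) :
    CyclicLMD F f p := by
  have h : sublevel f p = ⊥ := by
    refine Opens.ext (subset_empty_iff.1 fun y hy => ?_)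
    exact absurd (interior_subset (s := {y | f y < f p}) hy) (not_lt.2 (hf y))
  have hs : ∀ i, Subsingleton (LMD F f p (i + 1)) := fun i => by
    have := localCohomology_bot_succ_subsingleton F p i
    rw [← h] at this
    exact this
  refine ⟨fun i => ?_, fun i => hs (i + 1)⟩
  cases i with
  | zero =>
    have := localCohomology_bot_zero_cyclic hu p
    rw [← h] at this
    exact this
  | succ i =>
    have := hs i
    exact exists_generator_of_subsingleton

/-- The sublevel set is the complement of `p`, two half lines near `p`, so everything is
concentrated in degree 1. -/
theorem cyclicLMD_of_strict_max {φ : X → ℝ} (hφ : IsOpenEmbedding φ) (hu : IsGenerator F u)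
    {f : X → ℝ} {p : X} (hf : ∀ y, y ≠ p → f y < f p) : CyclicLMD F f p := by
  have := hφ.locallyConnectedSpace
  let A : Opens X := ⟨φ ⁻¹' Iio (φ p), isOpen_Iio.preimage hφ.continuous⟩
  let B : Opens X := ⟨φ ⁻¹' Ioi (φ p), isOpen_Ioi.preimage hφ.continuous⟩
  have hAB : sublevel f p = A ⊔ B := by
    have hset : {y | f y < f p} = φ ⁻¹' Iio (φ p) ∪ φ ⁻¹' Ioi (φ p) := by
      ext y
      constructor
      · intro hy
        refine lt_or_gt_of_ne (a := φ y) (b := φ p) fun h => ?_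
        rw [hφ.injective h] at hy
        exact lt_irrefl (f p) hy
      · intro hy
        refine hf y fun h => ?_
        rw [h] at hy
        exact hy.elim (lt_irrefl (φ p)) (lt_irrefl (φ p))
    refine Opens.ext ?_
    change interior {y | f y < f p} = _
    rw [hset]
    exact (A ⊔ B).isOpen.interior_eq
  have hdisj : A ⊓ B = ⊥ :=
    Opens.ext (subset_empty_iff.1 fun y hy => lt_asymm (a := φ y) (b := φ p) hy.1 hy.2)
  have hclos : p ∈ closure (sublevel f p : Set X) := by
    refine mem_closure_iff_nhds.2 fun t ht => ?_
    obtain ⟨δ, hδ, hδr, hδt⟩ := exists_ball_preimage hφ ht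
    have hb : φ p - δ / 2 ∈ Metric.ball (φ p) δ := by
      rw [Metric.mem_ball, Real.dist_eq, sub_sub_cancel_left, abs_neg, abs_of_pos (half_pos hδ)]
      linarith
    obtain ⟨y, hy⟩ := hδr hb
    refine ⟨y, hδt ?_, ?_⟩
    · rw [mem_preimage, hy]; exact hb
    · rw [hAB]
      left
      change φ y < φ p
      rw [hy]; linarith
  have h2 : ∀ i, Subsingleton (LMD F f p (i + 2)) := fun i =>
    localCohomology_subsingleton_of_two_le (preconnectedInter_of_isOpenEmbedding hφ) hu _ p i
  refine ⟨fun i => ?_, h2⟩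
  match i with
  | 0 =>
    have : Subsingleton (LMD F f p 0) := localCohomology_zero_subsingleton hu _ p hclos
    exact exists_generator_of_subsingleton
  | 1 =>
    refine localCohomology_one_cyclic hu hAB hdisj fun U hU => ?_
    obtain ⟨δ, hδ, hδr, hδU⟩ := exists_ball_preimage hφ (U.isOpen.mem_nhds hU)
    refine ⟨⟨φ ⁻¹' Metric.ball (φ p) δ, Metric.isOpen_ball.preimage hφ.continuous⟩,
      hδU, Metric.mem_ball_self hδ, ?_, ?_⟩
    · change IsPreconnected (φ ⁻¹' (Metric.ball (φ p) δ ∩ Iio (φ p)))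
      refine isPreconnected_preimage_of_subset_range hφ (inter_subset_left.trans hδr) ?_
      rw [Real.ball_eq_Ioo]
      exact ordConnected_Ioo.inter ordConnected_Iio
    · change IsPreconnected (φ ⁻¹' (Metric.ball (φ p) δ ∩ Ioi (φ p)))
      refine isPreconnected_preimage_of_subset_range hφ (inter_subset_left.trans hδr) ?_
      rw [Real.ball_eq_Ioo]
      exact ordConnected_Ioo.inter ordConnected_Ioi
  | i + 2 =>
    have := h2 i
    exact exists_generator_of_subsingleton

/-- The generators in degrees 0 and 1 over the finite set `ι` suffice. -/
lemma finite_directSum_of_cyclic {ι : Type*} [DecidableEq ι] (A : ι × ℕ → Type*)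
    [∀ i, AddCommGroup (A i)] [Finite ι]
    (h₁ : ∀ i, ∃ e : A i, ∀ s, ∃ k : ℤ, s = k • e)
    (h₂ : ∀ i n, Subsingleton (A (i, n + 2))) : Module.Finite ℤ (⨁ i, A i) := by
  choose e he using h₁
  refine ⟨Submodule.fg_def.2 ⟨(fun i => DirectSum.of A i (e i)) '' (univ ×ˢ {0, 1}),
    ((finite_univ.prod (Set.toFinite _)).image _), ?_⟩⟩
  rw [eq_top_iff]
  rintro x -
  induction x using DirectSum.induction_on with
  | zero => exact Submodule.zero_mem _
  | add x y hx hy => exact Submodule.add_mem _ hx hy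
  | of i x =>
    obtain ⟨i, n⟩ := i
    match n with
    | 0 =>
      obtain ⟨k, rfl⟩ := he _ x
      rw [map_zsmul]
      exact Submodule.smul_mem _ _ (Submodule.subset_span ⟨(i, 0), by simp, rfl⟩)
    | 1 =>
      obtain ⟨k, rfl⟩ := he _ x
      rw [map_zsmul]
      exact Submodule.smul_mem _ _ (Submodule.subset_span ⟨(i, 1), by simp, rfl⟩)
    | n + 2 =>
      have := h₂ i n
      rw [Subsingleton.elim x 0, map_zero]
      exact Submodule.zero_mem _

/-! ### The micro-support of the constant sheaf on the line -/

lemma isGenerator_constZOn_univ (E : Type u) [TopologicalSpace E] :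
    IsGenerator (constZOn (univ : Set E)) (constOne (TopCat.of (univ : Set E))) :=
  (isGenerator_constOne (TopCat.of (univ : Set E))).pushforward _
    (Homeomorph.Set.univ E).isHomeomorph

/-- A nonzero derivative makes `ψ - ψ x` have the sign of the coordinate difference, up to a global
sign, so the sublevel set is a half line near `x`. -/
lemma isZero_LMD_of_fderiv_ne_zero {F : TopCat.Sheaf AddCommGrpCat.{0} (TopCat.of (Fin 1 → ℝ))}
    {u : Sec F ⊤} (hu : IsGenerator F u) {ψ : (Fin 1 → ℝ) → ℝ} {x : Fin 1 → ℝ}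
    (hψ : DifferentiableAt ℝ ψ x) (h : fderiv ℝ ψ x ≠ 0) (i : ℕ) : IsZero (LMD F ψ x i) := by
  have hφ : IsOpenEmbedding (fun y : Fin 1 → ℝ => y 0) :=
    (Homeomorph.funUnique (Fin 1) ℝ).isOpenEmbedding
  let c : ℝ → Fin 1 → ℝ := fun t _ => t
  have hc : ∀ y : Fin 1 → ℝ, c (y 0) = y := fun y => by ext j; fin_cases j; rfl
  let d := fderiv ℝ ψ x (fun _ => 1)
  have hd : d ≠ 0 := by
    intro h0
    refine h (ContinuousLinearMap.ext fun v => ?_)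
    have : v = v 0 • (fun _ => 1 : Fin 1 → ℝ) := by ext j; fin_cases j; simp
    rw [this, map_smul]
    exact (congrArg (v 0 • ·) h0).trans (smul_zero _)
  have hder : HasDerivAt (fun t => ψ (c t)) d (x 0) := by
    have h₁ : HasDerivAt c (fun _ => 1) (x 0) := hasDerivAt_pi.2 fun _ => hasDerivAt_id _
    have h₂ : HasFDerivAt ψ (fderiv ℝ ψ x) (c (x 0)) := by rw [hc]; exact hψ.hasFDerivAt
    exact h₂.comp_hasDerivAt (x 0) h₁
  have key : ∀ (g : ℝ → ℝ) (d : ℝ), HasDerivAt g d (x 0) → 0 < d →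
      ∀ᶠ t in 𝓝 (x 0), SignType.sign (g t - g (x 0)) = SignType.sign (t - x 0) := by
    intro g d hg hd
    refine eventually_nhdsWithin_sign_eq_of_deriv_pos (f := fun t => g t - g (x 0)) ?_ (sub_self _)
    rw [(hg.sub_const _).deriv]
    exact hd
  have hcont : Tendsto (fun y : Fin 1 → ℝ => y 0) (𝓝 x) (𝓝 (x 0)) :=
    (continuous_apply 0).continuousAt
  rcases lt_or_gt_of_ne hd with hneg | hpos
  -- For a negative derivative the coordinate is reversed, so that the sublevel set again lies to
  -- its left.
  · refine isZero_LMD_of_sign (X := TopCat.of (Fin 1 → ℝ)) (φ := fun y => -(y 0))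
      ((Homeomorph.neg ℝ).isOpenEmbedding.comp hφ) hu ?_ i
    have := hcont.eventually (key (fun t => -ψ (c t)) (-d) hder.neg (neg_pos.2 hneg))
    filter_upwards [this] with y hy
    rw [hc, hc] at hy
    have h₁ : ψ y < ψ x ↔ SignType.sign (-ψ y - -ψ x) = 1 := by
      rw [sign_eq_one_iff]; constructor <;> intro h <;> linarith
    rw [h₁, hy, sign_eq_one_iff]
    constructor <;> intro h <;> linarith
  · refine isZero_LMD_of_sign (X := TopCat.of (Fin 1 → ℝ)) (φ := fun y => y 0) hφ hu ?_ i
    have := hcont.eventually (key (fun t => ψ (c t)) d hder hpos)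
    filter_upwards [this] with y hy
    rw [hc, hc] at hy
    have h₁ : ψ y < ψ x ↔ SignType.sign (ψ y - ψ x) = -1 := by
      rw [sign_eq_neg_one_iff]; constructor <;> intro h <;> linarith
    rw [h₁, hy, sign_eq_neg_one_iff]
    constructor <;> intro h <;> linarith

/-- The micro-support of the constant sheaf on the line is contained in the zero section. -/
theorem microsupportAt_constZOn_univ_subset (x : Fin 1 → ℝ) :
    microsupportAt (constZOn (univ : Set (Fin 1 → ℝ))) x ⊆ {0} := by
  intro ξ hξ
  by_contra hne
  refine hξ ⟨{q | q.2 ≠ 0}, ?_, ?_⟩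
  · exact (isOpen_ne.preimage continuous_snd).mem_nhds hne
  · intro x₁ V ψ hV hx₁ hψ hN i
    exact isZero_LMD_of_fderiv_ne_zero (isGenerator_constZOn_univ _)
      ((hψ.contDiffAt (hV.mem_nhds hx₁)).differentiableAt (by simp)) hN i

end MorseSheaf

end

noncomputable section

/-! ## Charts of tropical curves -/

namespace Tropical

namespace TropReal

@[simp] lemma exp_bot : TropReal.exp ⊥ = 0 := rfl

@[simp] lemma exp_coe (r : ℝ) : TropReal.exp (r : TropReal) = Real.exp r := rfl

@[simp] lemma toReal_bot : TropReal.toReal ⊥ = 0 := rfl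

@[simp] lemma toReal_zero : TropReal.toReal 0 = 0 := rfl

@[simp] lemma toReal_coe (r : ℝ) : TropReal.toReal (r : TropReal) = r := rfl

lemma coe_toReal {t : TropReal} (h : t ≠ ⊥) : (t.toReal : TropReal) = t := by
  induction t using WithBot.recBotCoe with
  | bot => exact absurd rfl h
  | coe r => rfl

lemma exp_eq_zero {t : TropReal} : t.exp = 0 ↔ t = ⊥ := by
  induction t using WithBot.recBotCoe with
  | bot => simp
  | coe r => simp [(Real.exp_pos r).ne']

lemma exp_nonneg (t : TropReal) : 0 ≤ t.exp := by
  induction t using WithBot.recBotCoe with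
  | bot => simp
  | coe r => exact (Real.exp_pos r).le

lemma exp_pos {t : TropReal} (h : t ≠ ⊥) : 0 < t.exp :=
  lt_of_le_of_ne (exp_nonneg t) fun h' => h (exp_eq_zero.1 h'.symm)

lemma log_exp (t : TropReal) : Real.log t.exp = t.toReal := by
  induction t using WithBot.recBotCoe with
  | bot => simp
  | coe r => simp

lemma exp_toReal {t : TropReal} (h : t ≠ ⊥) : Real.exp t.toReal = t.exp := by
  rw [← log_exp, Real.exp_log (exp_pos h)]

lemma exp_strictMono : StrictMono TropReal.exp := by
  intro s t h
  induction t using WithBot.recBotCoe with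
  | bot => exact absurd h not_lt_bot
  | coe r =>
    induction s using WithBot.recBotCoe with
    | bot => exact Real.exp_pos r
    | coe r' => exact Real.exp_lt_exp.2 (WithBot.coe_lt_coe.1 h)

lemma range_exp : range TropReal.exp = Ici 0 := by
  ext x
  constructor
  · rintro ⟨t, rfl⟩; exact exp_nonneg t
  · intro hx
    rcases (mem_Ici.1 hx).eq_or_lt with rfl | h
    · exact ⟨⊥, rfl⟩
    · exact ⟨(Real.log x : ℝ), Real.exp_log h⟩

lemma isEmbedding_exp : IsEmbedding TropReal.exp :=
  exp_strictMono.isEmbedding_of_ordConnected (range_exp ▸ ordConnected_Ici)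

lemma continuous_exp : Continuous TropReal.exp := isEmbedding_exp.continuous

lemma range_coe : range ((↑) : ℝ → TropReal) = {⊥}ᶜ := by
  ext t
  constructor
  · rintro ⟨r, rfl⟩; exact WithBot.coe_ne_bot
  · intro h; exact ⟨TropReal.toReal t, coe_toReal h⟩

lemma isOpenEmbedding_coe : IsOpenEmbedding ((↑) : ℝ → TropReal) := by
  refine ⟨WithBot.coe_strictMono.isEmbedding_of_ordConnected ?_, ?_⟩
  · rw [WithBot.range_coe]; exact ordConnected_Ioi
  · rw [WithBot.range_coe]; exact isOpen_Ioi

lemma continuousAt_toReal {t : TropReal} (h : t ≠ ⊥) : ContinuousAt TropReal.toReal t := by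
  have : TropReal.toReal = fun t => Real.log t.exp := funext fun t => (log_exp t).symm
  rw [this]
  exact (Real.continuousAt_log (exp_pos h).ne').comp continuous_exp.continuousAt

lemma dense_range_coe : DenseRange ((↑) : ℝ → TropReal) := by
  intro t
  induction t using WithBot.recBotCoe with
  | coe r => exact subset_closure ⟨r, rfl⟩
  | bot =>
    refine mem_closure_iff_nhds.2 fun s hs => ?_
    obtain ⟨b, hb, hbs⟩ := exists_Ico_subset_of_mem_nhds hs ⟨(0 : ℝ), WithBot.bot_lt_coe 0⟩
    lift b to ℝ using hb.ne'
    exact ⟨((b - 1 : ℝ) : TropReal), hbs ⟨bot_le, WithBot.coe_lt_coe.2 (by linarith)⟩, b - 1, rfl⟩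

end TropReal

lemma isEmbedding_expMap {n : ℕ} : IsEmbedding (expMap (n := n)) := by
  refine ⟨⟨?_⟩, fun x y h => funext fun i =>
    TropReal.exp_strictMono.injective (congrFun h i)⟩
  have : ∀ i : Fin n, induced (fun x : Fin n → TropReal => x i) inferInstance =
      induced (fun x : Fin n → TropReal => expMap x i) inferInstance := by
    intro i
    rw [TropReal.isEmbedding_exp.eq_induced, induced_compose]
    rfl
  simp only [Pi.topologicalSpace, induced_iInf, induced_compose]
  exact iInf_congr this

lemma continuous_expMap {n : ℕ} : Continuous (expMap (n := n)) := isEmbedding_expMap.continuous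

section Spaces

variable {S : Type u} [TopologicalSpace S] {O : FunctionSheaf S}

namespace Chart

lemma isEmbedding_source (c : Chart O) : IsEmbedding (fun y : c.source => c.toFun y) :=
  IsEmbedding.subtypeVal.comp c.isOpenEmbedding.isEmbedding

lemma continuousOn (c : Chart O) : ContinuousOn c.toFun c.source :=
  continuousOn_iff_continuous_domRestrict.2 c.isEmbedding_source.continuous

lemma continuousAt (c : Chart O) {x : S} (hx : x ∈ c.source) : ContinuousAt c.toFun x :=
  c.continuousOn.continuousAt (c.source.isOpen.mem_nhds hx)

/-- The exponential coordinates of a chart. -/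
def z (c : Chart O) (y : S) : Fin c.dim → ℝ := expMap (c.toFun y)

lemma z_apply (c : Chart O) (y : S) (i : Fin c.dim) : c.z y i = (c.toFun y i).exp := rfl

lemma z_eq_zero (c : Chart O) {y : S} {i : Fin c.dim} : c.z y i = 0 ↔ c.toFun y i = ⊥ :=
  TropReal.exp_eq_zero

lemma continuousAt_z (c : Chart O) {x : S} (hx : x ∈ c.source) : ContinuousAt c.z x :=
  continuous_expMap.continuousAt.comp (c.continuousAt hx)

lemma continuousOn_z (c : Chart O) : ContinuousOn c.z c.source := fun _ hx =>
  (c.continuousAt_z hx).continuousWithinAt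

lemma nhds_eq_comap_z (c : Chart O) {x : S} (hx : x ∈ c.source) :
    𝓝 x = comap c.z (𝓝 (c.z x)) ⊓ 𝓟 c.source := by
  have h := (isEmbedding_expMap.comp c.isEmbedding_source).isInducing.nhds_eq_comap ⟨x, hx⟩
  have h' : 𝓝 x = map ((↑) : c.source → S) (𝓝 ⟨x, hx⟩) :=
    (c.source.isOpen.isOpenEmbedding_subtypeVal.map_nhds_eq ⟨x, hx⟩).symm
  rw [h', h]
  ext s
  simp only [mem_map, mem_comap, mem_inf_principal]
  constructor
  · rintro ⟨t, ht, hts⟩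
    exact ⟨t, ht, fun y hy hys => hts (a := ⟨y, hys⟩) hy⟩
  · rintro ⟨t, ht, hts⟩
    exact ⟨t, ht, fun y hy => hts hy y.2⟩

/-- The restriction of a chart to an open subset. -/
def restrict (c : Chart O) (U : Opens S) : Chart O where
  dim := c.dim
  source := c.source ⊓ U
  toFun := c.toFun
  target := c.target
  target_polyhedral := c.target_polyhedral
  mapsTo y hy := c.mapsTo y hy.1
  isOpenEmbedding := by
    have : IsOpenEmbedding (Opens.toTopCat (TopCat.of S) |>.map
        (homOfLE (inf_le_left : c.source ⊓ U ≤ c.source))) :=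
      Opens.isOpenEmbedding_of_le inf_le_left
    exact c.isOpenEmbedding.comp this
  stalk_iff x hx := c.stalk_iff x hx.1

end Chart

/-! ### One-dimensional charts -/

variable (O) in
/-- A chart of `(S, O)` with an open subset of `ℝ ∪ {-∞}`. -/
structure LineChart where
  source : Opens S
  toFun : S → TropReal
  isOpenEmbedding : IsOpenEmbedding (fun y : source => toFun y)
  stalk_iff : ∀ x ∈ source, ∀ f : S → ℝ, (f : Germ (𝓝 x) ℝ) ∈ O.stalk x ↔
    ∃ (m : ℤ) (a : ℝ), (toFun x = ⊥ → m = 0) ∧ ∀ᶠ y in 𝓝 x, f y = a + m * (toFun y).toReal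

/-- The empty system of inequalities on the finite stratum cuts out `ℝ`, which is dense in `ℝ ∪
{-∞}`. -/
lemma isRationalPolyhedralSet_univ : IsRationalPolyhedralSet (univ : Set (Fin 1 → TropReal)) := by
  refine ⟨1, fun _ => univ, fun _ => ⟨∅, 0, fun _ => 0, fun _ => 0, ?_⟩, (iUnion_const _).symm⟩
  have : {x : Fin 1 → TropReal | (∀ i, x i = ⊥ ↔ i ∈ (∅ : Set (Fin 1))) ∧
      ∀ j : Fin 0, ∑ i, (((0 : Fin 1 → ℤ) i : ℤ) : ℝ) * (x i).toReal ≤ 0} =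
      univ.pi fun _ => range ((↑) : ℝ → TropReal) := by
    ext x
    simp [TropReal.range_coe]
  refine Eq.trans ?_ (congrArg closure this).symm
  rw [closure_pi_set]
  simp [TropReal.dense_range_coe.closure_range]

namespace LineChart

/-- A line chart as a chart. -/
def toChart (ℓ : LineChart O) : Chart O where
  dim := 1
  source := ℓ.source
  toFun y _ := ℓ.toFun y
  target := univ
  target_polyhedral := isRationalPolyhedralSet_univ
  mapsTo _ _ := trivial
  isOpenEmbedding := by
    have h := (((Homeomorph.funUnique (Fin 1) TropReal).symm.trans
      (Homeomorph.Set.univ _).symm).isOpenEmbedding).comp ℓ.isOpenEmbedding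
    exact h
  stalk_iff x hx f := by
    rw [ℓ.stalk_iff x hx]
    constructor
    · rintro ⟨m, a, h, h'⟩
      exact ⟨fun _ => m, a, fun _ => h, by simpa using h'⟩
    · rintro ⟨m, a, h, h'⟩
      exact ⟨m 0, a, h 0, by simpa using h'⟩

lemma continuousAt (ℓ : LineChart O) {x : S} (hx : x ∈ ℓ.source) : ContinuousAt ℓ.toFun x :=
  (continuousOn_iff_continuous_domRestrict.2 ℓ.isOpenEmbedding.continuous).continuousAt
    (ℓ.source.isOpen.mem_nhds hx)

/-- A line chart obtained from a chart of a one-dimensional piece of its target, parametrized by a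
coordinate. -/
def ofChart (c : Chart O) (j : TropReal → Fin c.dim → TropReal) (hj : Continuous j)
    (i : Fin c.dim) (D : Set TropReal) (hD : IsOpen D) (N : Set (Fin c.dim → TropReal))
    (hN : IsOpen N) (hjt : ∀ t ∈ D, j t ∈ c.target ∩ N) (hji : ∀ t ∈ D, j t i = t)
    (hcN : ∀ w ∈ c.target ∩ N, w i ∈ D ∧ j (w i) = w)
    (n : Fin c.dim → ℤ) (hn : ∀ t ∈ D, ∀ l, (j t l).toReal = n l * t.toReal)
    (hbot : ⊥ ∈ D → ∀ l, n l = 0 ∨ j ⊥ l = ⊥) : LineChart O where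
  source := ⟨c.source ∩ c.toFun ⁻¹' N, c.continuousOn.isOpen_inter_preimage c.source.isOpen hN⟩
  toFun y := c.toFun y i
  isOpenEmbedding := by
    have hinc : IsEmbedding (fun y : (c.source ∩ c.toFun ⁻¹' N : Set S) =>
        (⟨y, y.2.1⟩ : c.source)) :=
      IsEmbedding.subtypeVal.of_comp (by fun_prop) (continuous_subtype_val (p := (· ∈ c.source)))
    have hemb : IsEmbedding (fun y : (c.source ∩ c.toFun ⁻¹' N : Set S) => c.toFun y) :=
      c.isEmbedding_source.comp hinc
    have hcomp : (fun y : (c.source ∩ c.toFun ⁻¹' N : Set S) => c.toFun y) =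
        j ∘ fun y : (c.source ∩ c.toFun ⁻¹' N : Set S) => c.toFun y i :=
      funext fun y => (hcN _ ⟨c.mapsTo y y.2.1, y.2.2⟩).2.symm
    refine ⟨IsEmbedding.of_comp ((continuous_apply i).comp hemb.continuous) hj (hcomp ▸ hemb), ?_⟩
    obtain ⟨G, hG, hGr⟩ := isOpen_induced_iff.1 c.isOpenEmbedding.isOpen_range
    have : range (fun y : (c.source ∩ c.toFun ⁻¹' N : Set S) => c.toFun y i) = D ∩ j ⁻¹' G := by
      ext t
      constructor
      · rintro ⟨y, rfl⟩
        have h := hcN _ ⟨c.mapsTo y y.2.1, y.2.2⟩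
        refine ⟨h.1, ?_⟩
        have hy : (⟨c.toFun y, c.mapsTo y y.2.1⟩ : c.target) ∈ Subtype.val ⁻¹' G := by
          rw [hGr]; exact ⟨⟨y, y.2.1⟩, rfl⟩
        change j (c.toFun y i) ∈ G
        rw [h.2]
        exact hy
      · rintro ⟨htD, htG⟩
        have hy : (⟨j t, (hjt t htD).1⟩ : c.target) ∈ Subtype.val ⁻¹' G := htG
        rw [hGr] at hy
        obtain ⟨y, hy⟩ := hy
        have hy' : c.toFun y = j t := congrArg Subtype.val hy
        refine ⟨⟨y, y.2, ?_⟩, ?_⟩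
        · change c.toFun y ∈ N
          rw [hy']; exact (hjt t htD).2
        · change c.toFun y i = t
          rw [hy', hji t htD]
    exact Eq.mpr (congrArg IsOpen this) (hD.inter (hG.preimage hj))
  stalk_iff x hx f := by
    rw [c.stalk_iff x hx.1]
    have hx' := hcN _ ⟨c.mapsTo x hx.1, hx.2⟩
    have hnear : ∀ᶠ y in 𝓝 x, ∀ l, (c.toFun y l).toReal = n l * (c.toFun y i).toReal := by
      filter_upwards [(c.continuousOn.isOpen_inter_preimage c.source.isOpen hN).mem_nhds hx]
        with y hy l
      have hy' := hcN _ ⟨c.mapsTo y hy.1, hy.2⟩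
      rw [← hn _ hy'.1 l, hy'.2]
    constructor
    · rintro ⟨m, a, hm, h⟩
      -- Coordinate `l` has slope `n l` along the parametrization, so the slopes add up to `∑ m l *
      -- n l`. At `-∞` each term vanishes: either `n l = 0`, or coordinate `l` is also `-∞` and `m l
      -- = 0`.
      refine ⟨∑ l, m l * n l, a, fun hb => Finset.sum_eq_zero fun l _ => ?_, ?_⟩
      · have hx₁ := hx'.1
        rw [hb] at hx₁
        rcases hbot hx₁ l with h0 | h0
        · rw [h0, mul_zero]
        · rw [hm l (by rw [← hx'.2, hb, h0]), zero_mul]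
      · filter_upwards [h, hnear] with y hy hy'
        rw [hy]
        push_cast
        rw [Finset.sum_mul]
        congr 1
        exact Finset.sum_congr rfl fun l _ => by rw [hy' l, mul_assoc]
    · rintro ⟨m, a, hm, h⟩
      refine ⟨Pi.single i m, a, fun l hl => ?_, ?_⟩
      · rcases eq_or_ne l i with rfl | hli
        · simpa using hm hl
        · simp [hli]
      · filter_upwards [h] with y hy
        rw [hy]
        congr 1
        rw [Finset.sum_eq_single i]
        · simp
        · intro l _ hl; simp [hl]
        · simp

end LineChart

end Spaces

end Tropical

end

noncomputable section

/-! ## Normal charts -/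

namespace Tropical

lemma TropReal.exp_int_mul {t : TropReal} (ht : t ≠ ⊥) (m : ℤ) :
    Real.exp (m * t.toReal) = t.exp ^ m := by
  rw [← exp_toReal ht, mul_comm, Real.exp_mul, Real.rpow_intCast]

/-- At a finite `t` the set `I` is an interval around `t`; at `-∞` it is a ray `(-∞, b)` without its
end point. Leaving out `-∞` keeps the coordinate real on `I`, while `t` can still be reached as a
limit. -/
lemma TropReal.exists_isPreconnected {t : TropReal} {N : Set TropReal} (hN : N ∈ 𝓝 t) :
    ∃ I ⊆ N, _root_.IsPreconnected I ∧ ⊥ ∉ I ∧ insert t I ∈ 𝓝 t ∧ t ∈ closure I := by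
  induction t using WithBot.recBotCoe with
  | coe r =>
    rw [← TropReal.isOpenEmbedding_coe.map_nhds_eq r] at hN ⊢
    obtain ⟨ε, hε, hb⟩ := Metric.mem_nhds_iff.1 (mem_map.1 hN)
    refine ⟨(↑) '' Metric.ball r ε, image_subset_iff.2 hb,
      (convex_ball r ε).isPreconnected.image _ WithBot.continuous_coe.continuousOn, ?_, ?_, ?_⟩
    · rintro ⟨s, -, hs⟩
      exact WithBot.coe_ne_bot hs
    · exact mem_of_superset (image_mem_map (Metric.ball_mem_nhds r hε)) (subset_insert _ _)
    · exact subset_closure ⟨r, Metric.mem_ball_self hε, rfl⟩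
  | bot =>
    obtain ⟨b, hb, hbs⟩ := exists_Ico_subset_of_mem_nhds hN ⟨(0 : ℝ), WithBot.bot_lt_coe 0⟩
    have hb' : ((b : TropReal).toReal : TropReal) = b := TropReal.coe_toReal hb.ne'
    refine ⟨(↑) '' Iio (TropReal.toReal b), ?_,
      (convex_Iio _).isPreconnected.image _ WithBot.continuous_coe.continuousOn, ?_, ?_, ?_⟩
    · rintro _ ⟨s, hs, rfl⟩
      refine hbs ⟨bot_le, ?_⟩
      rw [← hb']
      exact WithBot.coe_lt_coe.2 hs
    · rintro ⟨s, -, hs⟩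
      exact WithBot.coe_ne_bot hs
    · refine mem_of_superset (Iio_mem_nhds hb) fun t ht => ?_
      induction t using WithBot.recBotCoe with
      | bot => exact mem_insert _ _
      | coe s =>
        rw [← hb'] at ht
        exact Or.inr ⟨s, WithBot.coe_lt_coe.1 ht, rfl⟩
    · have := TropReal.dense_range_coe.open_subset_closure_inter (isOpen_Iio (a := b)) hb
      refine closure_mono ?_ this
      rintro _ ⟨ht, s, rfl⟩
      rw [← hb'] at ht
      exact ⟨s, WithBot.coe_lt_coe.1 ht, rfl⟩

section Spaces

variable {S : Type u} [TopologicalSpace S] {O : FunctionSheaf S}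

lemma Chart.map_nhds (c : Chart O) {x : S} (hx : x ∈ c.source) :
    map c.toFun (𝓝 x) = 𝓝[c.target] c.toFun x := by
  have h := c.isOpenEmbedding.map_nhds_eq ⟨x, hx⟩
  rw [← c.source.isOpen.isOpenEmbedding_subtypeVal.map_nhds_eq ⟨x, hx⟩, map_map,
    ← map_nhds_subtype_val ⟨c.toFun x, c.mapsTo x hx⟩, ← h, map_map]
  rfl

lemma Chart.injOn (c : Chart O) : InjOn c.toFun c.source := fun x hx y hy h =>
  congrArg Subtype.val (c.isEmbedding_source.injective (a₁ := ⟨x, hx⟩) (a₂ := ⟨y, hy⟩) h)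

namespace LineChart

/-- The real-valued coordinate of a line chart. -/
def coord (ℓ : LineChart O) (y : S) : ℝ := (ℓ.toFun y).toReal

lemma injOn (ℓ : LineChart O) : InjOn ℓ.toFun ℓ.source := fun x hx y hy h =>
  congrArg Subtype.val (ℓ.isOpenEmbedding.injective (a₁ := ⟨x, hx⟩) (a₂ := ⟨y, hy⟩) h)

lemma map_nhds (ℓ : LineChart O) {x : S} (hx : x ∈ ℓ.source) :
    map ℓ.toFun (𝓝 x) = 𝓝 (ℓ.toFun x) := by
  rw [← ℓ.source.isOpen.isOpenEmbedding_subtypeVal.map_nhds_eq ⟨x, hx⟩, map_map]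
  exact ℓ.isOpenEmbedding.map_nhds_eq ⟨x, hx⟩

lemma map_coord_nhds (ℓ : LineChart O) {x : S} (hx : x ∈ ℓ.source) (hr : ℓ.toFun x ≠ ⊥) :
    map ℓ.coord (𝓝 x) = 𝓝 (ℓ.coord x) := by
  have : map ℓ.coord (𝓝 x) = map TropReal.toReal (map ℓ.toFun (𝓝 x)) := rfl
  rw [this, ℓ.map_nhds hx]
  conv_lhs => rw [← TropReal.coe_toReal hr]
  rw [← TropReal.isOpenEmbedding_coe.map_nhds_eq, map_map]
  exact map_id

lemma continuousAt_coord (ℓ : LineChart O) {x : S} (hx : x ∈ ℓ.source) (hr : ℓ.toFun x ≠ ⊥) :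
    ContinuousAt ℓ.coord x := (ℓ.map_coord_nhds hx hr).le

lemma eventually_real (ℓ : LineChart O) {x : S} (hx : x ∈ ℓ.source) (hr : ℓ.toFun x ≠ ⊥) :
    ∀ᶠ y in 𝓝 x, y ∈ ℓ.source ∧ ℓ.toFun y ≠ ⊥ :=
  Filter.Eventually.and (ℓ.source.isOpen.mem_nhds hx) ((ℓ.continuousAt hx).eventually_ne hr)

lemma isPreconnected_preimage (ℓ : LineChart O) {I : Set TropReal} (hI : _root_.IsPreconnected I)
    (hIr : I ⊆ ℓ.toFun '' ℓ.source) : _root_.IsPreconnected (ℓ.source ∩ ℓ.toFun ⁻¹' I) := by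
  have h := (hI.preimage_of_isOpenMap ℓ.isOpenEmbedding.injective ℓ.isOpenEmbedding.isOpenMap
    (fun t ht => by obtain ⟨y, hy, rfl⟩ := hIr ht; exact ⟨⟨y, hy⟩, rfl⟩)).image Subtype.val
      continuous_subtype_val.continuousOn
  convert h using 1
  ext y
  simp [and_comm]

/-- A connected set of real points of a line chart close to the point `x`. -/
structure IsArc (ℓ : LineChart O) (x : S) (A : Set S) : Prop where
  subset_source : A ⊆ ℓ.source
  ne_bot : ∀ y ∈ A, ℓ.toFun y ≠ ⊥
  isPreconnected : _root_.IsPreconnected A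
  mem_closure : x ∈ closure A

lemma exists_isArc (ℓ : LineChart O) {x : S} (hx : x ∈ ℓ.source) {U : Set S} (hU : U ∈ 𝓝 x) :
    ∃ A ⊆ U, ℓ.IsArc x A ∧ insert x A ∈ 𝓝 x := by
  have hN : ℓ.toFun '' (U ∩ ℓ.source) ∈ 𝓝 (ℓ.toFun x) := by
    rw [← ℓ.map_nhds hx]
    exact image_mem_map (inter_mem hU (ℓ.source.isOpen.mem_nhds hx))
  obtain ⟨I, hIN, hI, hbot, hnhds, hcl⟩ := TropReal.exists_isPreconnected hN
  refine ⟨ℓ.source ∩ ℓ.toFun ⁻¹' I, ?_, ⟨inter_subset_left, ?_,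
    ℓ.isPreconnected_preimage hI (hIN.trans (image_mono inter_subset_right)), ?_⟩, ?_⟩
  · rintro y ⟨hy, hyI⟩
    obtain ⟨y', hy', h⟩ := hIN hyI
    rw [← ℓ.injOn hy'.2 hy h]
    exact hy'.1
  · rintro y ⟨-, hy⟩ h
    exact hbot (h ▸ hy)
  · rw [mem_closure_iff_frequently] at hcl ⊢
    rw [← ℓ.map_nhds hx, frequently_map] at hcl
    exact (hcl.and_eventually (ℓ.source.isOpen.mem_nhds hx)).mono fun y hy => ⟨hy.2, hy.1⟩
  · filter_upwards [ℓ.continuousAt hx hnhds, ℓ.source.isOpen.mem_nhds hx] with y hy hys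
    rcases hy with h | h
    · exact Or.inl (ℓ.injOn hys hx h)
    · exact Or.inr ⟨hys, h⟩

/-- Along an arc, a coordinate of a chart is either `-∞` or affine with integral slope. -/
lemma IsArc.z_eq {ℓ : LineChart O} {x : S} {A : Set S} (hA : ℓ.IsArc x A) (c : Chart O)
    (hAc : A ⊆ c.source) (i : Fin c.dim) :
    (∀ y ∈ A, c.z y i = 0) ∨
      ∃ (a : ℝ) (m : ℤ), ∀ y ∈ A, c.z y i = Real.exp (a + m * ℓ.coord y) := by
  have hcont : ∀ y ∈ A, ContinuousAt (fun y => c.z y i) y := fun y hy =>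
    (continuousAt_apply i _).comp (c.continuousAt_z (hAc hy))
  have hloc : ∀ y ∈ A, c.z y i ≠ 0 → ∃ (a : ℝ) (m : ℤ),
      ∀ᶠ y' in 𝓝 y, c.z y' i = Real.exp (a + m * ℓ.coord y') := by
    intro y hy h
    have h' := c.z_eq_zero.not.1 h
    obtain ⟨m, a, -, hma⟩ := (ℓ.stalk_iff y (hA.subset_source hy) _).1 (c.coord_mem (hAc hy) h')
    refine ⟨a, m, ?_⟩
    filter_upwards [hma, (hcont y hy).eventually_ne h] with y' h₁ h₂
    rw [LineChart.coord, ← h₁, c.z_apply, TropReal.exp_toReal (c.z_eq_zero.not.1 h₂)]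
  by_cases hz : ∀ y ∈ A, c.z y i = 0
  · exact Or.inl hz
  push Not at hz
  obtain ⟨y₀, hy₀, hne⟩ := hz
  obtain ⟨a, m, h₀⟩ := hloc y₀ hy₀ hne
  refine Or.inr ⟨a, m, fun y hy => ?_⟩
  -- The locus where the formula with these `a` and `m` holds locally is open and meets the arc; it
  -- remains to show that it is relatively closed in `A`.
  let A' : Set S := {y | ∀ᶠ y' in 𝓝 y, c.z y' i = Real.exp (a + m * ℓ.coord y')}
  have hsub : A ⊆ A' := by
    refine hA.isPreconnected.subset_of_closure_inter_subset isOpen_setOfPred_eventually_nhds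
      ⟨y₀, hy₀, h₀⟩ ?_
    rintro y ⟨hycl, hy⟩
    have hτ := ℓ.continuousAt_coord (hA.subset_source hy) (hA.ne_bot y hy)
    rw [mem_closure_iff_frequently] at hycl
    have hval : c.z y i = Real.exp (a + m * ℓ.coord y) := by
      have h₁ : ContinuousAt (fun y' => c.z y' i - Real.exp (a + m * ℓ.coord y')) y :=
        (hcont y hy).sub (by fun_prop)
      by_contra hcon
      obtain ⟨y', h₂, h₃⟩ := (hycl.and_eventually
        (h₁.eventually_ne (sub_ne_zero.2 hcon))).exists
      exact h₃ (sub_eq_zero.2 h₂.self_of_nhds)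
    -- By continuity the value at the limit point is a positive exponential, so the coordinate is
    -- finite there and has its own affine formula. The two formulas agree on an open set of
    -- coordinate values, hence have equal coefficients.
    obtain ⟨a', m', h'⟩ := hloc y hy (by rw [hval]; exact (Real.exp_pos _).ne')
    obtain ⟨y', ⟨h₁, h₂⟩, h₃⟩ := ((hycl.and_eventually (eventually_eventually_nhds.2 h')).and_eventually
      (ℓ.eventually_real (hA.subset_source hy) (hA.ne_bot y hy))).exists
    have h₄ : ∀ᶠ s in 𝓝 (ℓ.coord y'), a + m * s = a' + m' * s := by
      rw [← ℓ.map_coord_nhds h₃.1 h₃.2, eventually_map]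
      filter_upwards [h₁, h₂] with y'' h₁ h₂
      exact Real.exp_injective (h₁.symm.trans h₂)
    have hd := (Filter.EventuallyEq.deriv_eq h₄)
    have hm : (m : ℝ) = m' := by
      simpa using hd
    have ha : a = a' := by
      have := h₄.self_of_nhds
      rw [hm] at this
      linarith
    change ∀ᶠ y' in 𝓝 y, _
    rw [hm, ha]
    exact h'
  exact (hsub hy).self_of_nhds

end LineChart

/-- A chart `c'` is normal at `x` if near `x` the exponential coordinates of every chart are
monomials in the exponential coordinates of `c'`. -/
def Chart.IsNormalAt (c' : Chart O) (x : S) : Prop :=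
  x ∈ c'.source ∧ ∀ c : Chart O, x ∈ c.source → ∀ i, ∃ (C : ℝ) (m : Fin c'.dim → ℤ),
    (∀ j, c'.toFun x j = ⊥ → 0 ≤ m j) ∧ ∀ᶠ y in 𝓝 x, c.z y i = C * ∏ j, c'.z y j ^ m j

/-- A coordinate that is finite at `x` is a section of `O`, hence integral affine in the coordinates
of `c'`; exponentiation gives a monomial. Coordinates of `c'` equal to `-∞` at `x` occur with
exponent 0. -/
lemma Chart.exists_monomial {c' c : Chart O} {x : S} (hx' : x ∈ c'.source) (hx : x ∈ c.source)
    {i : Fin c.dim} (hi : c.toFun x i ≠ ⊥) : ∃ (C : ℝ) (m : Fin c'.dim → ℤ),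
    (∀ j, c'.toFun x j = ⊥ → 0 ≤ m j) ∧ ∀ᶠ y in 𝓝 x, c.z y i = C * ∏ j, c'.z y j ^ m j := by
  obtain ⟨m, a, hm, h⟩ := (c'.stalk_iff x hx' _).1 (c.coord_mem hx hi)
  refine ⟨Real.exp a, m, fun j hj => (hm j hj).ge, ?_⟩
  have hne : ∀ᶠ y in 𝓝 x, ∀ j, c'.toFun x j ≠ ⊥ → c'.toFun y j ≠ ⊥ := by
    refine eventually_all.2 fun j => ?_
    by_cases hj : c'.toFun x j = ⊥
    · simp [hj]
    · filter_upwards [((continuousAt_apply j _).comp (c'.continuousAt hx')).eventually_ne hj]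
        with y hy _ using hy
  filter_upwards [h, hne, ((continuousAt_apply i _).comp (c.continuousAt hx)).eventually_ne hi]
    with y h₁ h₂ h₃
  rw [c.z_apply, ← TropReal.exp_toReal (t := c.toFun y i) h₃]
  rw [h₁, Real.exp_add, Real.exp_sum]
  congr 1
  refine Finset.prod_congr rfl fun j _ => ?_
  by_cases hj : c'.toFun x j = ⊥
  · simp [hm j hj]
  · rw [c'.z_apply, TropReal.exp_int_mul (h₂ j hj)]

/-- The stalk of `O` at `x` says nothing about a coordinate that is `-∞` at `x`. Such a coordinate
is followed along an arc approaching `x`, where it is identically `-∞` or affine. -/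
lemma LineChart.isNormalAt (ℓ : LineChart O) {x : S} (hx : x ∈ ℓ.source) :
    ℓ.toChart.IsNormalAt x := by
  refine ⟨hx, fun c hxc i => ?_⟩
  by_cases hi : c.toFun x i = ⊥
  swap
  · exact Chart.exists_monomial hx hxc hi
  obtain ⟨A, hAU, hA, hnhds⟩ := ℓ.exists_isArc hx (c.source.isOpen.mem_nhds hxc)
  have hz : c.z x i = 0 := c.z_eq_zero.2 hi
  rcases hA.z_eq c hAU i with h | ⟨a, m, h⟩
  · refine ⟨0, 0, fun _ _ => le_rfl, ?_⟩
    filter_upwards [hnhds] with y hy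
    rcases hy with rfl | hy
    · rw [hz, zero_mul]
    · rw [h y hy, zero_mul]
  have hlim : ContinuousAt (fun y => c.z y i) x :=
    (continuousAt_apply i _).comp (c.continuousAt_z hxc)
  have he : ContinuousAt (fun y => (ℓ.toFun y).exp) x :=
    TropReal.continuous_exp.continuousAt.comp (ℓ.continuousAt hx)
  have h' : ∀ y ∈ A, c.z y i = Real.exp a * (ℓ.toFun y).exp ^ m := fun y hy => by
    rw [h y hy, Real.exp_add, LineChart.coord, TropReal.exp_int_mul (hA.ne_bot y hy)]
  -- Along the arc the coordinate is `exp a * z ^ m` and it tends to 0 at `x`. If `z` stayed nonzero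
  -- in the limit, or if `m ≤ 0`, then multiplying by `z ^ (-m)` would give `exp a = 0`.
  have hm : ℓ.toFun x = ⊥ ∧ 0 < m := by
    by_contra hcon
    have key : c.z x i * (ℓ.toFun x).exp ^ (-m) = Real.exp a := by
      have h₁ : ContinuousAt (fun y => c.z y i * (ℓ.toFun y).exp ^ (-m) - Real.exp a) x := by
        refine (hlim.mul (he.zpow₀ (-m) ?_)).sub continuousAt_const
        by_contra! h₂
        exact hcon ⟨TropReal.exp_eq_zero.1 h₂.1, by omega⟩
      by_contra h₂
      obtain ⟨y, h₃, h₄⟩ := ((mem_closure_iff_frequently.1 hA.mem_closure).and_eventually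
        (h₁.eventually_ne (sub_ne_zero.2 h₂))).exists
      refine h₄ (sub_eq_zero.2 ?_)
      rw [h' y h₃, mul_assoc, ← zpow_add₀ (TropReal.exp_pos (hA.ne_bot y h₃)).ne']
      simp
    rw [hz, zero_mul] at key
    exact (Real.exp_pos a).ne key
  refine ⟨Real.exp a, fun _ => m, fun _ _ => hm.2.le, ?_⟩
  filter_upwards [hnhds] with y hy
  have hprod : ∏ j, ℓ.toChart.z y j ^ m = (ℓ.toFun y).exp ^ m :=
    Fin.prod_univ_one (fun j : Fin 1 => ℓ.toChart.z y j ^ m)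
  rw [hprod]
  rcases hy with rfl | hy
  · rw [hz, hm.1, TropReal.exp_bot, zero_zpow _ hm.2.ne', mul_zero]
  · exact h' y hy

end Spaces

end Tropical

end

noncomputable section

/-! ## Star centres of tropical curves -/

namespace Tropical

section Spaces

variable {S : Type u} [TopologicalSpace S] {O : FunctionSheaf S}

/-- The point `x` is mapped to the vertex of a tropical line by the chart `c`. -/
structure Chart.IsStarAt (c : Chart O) (x : S) : Prop where
  mem : x ∈ c.source
  target_eq : c.target = tropicalLine c.dim
  eq_zero : ∀ i, c.toFun x i = ((0 : ℝ) : TropReal)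

/-- The parametrization of the `i`-th positive ray of a tropical line. -/
def rayParam {k : ℕ} (i : Fin k) (t : TropReal) : Fin k → TropReal :=
  fun l => if l = i then t else ((0 : ℝ) : TropReal)

lemma continuous_rayParam {k : ℕ} (i : Fin k) : Continuous (rayParam i) :=
  continuous_pi fun l => by
    by_cases h : l = i <;> simp only [rayParam, h, if_true, if_false] <;> fun_prop

lemma rayParam_mem {k : ℕ} (i : Fin k) {t : ℝ} (ht : 0 ≤ t) : rayParam i t ∈ tropicalLine k := by
  refine Or.inl ⟨i, t, ht, funext fun l => ?_⟩
  by_cases h : l = i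
  · subst h; simp [rayParam]
  · simp [rayParam, h]

lemma mem_tropicalLine_pos {k : ℕ} {i : Fin k} {w : Fin k → TropReal} (hw : w ∈ tropicalLine k)
    (hi : ((0 : ℝ) : TropReal) < w i) : rayParam i (w i) = w := by
  rcases hw with ⟨i', t, ht, rfl⟩ | ⟨t, ht, rfl⟩
  · obtain rfl : i = i' := by
      by_contra h
      simp only [Pi.single_eq_of_ne h] at hi
      exact lt_irrefl _ hi
    funext l
    by_cases h : l = i
    · subst h; simp [rayParam]
    · simp [rayParam, h]
  · exact absurd hi (not_lt.2 ht)

lemma mem_tropicalLine_neg {k : ℕ} {i : Fin k} {w : Fin k → TropReal} (hw : w ∈ tropicalLine k)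
    (hi : w i < ((0 : ℝ) : TropReal)) : (fun _ => w i) = w := by
  rcases hw with ⟨i', t, ht, rfl⟩ | ⟨t, ht, rfl⟩
  · refine absurd hi (not_lt.2 (WithBot.coe_le_coe.2 ?_))
    by_cases h : i = i'
    · subst h; simpa using ht
    · simp [h]
  · rfl

lemma tropReal_cases {k : ℕ} (w : Fin k → TropReal) :
    (∀ i, w i = ((0 : ℝ) : TropReal)) ∨ (∃ i, ((0 : ℝ) : TropReal) < w i) ∨
      ∃ i, w i < ((0 : ℝ) : TropReal) := by
  by_contra! h
  obtain ⟨⟨i, hi⟩, h₁, h₂⟩ := h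
  exact hi (le_antisymm (h₁ i) (h₂ i))

namespace LineChart

/-- The line chart on a positive ray of a star. -/
def ofRay (c : Chart O) (hc : c.target = tropicalLine c.dim) (i : Fin c.dim) : LineChart O :=
  ofChart c (rayParam i) (continuous_rayParam i) i (Ioi ((0 : ℝ) : TropReal)) isOpen_Ioi
    {w | ((0 : ℝ) : TropReal) < w i} (isOpen_Ioi.preimage (continuous_apply i))
    (fun t ht => by
      have hb : t ≠ ⊥ := ((WithBot.bot_lt_coe _).trans ht).ne'
      rw [← TropReal.coe_toReal hb] at ht ⊢
      refine ⟨hc ▸ rayParam_mem i (WithBot.coe_lt_coe.1 ht).le, ?_⟩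
      simpa [rayParam] using ht)
    (fun t _ => by simp [rayParam])
    (fun w hw => ⟨hw.2, mem_tropicalLine_pos (hc ▸ hw.1) hw.2⟩)
    (Pi.single i 1)
    (fun t _ l => by
      by_cases h : l = i
      · subst h; simp [rayParam]
      · simp [rayParam, h])
    (fun h => absurd (mem_Ioi.1 h) (not_lt.2 bot_le))

/-- The line chart on the negative ray of a star. -/
def ofTail (c : Chart O) (hc : c.target = tropicalLine c.dim) (i : Fin c.dim) : LineChart O :=
  ofChart c (fun t _ => t) (by fun_prop) i (Iio ((0 : ℝ) : TropReal)) isOpen_Iio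
    {w | w i < ((0 : ℝ) : TropReal)} (isOpen_Iio.preimage (continuous_apply i))
    (fun t ht => ⟨hc ▸ Or.inr ⟨t, le_of_lt ht, rfl⟩, ht⟩)
    (fun _ _ => rfl)
    (fun w hw => ⟨hw.2, mem_tropicalLine_neg (hc ▸ hw.1) hw.2⟩)
    (fun _ => 1)
    (fun t _ l => by simp)
    (fun _ _ => Or.inr rfl)

end LineChart

/-- A point of a tropical line other than the vertex lies on one open ray, which a single coordinate
parametrizes. -/
lemma exists_lineChart_or_isStarAt (h : IsTropicalCurve O) (x : S) :
    (∃ ℓ : LineChart O, x ∈ ℓ.source) ∨ ∃ c : Chart O, c.IsStarAt x := by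
  obtain ⟨c, hx, -, hc⟩ := h x
  rcases tropReal_cases (c.toFun x) with h | ⟨i, hi⟩ | ⟨i, hi⟩
  · exact Or.inr ⟨c, hx, hc, h⟩
  · exact Or.inl ⟨LineChart.ofRay c hc i, hx, hi⟩
  · exact Or.inl ⟨LineChart.ofTail c hc i, hx, hi⟩

/-- Near a star centre every other point lies on an arc along one of the rays. -/
lemma Chart.IsStarAt.eventually {c : Chart O} {x : S} (hc : c.IsStarAt x) {U : Set S}
    (hU : U ∈ 𝓝 x) : ∀ᶠ y in 𝓝 x, y = x ∨ ∃ (ℓ : LineChart O) (A : Set S) (i : Fin c.dim),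
      y ∈ A ∧ A ⊆ U ∧ ℓ.IsArc x A ∧ (∀ y, ℓ.toFun y = c.toFun y i) ∧
      ℓ.coord y ≠ 0 ∧
      ((∀ y ∈ ℓ.source, ∀ l, (c.toFun y l).toReal = if l = i then ℓ.coord y else 0) ∨
       (∀ y ∈ ℓ.source, ∀ l, (c.toFun y l).toReal = ℓ.coord y)) := by
  have hW : c.toFun '' (U ∩ c.source) ∈ 𝓝[c.target] (c.toFun x) := by
    rw [← c.map_nhds hc.mem]
    exact image_mem_map (inter_mem hU (c.source.isOpen.mem_nhds hc.mem))
  have hx0 : c.toFun x = fun _ => ((0 : ℝ) : TropReal) := funext hc.eq_zero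
  -- The argument common to both kinds of ray: `j` parametrizes the ray with vertex at 0, and `K` is
  -- the set of its real parameters. The arc consists of the points with parameter in `K` of
  -- absolute value below some `ε`.
  have leg : ∀ (ℓ : LineChart O) (j : TropReal → Fin c.dim → TropReal) (i : Fin c.dim) (K : Set ℝ),
      Continuous j → j ((0 : ℝ) : TropReal) = (fun _ => ((0 : ℝ) : TropReal)) → K.OrdConnected →
      (0 : ℝ) ∈ closure K → (∀ s ∈ K, j (s : TropReal) ∈ c.target) →
      (∀ y, ℓ.toFun y = c.toFun y i) →
      (∀ y ∈ ℓ.source, y ∈ c.source ∧ c.toFun y = j (ℓ.toFun y)) →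
      (∀ y ∈ c.source, ∀ s ∈ K, c.toFun y = j (s : TropReal) →
        y ∈ ℓ.source ∧ ℓ.toFun y = (s : TropReal)) →
      ∀ᶠ y in 𝓝 x, y ∈ ℓ.source → ℓ.toFun y ≠ ⊥ → ℓ.coord y ∈ K →
        ∃ A, y ∈ A ∧ A ⊆ U ∧ ℓ.IsArc x A ∧ ∀ y ∈ A, ℓ.coord y ∈ K := by
    intro ℓ j i K hj hj0 hK h0 hjK hℓ hℓs hℓK
    have hjc : Tendsto (fun s : ℝ => j (s : TropReal)) (𝓝[K] 0) (𝓝[c.target] (c.toFun x)) := by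
      refine tendsto_nhdsWithin_iff.2 ⟨?_, eventually_mem_nhdsWithin.mono hjK⟩
      have := (hj.comp WithBot.continuous_coe).tendsto (0 : ℝ)
      simp only [Function.comp_def, hj0, ← hx0] at this
      exact this.mono_left nhdsWithin_le_nhds
    obtain ⟨ε, hε, hεW⟩ := Metric.mem_nhdsWithin_iff.1 (hjc hW)
    have hlift : ∀ s ∈ Metric.ball (0 : ℝ) ε ∩ K, ∃ y ∈ U ∩ ℓ.source, ℓ.toFun y = (s : TropReal) := by
      intro s hs
      obtain ⟨y, hy, hys⟩ := hεW hs
      obtain ⟨h₁, h₂⟩ := hℓK y hy.2 s hs.2 hys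
      exact ⟨y, ⟨hy.1, h₁⟩, h₂⟩
    have hcoord : ContinuousAt (fun y => (c.toFun y i).toReal) x := by
      refine ContinuousAt.comp (g := TropReal.toReal) (TropReal.continuousAt_toReal ?_)
        ((continuousAt_apply i _).comp (c.continuousAt hc.mem))
      rw [hc.eq_zero]
      exact WithBot.coe_ne_bot
    have hball : ∀ᶠ y in 𝓝 x, ℓ.coord y ∈ Metric.ball (0 : ℝ) ε := by
      have : (c.toFun x i).toReal = 0 := by rw [hc.eq_zero]; rfl
      have h' : ContinuousAt ℓ.coord x := by
        have : ℓ.coord = fun y => (c.toFun y i).toReal := funext fun y => congrArg _ (hℓ y)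
        rwa [this]
      have h0 : ℓ.coord x = 0 := by rw [LineChart.coord, hℓ, this]
      exact h' (Metric.isOpen_ball.mem_nhds (by rw [h0]; exact Metric.mem_ball_self hε))
    filter_upwards [hball] with y hyb hys hyr hyK
    refine ⟨ℓ.source ∩ ℓ.toFun ⁻¹' ((↑) '' (Metric.ball (0 : ℝ) ε ∩ K)),
      ⟨hys, ℓ.coord y, ⟨hyb, hyK⟩, TropReal.coe_toReal hyr⟩, ?_, ⟨inter_subset_left, ?_, ?_, ?_⟩, ?_⟩
    · rintro y' ⟨h₁, s, hs, h₂⟩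
      obtain ⟨y'', h₃, h₄⟩ := hlift s hs
      rw [ℓ.injOn h₁ h₃.2 (h₂.symm.trans h₄.symm)]
      exact h₃.1
    · rintro y' ⟨-, s, -, h₂⟩
      rw [← h₂]
      exact WithBot.coe_ne_bot
    · refine ℓ.isPreconnected_preimage (IsPreconnected.image ?_ _
        WithBot.continuous_coe.continuousOn) ?_
      · rw [Real.ball_eq_Ioo]
        exact (ordConnected_Ioo.inter hK).isPreconnected
      · rintro _ ⟨s, hs, rfl⟩
        obtain ⟨y', h₃, h₄⟩ := hlift s hs
        exact ⟨y', h₃.2, h₄⟩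
    · have hne : (𝓝[K] (0 : ℝ)).NeBot := mem_closure_iff_nhdsWithin_neBot.1 h0
      have hfr : ∃ᶠ w in 𝓝[c.target] (c.toFun x),
          ∃ s ∈ Metric.ball (0 : ℝ) ε ∩ K, w = j (s : TropReal) := by
        refine hjc.frequently (Eventually.frequently ?_)
        filter_upwards [inter_mem (mem_nhdsWithin_of_mem_nhds (Metric.ball_mem_nhds (0 : ℝ) hε))
          self_mem_nhdsWithin] with s hs using ⟨s, hs, rfl⟩
      rw [← c.map_nhds hc.mem, frequently_map] at hfr
      refine mem_closure_iff_frequently.2 ((hfr.and_eventually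
        (c.source.isOpen.mem_nhds hc.mem)).mono ?_)
      rintro y' ⟨⟨s, hs, h₁⟩, h₂⟩
      obtain ⟨h₃, h₄⟩ := hℓK y' h₂ s hs.2 h₁
      exact ⟨h₃, s, hs, h₄.symm⟩
    · rintro y' ⟨-, s, hs, h₂⟩
      rw [LineChart.coord, ← h₂]
      exact hs.2
  have hrays : ∀ᶠ y in 𝓝 x, ∀ i, y ∈ (LineChart.ofRay c hc.target_eq i).source →
      (LineChart.ofRay c hc.target_eq i).toFun y ≠ ⊥ →
      (LineChart.ofRay c hc.target_eq i).coord y ∈ Ioi (0 : ℝ) →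
      ∃ A, y ∈ A ∧ A ⊆ U ∧ (LineChart.ofRay c hc.target_eq i).IsArc x A ∧
        ∀ y ∈ A, (LineChart.ofRay c hc.target_eq i).coord y ∈ Ioi (0 : ℝ) := by
    refine eventually_all.2 fun i => leg _ (rayParam i) i (Ioi 0) (continuous_rayParam i) ?_
      ordConnected_Ioi (by simp) ?_ (fun _ => rfl) ?_ ?_
    · funext l; simp [rayParam]
    · intro s hs; exact hc.target_eq ▸ rayParam_mem i (le_of_lt hs)
    · rintro y ⟨hy, hyi⟩
      exact ⟨hy, (mem_tropicalLine_pos (hc.target_eq ▸ c.mapsTo y hy) hyi).symm⟩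
    · intro y hy s hs h
      have : c.toFun y i = (s : TropReal) := by rw [h]; simp [rayParam]
      refine ⟨⟨hy, ?_⟩, this⟩
      change ((0 : ℝ) : TropReal) < c.toFun y i
      rw [this]
      exact WithBot.coe_lt_coe.2 hs
  have htail : ∀ᶠ y in 𝓝 x, ∀ i, y ∈ (LineChart.ofTail c hc.target_eq i).source →
      (LineChart.ofTail c hc.target_eq i).toFun y ≠ ⊥ →
      (LineChart.ofTail c hc.target_eq i).coord y ∈ Iio (0 : ℝ) →
      ∃ A, y ∈ A ∧ A ⊆ U ∧ (LineChart.ofTail c hc.target_eq i).IsArc x A ∧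
        ∀ y ∈ A, (LineChart.ofTail c hc.target_eq i).coord y ∈ Iio (0 : ℝ) := by
    refine eventually_all.2 fun i => leg _ (fun t _ => t) i (Iio 0) (by fun_prop) rfl
      ordConnected_Iio (by simp) ?_ (fun _ => rfl) ?_ ?_
    · intro s hs
      exact hc.target_eq ▸ Or.inr ⟨s, WithBot.coe_le_coe.2 (le_of_lt hs), rfl⟩
    · rintro y ⟨hy, hyi⟩
      exact ⟨hy, (mem_tropicalLine_neg (hc.target_eq ▸ c.mapsTo y hy) hyi).symm⟩
    · intro y hy s hs h
      have : c.toFun y i = (s : TropReal) := by rw [h]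
      refine ⟨⟨hy, ?_⟩, this⟩
      change c.toFun y i < ((0 : ℝ) : TropReal)
      rw [this]
      exact WithBot.coe_lt_coe.2 hs
  have hreal : ∀ᶠ y in 𝓝 x, ∀ i, c.toFun y i ≠ ⊥ := eventually_all.2 fun i =>
    ((continuousAt_apply i _).comp (c.continuousAt hc.mem)).eventually_ne (by
      change c.toFun x i ≠ ⊥
      rw [hc.eq_zero]; exact WithBot.coe_ne_bot)
  filter_upwards [hrays, htail, hreal, c.source.isOpen.mem_nhds hc.mem] with y h₁ h₂ h₃ hys
  rcases tropReal_cases (c.toFun y) with h | ⟨i, hi⟩ | ⟨i, hi⟩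
  · exact Or.inl (c.injOn hys hc.mem (by rw [hx0]; exact funext h))
  · right
    have hc0 := hi
    rw [← TropReal.coe_toReal (h₃ i)] at hc0
    obtain ⟨A, hyA, hAU, hA, hpos⟩ := h₁ i ⟨hys, hi⟩ (h₃ i) (WithBot.coe_lt_coe.1 hc0)
    refine ⟨_, A, i, hyA, hAU, hA, fun _ => rfl, (hpos y hyA).ne',
      Or.inl fun y hy l => ?_⟩
    obtain ⟨h₄, h₅⟩ := hy
    conv_lhs => rw [← mem_tropicalLine_pos (hc.target_eq ▸ c.mapsTo y h₄) h₅]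
    by_cases hl : l = i
    · simp only [rayParam, hl, if_true]; rfl
    · simp [rayParam, hl]
  · right
    have hc0 := hi
    rw [← TropReal.coe_toReal (h₃ i)] at hc0
    obtain ⟨A, hyA, hAU, hA, hpos⟩ := h₂ i ⟨hys, hi⟩ (h₃ i) (WithBot.coe_lt_coe.1 hc0)
    refine ⟨_, A, i, hyA, hAU, hA, fun _ => rfl, (hpos y hyA).ne,
      Or.inr fun y hy l => ?_⟩
    obtain ⟨h₄, h₅⟩ := hy
    conv_lhs => rw [← mem_tropicalLine_neg (hc.target_eq ▸ c.mapsTo y h₄) h₅]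
    rfl

/-- If another chart has a coordinate equal to `-∞` at the vertex, its exponential vanishes near the
vertex. Otherwise it would be `exp` of an affine function on some arc, with positive limit, since
the star coordinates are finite at `x`. -/
lemma Chart.IsStarAt.isNormalAt {c : Chart O} {x : S} (hc : c.IsStarAt x) : c.IsNormalAt x := by
  refine ⟨hc.mem, fun c' hx i => ?_⟩
  by_cases hi : c'.toFun x i = ⊥
  swap
  · exact Chart.exists_monomial hc.mem hx hi
  have hz : c'.z x i = 0 := c'.z_eq_zero.2 hi
  refine ⟨0, 0, fun _ _ => le_rfl, ?_⟩
  filter_upwards [hc.eventually (c'.source.isOpen.mem_nhds hx)] with y hy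
  rw [zero_mul]
  rcases hy with rfl | ⟨ℓ, A, l, hyA, hAU, hA, hℓ, -⟩
  · exact hz
  rcases hA.z_eq c' hAU i with h | ⟨a, m, h⟩
  · exact h y hyA
  exfalso
  have hc0 : c.toFun x l ≠ ⊥ := by rw [hc.eq_zero]; exact WithBot.coe_ne_bot
  have hcoord : ContinuousAt ℓ.coord x := by
    have : ℓ.coord = TropReal.toReal ∘ fun y => c.toFun y l := funext fun y => congrArg _ (hℓ y)
    rw [this]
    exact ContinuousAt.comp (f := fun y => c.toFun y l) (TropReal.continuousAt_toReal hc0)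
      ((continuousAt_apply l _).comp (c.continuousAt hc.mem))
  have hlim : ContinuousAt (fun y => c'.z y i - Real.exp (a + m * ℓ.coord y)) x :=
    ((continuousAt_apply i _).comp (c'.continuousAt_z hx)).sub (by fun_prop)
  obtain ⟨y', h₁, h₂⟩ := ((mem_closure_iff_frequently.1 hA.mem_closure).and_eventually
    (hlim.eventually_ne (by rw [hz, zero_sub]; exact (neg_lt_zero.2 (Real.exp_pos _)).ne))).exists
  exact h₂ (sub_eq_zero.2 (h y' h₁))

lemma exists_isNormalAt (h : IsTropicalCurve O) (x : S) : ∃ c : Chart O, c.IsNormalAt x := by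
  rcases exists_lineChart_or_isStarAt h x with ⟨ℓ, hℓ⟩ | ⟨c, hc⟩
  · exact ⟨_, ℓ.isNormalAt hℓ⟩
  · exact ⟨c, hc.isNormalAt⟩

end Spaces

end Tropical

end

noncomputable section

/-! ## Weakly-smooth functions -/

namespace Tropical

section Spaces

variable {S : Type u} [TopologicalSpace S] {O : FunctionSheaf S}

/-- Near `x` the function `f` is a smooth function of the exponential coordinates of `c`. -/
def Chart.IsSmoothAt (c : Chart O) (f : S → ℝ) (x : S) : Prop :=
  x ∈ c.source ∧ ∃ (W : Set (Fin c.dim → ℝ)) (F : (Fin c.dim → ℝ) → ℝ),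
    IsOpen W ∧ c.z x ∈ W ∧ ContDiffOn ℝ ∞ F W ∧ ∀ᶠ y in 𝓝 x, f y = F (c.z y)

lemma Chart.IsSmoothAt.exists_datum {c : Chart O} {f : S → ℝ} {x : S} (h : c.IsSmoothAt f x)
    (N : Set S) (hN : N ∈ 𝓝 x) : ∃ (U : Opens S) (W : Set (Fin c.dim → ℝ))
      (F : (Fin c.dim → ℝ) → ℝ), x ∈ U ∧ (U : Set S) ⊆ N ∧ ContDiffOn ℝ ∞ F W ∧
        IsPrimitiveDatum f (c.restrict U) W (fun w => Real.exp (F w)) := by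
  obtain ⟨hx, W, F, hW, hxW, hF, hf⟩ := h
  obtain ⟨V, hV, hVo, hxV⟩ := mem_nhds_iff.1 (inter_mem hN (inter_mem hf (inter_mem
    (c.source.isOpen.mem_nhds hx) ((c.continuousAt_z hx) (hW.mem_nhds hxW)))))
  refine ⟨⟨V, hVo⟩, W, F, hxV, fun y hy => (hV hy).1, hF, hW, Real.contDiff_exp.comp_contDiffOn hF,
    fun _ _ => Real.exp_pos _, fun y hy => (hV hy.2).2.2.2, fun y hy => ?_⟩
  rw [Real.log_exp]
  exact (hV hy.2).2.1

lemma Chart.IsSmoothAt.isWeaklySmoothAt {c : Chart O} {f : S → ℝ} {x : S} (h : c.IsSmoothAt f x) :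
    IsWeaklySmoothAt O f x := by
  obtain ⟨U, W, F, hxU, -, -, hd⟩ := h.exists_datum univ univ_mem
  exact ⟨c.restrict U, W, _, ⟨h.1, hxU⟩, hd⟩

lemma contDiffOn_monomial {n : ℕ} (C : ℝ) (m : Fin n → ℤ) (V : Set (Fin n → ℝ))
    (hV : ∀ w ∈ V, ∀ j, m j < 0 → w j ≠ 0) :
    ContDiffOn ℝ ∞ (fun w : Fin n → ℝ => C * ∏ j, w j ^ m j) V := by
  refine contDiffOn_const.mul (contDiffOn_prod fun j _ => ?_)
  rcases le_or_gt 0 (m j) with h | h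
  · obtain ⟨k, hk⟩ := Int.eq_ofNat_of_zero_le h
    simp only [hk, zpow_natCast]
    exact (contDiff_apply ℝ ℝ j).contDiffOn.pow k
  · obtain ⟨k, hk⟩ := Int.eq_ofNat_of_zero_le (neg_nonneg.2 h.le)
    have : ∀ w : Fin n → ℝ, w j ^ m j = ((w j) ^ k)⁻¹ := fun w => by
      rw [← neg_neg (m j), hk, zpow_neg, zpow_natCast]
    simp only [this]
    exact ((contDiff_apply ℝ ℝ j).contDiffOn.pow k).inv fun w hw => pow_ne_zero _ (hV w hw j h)

/-- The monomial change of coordinates is smooth near `c'.z x`, including at zero coordinates, where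
the exponents are nonnegative. All weakly-smooth germs can thus be expressed in one chart, which is
what sums and products need. -/
lemma IsWeaklySmoothAt.isSmoothAt {f : S → ℝ} {x : S} (h : IsWeaklySmoothAt O f x) {c' : Chart O}
    (hc' : c'.IsNormalAt x) : c'.IsSmoothAt f x := by
  obtain ⟨c, W, h, hx, hd⟩ := h
  choose C m hm hz using hc'.2 c hx
  let M : (Fin c'.dim → ℝ) → Fin c.dim → ℝ := fun w i => C i * ∏ j, w j ^ m i j
  -- Negative exponents occur only for coordinates that are nonzero at `x`; `V` is the open set on
  -- which these stay nonzero.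
  let V : Set (Fin c'.dim → ℝ) := ⋂ j, {w | c'.z x j ≠ 0 → w j ≠ 0}
  have hVo : IsOpen V := isOpen_iInter_of_finite fun j => by
    by_cases hj : c'.z x j = 0
    · simp [hj]
    · simpa [hj] using isOpen_ne.preimage (continuous_apply j)
  have hMV : ContDiffOn ℝ ∞ M V := contDiffOn_pi.2 fun i =>
    contDiffOn_monomial _ _ _ fun w hw j hj => by
      refine mem_iInter.1 hw j fun h0 => ?_
      exact absurd (hm i j (c'.z_eq_zero.1 h0)) (not_le.2 hj)
  have hxM : M (c'.z x) = c.z x := funext fun i => (hz i).self_of_nhds.symm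
  refine ⟨hc'.1, V ∩ M ⁻¹' W, fun w => Real.log (h (M w)),
    hMV.continuousOn.isOpen_inter_preimage hVo hd.isOpen,
    ⟨mem_iInter.2 fun j hj => hj, ?_⟩, ?_, ?_⟩
  · change M (c'.z x) ∈ W
    rw [hxM]
    exact hd.mem x hx
  · exact ContDiffOn.log (hd.smooth.comp (hMV.mono inter_subset_left) fun w hw => hw.2)
      fun w hw => (hd.pos _ hw.2).ne'
  · filter_upwards [eventually_all.2 hz, c.source.isOpen.mem_nhds hx] with y hy hys
    rw [hd.eq y hys]
    congr 2
    exact funext hy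

lemma IsWeaklySmoothAt.congr {f g : S → ℝ} {x : S} (hC : IsTropicalCurve O)
    (h : IsWeaklySmoothAt O f x) (hfg : f =ᶠ[𝓝 x] g) : IsWeaklySmoothAt O g x := by
  obtain ⟨c, hc⟩ := exists_isNormalAt hC x
  obtain ⟨hx, W, F, hW, hxW, hF, hf⟩ := h.isSmoothAt hc
  exact Chart.IsSmoothAt.isWeaklySmoothAt (c := c)
    ⟨hx, W, F, hW, hxW, hF, by filter_upwards [hf, hfg] with y h₁ h₂ using h₂ ▸ h₁⟩

lemma IsWeaklySmoothAt.eventually {f : S → ℝ} {x : S} (h : IsWeaklySmoothAt O f x) :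
    ∀ᶠ y in 𝓝 x, IsWeaklySmoothAt O f y := by
  obtain ⟨c, W, h, hx, hd⟩ := h
  filter_upwards [c.source.isOpen.mem_nhds hx] with y hy using ⟨c, W, h, hy, hd⟩

/-- Expressing both functions in the same normal chart reduces this to composition of smooth maps.
-/
lemma IsWeaklySmoothAt.map₂ (hC : IsTropicalCurve O) {f g : S → ℝ} {x : S}
    (hf : IsWeaklySmoothAt O f x) (hg : IsWeaklySmoothAt O g x) {G : ℝ × ℝ → ℝ} {D : Set (ℝ × ℝ)}
    (hD : IsOpen D) (hG : ContDiffOn ℝ ∞ G D) (hx : (f x, g x) ∈ D) :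
    IsWeaklySmoothAt O (fun y => G (f y, g y)) x := by
  obtain ⟨c, hc⟩ := exists_isNormalAt hC x
  obtain ⟨hxc, W, F, hW, hxW, hF, hfF⟩ := hf.isSmoothAt hc
  obtain ⟨-, W', F', hW', hxW', hF', hgF⟩ := hg.isSmoothAt hc
  have hFF : ContDiffOn ℝ ∞ (fun w => (F w, F' w)) (W ∩ W') :=
    (hF.mono inter_subset_left).prodMk (hF'.mono inter_subset_right)
  refine Chart.IsSmoothAt.isWeaklySmoothAt (c := c)
    ⟨hxc, (W ∩ W') ∩ (fun w => (F w, F' w)) ⁻¹' D, fun w => G (F w, F' w),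
      hFF.continuousOn.isOpen_inter_preimage (hW.inter hW') hD, ⟨⟨hxW, hxW'⟩, ?_⟩,
      hG.comp (hFF.mono inter_subset_left) fun w hw => hw.2, ?_⟩
  · change (F (c.z x), F' (c.z x)) ∈ D
    rwa [← hfF.self_of_nhds, ← hgF.self_of_nhds]
  · filter_upwards [hfF, hgF] with y h₁ h₂
    rw [h₁, h₂]

lemma IsWeaklySmoothAt.add (hC : IsTropicalCurve O) {f g : S → ℝ} {x : S}
    (hf : IsWeaklySmoothAt O f x) (hg : IsWeaklySmoothAt O g x) :
    IsWeaklySmoothAt O (f + g) x :=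
  hf.map₂ hC hg isOpen_univ (contDiff_fst.add contDiff_snd).contDiffOn trivial

lemma IsWeaklySmoothAt.sub (hC : IsTropicalCurve O) {f g : S → ℝ} {x : S}
    (hf : IsWeaklySmoothAt O f x) (hg : IsWeaklySmoothAt O g x) :
    IsWeaklySmoothAt O (f - g) x :=
  hf.map₂ hC hg isOpen_univ (contDiff_fst.sub contDiff_snd).contDiffOn trivial

lemma IsWeaklySmoothAt.mul (hC : IsTropicalCurve O) {f g : S → ℝ} {x : S}
    (hf : IsWeaklySmoothAt O f x) (hg : IsWeaklySmoothAt O g x) :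
    IsWeaklySmoothAt O (f * g) x :=
  hf.map₂ hC hg isOpen_univ (contDiff_fst.mul contDiff_snd).contDiffOn trivial

lemma IsWeaklySmoothAt.div (hC : IsTropicalCurve O) {f g : S → ℝ} {x : S}
    (hf : IsWeaklySmoothAt O f x) (hg : IsWeaklySmoothAt O g x) (h0 : g x ≠ 0) :
    IsWeaklySmoothAt O (f / g) x :=
  hf.map₂ hC hg (isOpen_ne.preimage continuous_snd)
    (contDiff_fst.contDiffOn.div contDiff_snd.contDiffOn fun _ h => h) h0

lemma Chart.isSmoothAt_comp (c : Chart O) {F : (Fin c.dim → ℝ) → ℝ} (hF : ContDiff ℝ ∞ F) {x : S}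
    (hx : x ∈ c.source) : c.IsSmoothAt (fun y => F (c.z y)) x :=
  ⟨hx, univ, F, isOpen_univ, trivial, hF.contDiffOn, .of_forall fun _ => rfl⟩

lemma isWeaklySmoothAt_const (hC : IsTropicalCurve O) (a : ℝ) (x : S) :
    IsWeaklySmoothAt O (fun _ => a) x := by
  obtain ⟨c, hc, -⟩ := hC x
  exact (c.isSmoothAt_comp (contDiff_const (c := a)) hc).isWeaklySmoothAt

lemma IsWeaklySmoothAt.sum (hC : IsTropicalCurve O) {ι : Type*} (s : Finset ι) {f : ι → S → ℝ}
    {x : S} (hf : ∀ i ∈ s, IsWeaklySmoothAt O (f i) x) : IsWeaklySmoothAt O (∑ i ∈ s, f i) x := by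
  classical
  induction s using Finset.induction_on with
  | empty => exact isWeaklySmoothAt_const hC 0 x
  | insert i s hi ih =>
    rw [Finset.sum_insert hi]
    exact (hf i (Finset.mem_insert_self i s)).add hC
      (ih fun j hj => hf j (Finset.mem_insert_of_mem hj))

lemma Chart.isSmoothAt_affine (c : Chart O) {x : S} (hx : x ∈ c.source) (m : Fin c.dim → ℝ) (a : ℝ)
    (hm : ∀ i, c.toFun x i = ⊥ → m i = 0) {f : S → ℝ}
    (hf : ∀ᶠ y in 𝓝 x, f y = a + ∑ i, m i * (c.toFun y i).toReal) : c.IsSmoothAt f x := by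
  refine ⟨hx, ⋂ i, {w | m i ≠ 0 → w i ≠ 0}, fun w => a + ∑ i, m i * Real.log (w i),
    isOpen_iInter_of_finite fun i => ?_, mem_iInter.2 fun i hi h => hi (hm i (c.z_eq_zero.1 h)),
    contDiffOn_const.add (ContDiffOn.sum fun i _ => ?_), ?_⟩
  · by_cases hi : m i = 0
    · simp [hi]
    · simpa [hi] using isOpen_ne.preimage (continuous_apply i)
  · by_cases hi : m i = 0
    · simpa [hi] using contDiffOn_const
    · exact contDiffOn_const.mul ((contDiff_apply ℝ ℝ i).contDiffOn.log
        fun w hw => mem_iInter.1 hw i hi)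
  · filter_upwards [hf] with y hy
    simp only [hy, c.z_apply, TropReal.log_exp]

lemma isWeaklySmoothAt_of_mem_stalk (hC : IsTropicalCurve O) {f : S → ℝ} {x : S}
    (h : (f : Germ (𝓝 x) ℝ) ∈ O.stalk x) : IsWeaklySmoothAt O f x := by
  obtain ⟨c, hc, -⟩ := hC x
  obtain ⟨m, a, hm, hf⟩ := (c.stalk_iff x hc f).1 h
  exact (c.isSmoothAt_affine hc (fun i => m i) a (fun i hi => by simp [hm i hi])
    hf).isWeaklySmoothAt

/-- A weakly-smooth function is a smooth function of the coordinate of a line chart near a real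
point. -/
lemma IsWeaklySmoothAt.exists_profile {f : S → ℝ} {x : S} (h : IsWeaklySmoothAt O f x)
    (ℓ : LineChart O) (hx : x ∈ ℓ.source) (hr : ℓ.toFun x ≠ ⊥) :
    ∃ F : ℝ → ℝ, ContDiffAt ℝ 2 F (ℓ.coord x) ∧ ∀ᶠ y in 𝓝 x, f y = F (ℓ.coord y) := by
  obtain ⟨-, W, F, hW, hxW, hF, hf⟩ := h.isSmoothAt (ℓ.isNormalAt hx)
  have hz : ∀ᶠ y in 𝓝 x, ℓ.toChart.z y = fun _ => Real.exp (ℓ.coord y) := by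
    filter_upwards [ℓ.eventually_real hx hr] with y hy
    exact funext fun i => (TropReal.exp_toReal hy.2).symm
  refine ⟨fun s => F fun _ => Real.exp s, ?_, ?_⟩
  · rw [hz.self_of_nhds] at hxW
    have h₁ : ContDiffAt ℝ 2 F (fun _ => Real.exp (ℓ.coord x)) :=
      (hF.contDiffAt (hW.mem_nhds hxW)).of_le (WithTop.coe_le_coe.2 (le_top : (2 : ℕ∞) ≤ ⊤))
    exact h₁.comp (ℓ.coord x) (contDiff_pi.2 fun _ => Real.contDiff_exp).contDiffAt
  · filter_upwards [hf, hz] with y h₁ h₂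
    rw [h₁, h₂]

lemma LineChart.isWeaklySmoothAt_coord (ℓ : LineChart O) {x : S} (hx : x ∈ ℓ.source)
    (hr : ℓ.toFun x ≠ ⊥) : IsWeaklySmoothAt O ℓ.coord x := by
  refine (ℓ.toChart.isSmoothAt_affine hx (fun _ => 1) 0 (fun i hi => absurd hi hr)
    (.of_forall fun y => ?_)).isWeaklySmoothAt
  have := Fin.sum_univ_one (fun i : Fin 1 => (1 : ℝ) * (ℓ.toChart.toFun y i).toReal)
  rw [zero_add]
  refine Eq.trans ?_ this.symm
  rw [one_mul]
  rfl

end Spaces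

end Tropical

end

noncomputable section

/-! ## Differentials at real points -/

namespace Tropical

open MorseSheaf

section Spaces

variable {S : Type u} [TopologicalSpace S] {O : FunctionSheaf S}

lemma IsPrimitiveDatum.exists_hasDifferentialAt {f : S → ℝ} {c : Chart O}
    {W : Set (Fin c.dim → ℝ)} {h : (Fin c.dim → ℝ) → ℝ} (hd : IsPrimitiveDatum f c W h) {x : S}
    (hx : x ∈ c.source) : ∃ ξ, HasDifferentialAt O f x ξ ∧ ∀ v : TangentSpaceAt O x, ξ v =
        fderiv ℝ (fun z => Real.log (h z)) (expMap (c.toFun x))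
          (fun i => TropReal.exp (c.toFun x i) * v (c.dcoord hx i)) := by
  let ξ : CotangentSpaceAt O x :=
    { toFun := fun v => fderiv ℝ (fun z => Real.log (h z)) (expMap (c.toFun x))
          (fun i => TropReal.exp (c.toFun x i) * v (c.dcoord hx i))
      map_add' := fun v w => by
        rw [← map_add]
        congr 1
        funext i
        exact mul_add _ _ _
      map_smul' := fun a v => by
        rw [RingHom.id_apply, ← map_smul]
        congr 1
        funext i
        exact mul_left_comm _ _ _ }
  exact ⟨ξ, ⟨c, W, h, hx, hd, fun _ => rfl⟩, fun _ => rfl⟩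

lemma IsWeaklySmoothAt.exists_hasDifferentialAt {f : S → ℝ} {x : S} (hf : IsWeaklySmoothAt O f x) :
    ∃ ξ, HasDifferentialAt O f x ξ := by
  obtain ⟨c, W, h, hx, hd⟩ := hf
  obtain ⟨ξ, hξ, -⟩ := hd.exists_hasDifferentialAt hx
  exact ⟨ξ, hξ⟩

lemma mk_eq_mk_of_eventually {x : S} {f g : O.stalk x} {f' g' : S → ℝ}
    (hf : (f : Germ (𝓝 x) ℝ) = (f' : Germ (𝓝 x) ℝ)) (hg : (g : Germ (𝓝 x) ℝ) = (g' : Germ (𝓝 x) ℝ))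
    {a : ℝ} (h : ∀ᶠ y in 𝓝 x, g' y = a + f' y) :
    (QuotientAddGroup.mk f : IntegralCotangent O x) = QuotientAddGroup.mk g := by
  refine QuotientAddGroup.eq.2 (AddSubgroup.mem_addSubgroupOf.2 ⟨a, ?_⟩)
  rw [AddSubgroup.coe_add, AddSubgroup.coe_neg, hf, hg, ← Germ.coe_neg, ← Germ.coe_add]
  refine Germ.coe_eq.2 ?_
  filter_upwards [h] with y hy
  simp [hy]

namespace LineChart

lemma coord_mem_stalk (ℓ : LineChart O) {x : S} (hx : x ∈ ℓ.source)
    (hr : ℓ.toFun x ≠ ⊥) : (ℓ.coord : Germ (𝓝 x) ℝ) ∈ O.stalk x :=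
  (ℓ.stalk_iff x hx _).2 ⟨1, 0, fun h => absurd h hr, .of_forall fun y => by simp [coord]⟩

/-- The differential of the coordinate of a line chart at a real point. -/
def dcoord (ℓ : LineChart O) {x : S} (hx : x ∈ ℓ.source)
    (hr : ℓ.toFun x ≠ ⊥) : IntegralCotangent O x := QuotientAddGroup.mk ⟨_, ℓ.coord_mem_stalk hx hr⟩

lemma mk_eq_zsmul_dcoord (ℓ : LineChart O) {x : S} (hx : x ∈ ℓ.source)
    (hr : ℓ.toFun x ≠ ⊥) {g : O.stalk x} {f : S → ℝ}
    (hg : (g : Germ (𝓝 x) ℝ) = (f : Germ (𝓝 x) ℝ)) {m : ℤ} {a : ℝ}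
    (h : ∀ᶠ y in 𝓝 x, f y = a + m * ℓ.coord y) :
    (QuotientAddGroup.mk g : IntegralCotangent O x) = m • ℓ.dcoord hx hr := by
  symm
  have := mk_eq_mk_of_eventually (f := m • ⟨_, ℓ.coord_mem_stalk hx hr⟩) (g := g)
    (f' := fun y => m * ℓ.coord y) (g' := f) ?_ hg h
  · exact this
  · rw [AddSubgroup.coe_zsmul]
    refine Germ.coe_eq.2 (.of_forall fun y => ?_)
    simp

lemma exists_zsmul_dcoord (ℓ : LineChart O) {x : S} (hx : x ∈ ℓ.source)
    (hr : ℓ.toFun x ≠ ⊥) (m : IntegralCotangent O x) : ∃ n : ℤ, m = n • ℓ.dcoord hx hr := by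
  obtain ⟨⟨g, hg⟩, rfl⟩ := QuotientAddGroup.mk_surjective m
  induction g using Germ.inductionOn with
  | h f =>
    obtain ⟨n, a, -, h⟩ := (ℓ.stalk_iff x hx f).1 hg
    exact ⟨n, ℓ.mk_eq_zsmul_dcoord hx hr rfl h⟩

/-- If `n` times the coordinate is constant near `x`, then `n = 0`, because the coordinate takes all
values near `ℓ.coord x`. -/
lemma zsmul_dcoord_eq_zero (ℓ : LineChart O) {x : S} (hx : x ∈ ℓ.source)
    (hr : ℓ.toFun x ≠ ⊥) {n : ℤ} (h : n • ℓ.dcoord hx hr = 0) : n = 0 := by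
  have h' : (QuotientAddGroup.mk (n • ⟨_, ℓ.coord_mem_stalk hx hr⟩) : IntegralCotangent O x) = 0 := h
  rw [QuotientAddGroup.eq_zero_iff] at h'
  obtain ⟨k, hk⟩ := AddSubgroup.mem_addSubgroupOf.1 h'
  have h₁ : ∀ᶠ y in 𝓝 x, k = n * ℓ.coord y := by
    filter_upwards [Germ.coe_eq.1 hk] with y hy
    simpa using hy
  have h₂ : ∀ᶠ s in 𝓝 (ℓ.coord x), n * s = k := by
    rw [← ℓ.map_coord_nhds hx hr, eventually_map]
    exact h₁.mono fun y hy => hy.symm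
  have := Filter.EventuallyEq.deriv_eq h₂
  simpa using this

lemma exists_apply_dcoord_eq_one (ℓ : LineChart O) {x : S} (hx : x ∈ ℓ.source)
    (hr : ℓ.toFun x ≠ ⊥) : ∃ v : TangentSpaceAt O x, v (ℓ.dcoord hx hr) = 1 := by
  have hb : Function.Bijective (zmultiplesHom (IntegralCotangent O x) (ℓ.dcoord hx hr)) := by
    refine ⟨(injective_iff_map_eq_zero _).2 fun n hn => ?_, fun m => ?_⟩
    · exact ℓ.zsmul_dcoord_eq_zero hx hr (by simpa using hn)
    · obtain ⟨n, hn⟩ := ℓ.exists_zsmul_dcoord hx hr m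
      exact ⟨n, by simp [hn]⟩
  let e := AddEquiv.ofBijective _ hb
  refine ⟨(Int.castAddHom ℝ).comp e.symm.toAddMonoidHom, ?_⟩
  have : e.symm (ℓ.dcoord hx hr) = 1 := by
    rw [AddEquiv.symm_apply_eq]
    simp [e]
  simp [this]

lemma tangent_ext (ℓ : LineChart O) {x : S} (hx : x ∈ ℓ.source)
    (hr : ℓ.toFun x ≠ ⊥) {v w : TangentSpaceAt O x} (h : v (ℓ.dcoord hx hr) = w (ℓ.dcoord hx hr)) :
    v = w := by
  refine DFunLike.ext _ _ fun m => ?_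
  obtain ⟨n, rfl⟩ := ℓ.exists_zsmul_dcoord hx hr m
  rw [map_zsmul, map_zsmul, h]

/-- The tangent space at a real point is a line. -/
def tangentEquiv (ℓ : LineChart O) {x : S} (hx : x ∈ ℓ.source)
    (hr : ℓ.toFun x ≠ ⊥) : TangentSpaceAt O x ≃ₗ[ℝ] ℝ :=
  LinearEquiv.ofBijective
    { toFun := fun v => v (ℓ.dcoord hx hr), map_add' := fun _ _ => rfl, map_smul' := fun _ _ => rfl }
    ⟨fun _ _ h => ℓ.tangent_ext hx hr h, fun a => by
      obtain ⟨v, hv⟩ := ℓ.exists_apply_dcoord_eq_one hx hr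
      refine ⟨a • v, ?_⟩
      change a * v _ = a
      rw [hv, mul_one]⟩

/-- A line chart has the whole tropical line as target, so the local cone is the full tangent line.
The relevant sheaf is then constant, and its micro-support is contained in the zero section. -/
lemma SS_subset (ℓ : LineChart O) {x : S} (hx : x ∈ ℓ.source)
    (hr : ℓ.toFun x ≠ ⊥) : SS O x ⊆ {0} := by
  rintro ξ ⟨n, e, hξ⟩
  have hn : n = 1 := by
    have h₁ := e.finrank_eq
    rw [(ℓ.tangentEquiv hx hr).finrank_eq] at h₁
    simpa using h₁.symm
  subst hn
  have hcone : e '' localCone O x = univ := by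
    have : localCone O x = univ := eq_univ_of_forall fun v =>
      ⟨ℓ.toChart, hx, .of_forall fun _ => trivial⟩
    rw [this, image_univ]
    exact e.surjective.range_eq
  rw [hcone] at hξ
  have h0 := microsupportAt_constZOn_univ_subset 0 hξ
  refine LinearMap.ext fun v => ?_
  have := congrArg (fun L : (Fin 1 → ℝ) →L[ℝ] ℝ => L (e v)) (mem_singleton_iff.1 h0)
  simpa using this

/-- The span of `SS` is zero, so the forbidden set is the lattice minus itself. -/
lemma isPrepermissibleAt (ℓ : LineChart O) {x : S} (hx : x ∈ ℓ.source)
    (hr : ℓ.toFun x ≠ ⊥) {f : S → ℝ} (hf : IsWeaklySmoothAt O f x) :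
    IsPrepermissibleAt O f x := by
  obtain ⟨ξ, hξ⟩ := hf.exists_hasDifferentialAt
  refine ⟨ξ, hξ, fun h => h.2 ?_⟩
  have hspan : Submodule.span ℝ (SS O x) = ⊥ :=
    Submodule.span_eq_bot.2 fun η hη => ℓ.SS_subset hx hr hη
  have h' := h.1
  rw [hspan, Submodule.bot_toAddSubgroup, bot_sup_eq] at h'
  exact h'

/-- The differential at a real point of a function is its derivative in the coordinate of a line
chart. -/
lemma hasDifferentialAt_apply (ℓ : LineChart O) {x : S} (hx : x ∈ ℓ.source)
    (hr : ℓ.toFun x ≠ ⊥) {f : S → ℝ} {ξ : CotangentSpaceAt O x}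
    (hξ : HasDifferentialAt O f x ξ) {F : ℝ → ℝ} (hF : ∀ᶠ y in 𝓝 x, f y = F (ℓ.coord y))
    (v : TangentSpaceAt O x) : ξ v = deriv F (ℓ.coord x) * v (ℓ.dcoord hx hr) := by
  obtain ⟨c, W, h, hxc, hd, hξv⟩ := hξ
  have hcoord : ∀ i, ∃ (g : ℝ → ℝ) (n : ℤ),
      HasDerivAt g ((c.toFun x i).exp * n) (ℓ.coord x) ∧
      (∀ v : TangentSpaceAt O x, (c.toFun x i).exp * v (c.dcoord hxc i) =
        (c.toFun x i).exp * n * v (ℓ.dcoord hx hr)) ∧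
      ∀ᶠ y in 𝓝 x, c.z y i = g (ℓ.coord y) := by
    intro i
    by_cases hi : c.toFun x i = ⊥
    · refine ⟨fun _ => 0, 0, by simpa using hasDerivAt_const _ _, fun v => by simp [hi], ?_⟩
      obtain ⟨C, m, -, hz⟩ := (ℓ.isNormalAt hx).2 c hxc i
      have h0 := hz.self_of_nhds
      rw [c.z_eq_zero.2 hi] at h0
      -- At a real point the coordinate of `ℓ` has nonzero exponential, so a monomial in it that
      -- vanishes at `x` has coefficient 0. Coordinates at `-∞` thus contribute nothing to the
      -- derivative.
      have hC : C = 0 := by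
        refine (mul_eq_zero.1 h0.symm).resolve_right (Finset.prod_ne_zero_iff.2 fun j _ => ?_)
        exact zpow_ne_zero _ (TropReal.exp_pos hr).ne'
      filter_upwards [hz] with y hy
      rw [hy, hC, zero_mul]
    · obtain ⟨n, a, -, hn⟩ := (ℓ.stalk_iff x hx _).1 (c.coord_mem hxc hi)
      have hz : ∀ᶠ y in 𝓝 x, c.z y i = Real.exp (a + n * ℓ.coord y) := by
        filter_upwards [hn, ((continuousAt_apply i _).comp (c.continuousAt hxc)).eventually_ne hi]
          with y h₁ h₂
        rw [c.z_apply, ← TropReal.exp_toReal (t := c.toFun y i) h₂, h₁]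
        rfl
      refine ⟨fun s => Real.exp (a + n * s), n, ?_, fun v => ?_, hz⟩
      · have h₁ : HasDerivAt (fun s : ℝ => a + n * s) n (ℓ.coord x) := by
          simpa using ((hasDerivAt_id (ℓ.coord x)).const_mul (n : ℝ)).const_add a
        have h₂ := h₁.exp
        rwa [← hz.self_of_nhds, c.z_apply] at h₂
      · have h₁ : c.dcoord hxc i = n • ℓ.dcoord hx hr := by
          rw [Chart.dcoord, dif_neg hi]
          exact ℓ.mk_eq_zsmul_dcoord hx hr rfl hn
        rw [h₁, map_zsmul, zsmul_eq_mul, mul_assoc]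
  choose g n hg hgv hgz using hcoord
  have hxW : c.z x ∈ W := hd.mem x hxc
  have hgx : (fun i => g i (ℓ.coord x)) = c.z x := funext fun i => (hgz i).self_of_nhds.symm
  have hdiff : DifferentiableAt ℝ (fun w => Real.log (h w)) (c.z x) :=
    ((hd.smooth.contDiffAt (hd.isOpen.mem_nhds hxW)).differentiableAt (by simp)).log
      (hd.pos _ hxW).ne'
  have hder : HasDerivAt (fun s => Real.log (h fun i => g i s))
      (fderiv ℝ (fun w => Real.log (h w)) (c.z x) fun i => (c.toFun x i).exp * n i)
      (ℓ.coord x) := by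
    have h₁ := hasDerivAt_pi.2 hg
    rw [← hgx] at hdiff ⊢
    exact hdiff.hasFDerivAt.comp_hasDerivAt (ℓ.coord x) h₁
  have hFeq : F =ᶠ[𝓝 (ℓ.coord x)] fun s => Real.log (h fun i => g i s) := by
    rw [← ℓ.map_coord_nhds hx hr, EventuallyEq, eventually_map]
    filter_upwards [hF, eventually_all.2 hgz, c.source.isOpen.mem_nhds hxc] with y h₁ h₂ h₃
    rw [← h₁, hd.eq y h₃]
    congr 2
    exact funext h₂
  rw [hFeq.deriv_eq, hder.deriv, hξv]
  change fderiv ℝ (fun w => Real.log (h w)) (c.z x) _ = _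
  rw [mul_comm, ← smul_eq_mul, ← map_smul]
  congr 1
  funext i
  rw [hgv i v, Pi.smul_apply, smul_eq_mul, mul_comm]

lemma mem_integralCovectors_iff (ℓ : LineChart O) {x : S} (hx : x ∈ ℓ.source)
    (hr : ℓ.toFun x ≠ ⊥) {f : S → ℝ} {ξ : CotangentSpaceAt O x}
    (hξ : HasDifferentialAt O f x ξ) {F : ℝ → ℝ} (hF : ∀ᶠ y in 𝓝 x, f y = F (ℓ.coord y)) :
    ξ ∈ integralCovectors O x ↔ ∃ n : ℤ, deriv F (ℓ.coord x) = n := by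
  have key := ℓ.hasDifferentialAt_apply hx hr hξ hF
  constructor
  · rintro ⟨m, rfl⟩
    obtain ⟨n, rfl⟩ := ℓ.exists_zsmul_dcoord hx hr m
    obtain ⟨v, hv⟩ := ℓ.exists_apply_dcoord_eq_one hx hr
    refine ⟨n, ?_⟩
    have h₁ := key v
    rw [hv, mul_one] at h₁
    rw [← h₁]
    change v (n • _) = _
    rw [map_zsmul, hv]
    simp
  · rintro ⟨n, hn⟩
    refine ⟨n • ℓ.dcoord hx hr, LinearMap.ext fun v => ?_⟩
    rw [key v, hn]
    change v (n • _) = _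
    rw [map_zsmul, zsmul_eq_mul]

lemma isCriticalPoint_iff (ℓ : LineChart O) {x : S} (hx : x ∈ ℓ.source)
    (hr : ℓ.toFun x ≠ ⊥) {f : S → ℝ} (hf : IsWeaklySmoothAt O f x)
    {F : ℝ → ℝ} (hF : ∀ᶠ y in 𝓝 x, f y = F (ℓ.coord y)) :
    IsCriticalPoint O f x ↔ deriv F (ℓ.coord x) = 0 := by
  constructor
  · intro h
    obtain ⟨v, hv⟩ := ℓ.exists_apply_dcoord_eq_one hx hr
    have := ℓ.hasDifferentialAt_apply hx hr h hF v
    rw [hv, mul_one] at this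
    exact this.symm
  · intro h
    obtain ⟨ξ, hξ⟩ := hf.exists_hasDifferentialAt
    have : ξ = 0 := LinearMap.ext fun v => by
      rw [ℓ.hasDifferentialAt_apply hx hr hξ hF v, h, zero_mul]
      rfl
    rwa [this] at hξ

end LineChart

end Spaces

end Tropical

end

noncomputable section

/-! ## Bump functions, special points and their standard functions -/

namespace Tropical

section Spaces

variable {S : Type u} [TopologicalSpace S] {O : FunctionSheaf S}

/-- A smooth bump in the exponential coordinates is extended by zero. Its radius is chosen so small
that its support lies in a closed set inside the chart, which makes the extension weakly-smooth. -/
lemma exists_bump [T2Space S] [CompactSpace S] (hC : IsTropicalCurve O) {x : S} {N : Set S}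
    (hN : N ∈ 𝓝 x) : ∃ ρ : S → ℝ, (∀ y, IsWeaklySmoothAt O ρ y) ∧ (∀ᶠ y in 𝓝 x, ρ y = 1) ∧
      tsupport ρ ⊆ N ∧ ∀ y, 0 ≤ ρ y := by
  classical
  obtain ⟨c, hx, -⟩ := hC x
  obtain ⟨K, hK, hKc, hKN⟩ := exists_mem_nhds_isClosed_subset
    (inter_mem hN (c.source.isOpen.mem_nhds hx))
  have hK' := hK
  rw [c.nhds_eq_comap_z hx, mem_inf_principal, mem_comap] at hK'
  obtain ⟨t, ht, htK⟩ := hK'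
  obtain ⟨ε, hε, hεt⟩ := Metric.mem_nhds_iff.1 ht
  let χ : ContDiffBump (c.z x) := ⟨ε / 2, ε, by positivity, by linarith⟩
  let ρ : S → ℝ := fun y => if y ∈ c.source then χ (c.z y) else 0
  have hsupp : Function.support ρ ⊆ K := by
    intro y hy
    have hys : y ∈ c.source := by
      by_contra h
      exact hy (if_neg h)
    rw [Function.mem_support, show ρ y = χ (c.z y) from if_pos hys, ← Function.mem_support,
      χ.support_eq] at hy
    exact htK (hεt hy) hys
  have hts : tsupport ρ ⊆ K := closure_minimal hsupp hKc
  have hρ : ∀ y ∈ c.source, ρ =ᶠ[𝓝 y] fun y => χ (c.z y) := fun y hy => by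
    filter_upwards [c.source.isOpen.mem_nhds hy] with y' hy' using if_pos hy'
  refine ⟨ρ, fun y => ?_, ?_, hts.trans fun y hy => (hKN hy).1, fun y => ?_⟩
  · by_cases hy : y ∈ c.source
    · exact (c.isSmoothAt_comp χ.contDiff hy).isWeaklySmoothAt.congr hC (hρ y hy).symm
    · have h0 : ρ =ᶠ[𝓝 y] fun _ => 0 :=
        notMem_tsupport_iff_eventuallyEq.1 fun h => hy (hKN (hts h)).2
      exact (isWeaklySmoothAt_const hC 0 y).congr hC h0.symm
  · filter_upwards [hρ x hx, (c.continuousAt_z hx) χ.eventuallyEq_one] with y h₁ h₂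
    rw [h₁]
    exact h₂
  · by_cases hy : y ∈ c.source
    · rw [show ρ y = χ (c.z y) from if_pos hy]
      exact χ.nonneg
    · rw [show ρ y = 0 from if_neg hy]

lemma isWeaklySmoothAt_mul_of_tsupport (hC : IsTropicalCurve O) {ρ f : S → ℝ} {x : S}
    (hρ : IsWeaklySmoothAt O ρ x) (hf : x ∈ tsupport ρ → IsWeaklySmoothAt O f x) :
    IsWeaklySmoothAt O (ρ * f) x := by
  by_cases hx : x ∈ tsupport ρ
  · exact hρ.mul hC (hf hx)
  · refine (isWeaklySmoothAt_const hC 0 x).congr hC ?_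
    filter_upwards [notMem_tsupport_iff_eventuallyEq.1 hx] with y hy
    rw [Pi.mul_apply, hy, Pi.zero_apply, zero_mul]

lemma exists_partitionOfUnity [T2Space S] [CompactSpace S] (hC : IsTropicalCurve O)
    (N : S → Set S) (hN : ∀ x, N x ∈ 𝓝 x) : ∃ (T : Finset S) (ρ : S → S → ℝ),
      (∀ x y, IsWeaklySmoothAt O (ρ x) y) ∧ (∀ x, tsupport (ρ x) ⊆ N x) ∧
        ∀ y, ∑ x ∈ T, ρ x y = 1 := by
  choose b hb hb1 hbs hb0 using fun x => exists_bump hC (hN x)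
  obtain ⟨T, -, hT⟩ := isCompact_univ.elim_nhds_subcover _ fun x _ => hb1 x
  let B : S → ℝ := ∑ x ∈ T, b x
  have hB : ∀ y, B y ≠ 0 := by
    intro y
    obtain ⟨x, hxT, hx⟩ := mem_iUnion₂.1 (hT (mem_univ y))
    have : b x y ≤ B y := by
      rw [show B y = ∑ x ∈ T, b x y from Finset.sum_apply _ _ _]
      exact Finset.single_le_sum (fun x _ => hb0 x y) hxT
    rw [show b x y = 1 from hx] at this
    exact (one_pos.trans_le this).ne'
  -- The bumps are normalized by their finite sum, which is positive because the sets where some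
  -- bump equals 1 cover the curve.
  refine ⟨T, fun x => b x / B, fun x y => (hb x y).div hC
    (IsWeaklySmoothAt.sum hC T fun x _ => hb x y) (hB y), fun x => ?_, fun y => ?_⟩
  · refine (closure_mono fun y hy => ?_).trans (hbs x)
    rw [Function.mem_support] at hy ⊢
    exact fun h => hy (show b x y / B y = 0 by rw [h, zero_div])
  · simp only [Pi.div_apply]
    rw [← Finset.sum_div, show B y = ∑ x ∈ T, b x y from Finset.sum_apply _ _ _]
    refine div_self ?_
    rw [← Finset.sum_apply]
    exact hB y

variable (O) in
/-- `x` is a real point of some line chart. -/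
def IsRealPoint (x : S) : Prop := ∃ ℓ : LineChart O, x ∈ ℓ.source ∧ ℓ.toFun x ≠ ⊥

lemma IsRealPoint.eventually {x : S} (h : IsRealPoint O x) : ∀ᶠ y in 𝓝 x, IsRealPoint O y := by
  obtain ⟨ℓ, hx, hr⟩ := h
  filter_upwards [ℓ.eventually_real hx hr] with y hy using ⟨ℓ, hy⟩

/-- The function `q` behaves at the point `x` like `∑ ψ_i²` at a star centre `ψ = 0`. -/
structure IsStandardAt (O : FunctionSheaf S) (q : S → ℝ) (x : S) : Prop where
  eq_zero : q x = 0
  smooth : IsWeaklySmoothAt O q x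
  critical : IsCriticalPoint O q x
  nonneg : ∀ᶠ y in 𝓝 x, 0 ≤ q y
  profile : ∀ᶠ y in 𝓝[≠] x, ∃ (ℓ : LineChart O) (F : ℝ → ℝ), y ∈ ℓ.source ∧ ℓ.toFun y ≠ ⊥ ∧
    ContDiffAt ℝ 2 F (ℓ.coord y) ∧ (∀ᶠ y' in 𝓝 y, q y' = F (ℓ.coord y')) ∧
      ∀ n : ℤ, deriv F (ℓ.coord y) ≠ n

lemma Int.ne_cast_of_abs_lt_one {a : ℝ} (h0 : a ≠ 0) (h1 : |a| < 1) (n : ℤ) : a ≠ n := by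
  rintro rfl
  rw [← Int.cast_abs, ← Int.cast_one, Int.cast_lt, Int.abs_lt_one_iff] at h1
  exact h0 (by rw [h1, Int.cast_zero])

/-- In the tropical coordinate `s` the function is `exp s`. Its slope lies strictly between 0 and 1
near `-∞`, and its differential at `-∞` vanishes because of the factor `exp (-∞) = 0`. -/
lemma LineChart.isStandardAt (ℓ : LineChart O) {x : S} (hx : x ∈ ℓ.source) (hb : ℓ.toFun x = ⊥) :
    IsStandardAt O (fun y => (ℓ.toFun y).exp) x := by
  have hs : ℓ.toChart.IsSmoothAt (fun y => (ℓ.toFun y).exp) x :=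
    ℓ.toChart.isSmoothAt_comp (F := fun w => w (0 : Fin 1)) (contDiff_apply ℝ ℝ _) hx
  have hcont : ContinuousAt (fun y => (ℓ.toFun y).exp) x :=
    TropReal.continuous_exp.continuousAt.comp (ℓ.continuousAt hx)
  refine ⟨by simp [hb], hs.isWeaklySmoothAt, ?_, .of_forall fun y => TropReal.exp_nonneg _, ?_⟩
  · obtain ⟨U, W, F, hxU, -, -, hd⟩ := hs.exists_datum univ univ_mem
    obtain ⟨ξ, hξ, hξv⟩ := hd.exists_hasDifferentialAt (x := x) ⟨hx, hxU⟩
    have : ξ = 0 := LinearMap.ext fun v => by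
      rw [hξv]
      have h0 : (fun i => TropReal.exp ((ℓ.toChart.restrict U).toFun x i) *
          v ((ℓ.toChart.restrict U).dcoord ⟨hx, hxU⟩ i)) = 0 := funext fun i => by
        have : (ℓ.toChart.restrict U).toFun x i = ⊥ := hb
        rw [this, TropReal.exp_bot, zero_mul, Pi.zero_apply]
      rw [h0, map_zero]
      rfl
    rwa [this] at hξ
  · have h1 : ∀ᶠ y in 𝓝 x, (ℓ.toFun y).exp < 1 :=
      hcont.eventually (gt_mem_nhds (by simp [hb]))
    filter_upwards [nhdsWithin_le_nhds h1, nhdsWithin_le_nhds (ℓ.source.isOpen.mem_nhds hx),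
      self_mem_nhdsWithin] with y hy1 hys hyx
    have hyb : ℓ.toFun y ≠ ⊥ := fun h => hyx (ℓ.injOn hys hx (h.trans hb.symm))
    refine ⟨ℓ, Real.exp, hys, hyb, Real.contDiff_exp.contDiffAt, ?_, fun n => ?_⟩
    · filter_upwards [ℓ.eventually_real hys hyb] with y' hy'
      exact (TropReal.exp_toReal hy'.2).symm
    · rw [Real.deriv_exp]
      refine Int.ne_cast_of_abs_lt_one (Real.exp_pos _).ne' ?_ n
      rwa [Real.abs_exp, LineChart.coord, TropReal.exp_toReal hyb]

/-- The vertex is a minimum of the sum of squares, hence critical. On each ray the function is `k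
s²`, whose slope is nonzero away from the vertex and of absolute value below 1 close to it. -/
lemma Chart.IsStarAt.isStandardAt {c : Chart O} {x : S} (hc : c.IsStarAt x) :
    IsStandardAt O (fun y => ∑ i, (c.toFun y i).toReal ^ 2) x := by
  let F : (Fin c.dim → ℝ) → ℝ := fun w => ∑ i, Real.log (w i) ^ 2
  have hz : ∀ i, c.z x i = 1 := fun i => by rw [c.z_apply, hc.eq_zero]; exact Real.exp_zero
  have hsF : ContDiffOn ℝ ∞ F (⋂ i, {w | w i ≠ 0}) := ContDiffOn.sum fun i _ =>
    ((contDiff_apply ℝ ℝ i).contDiffOn.log fun w hw => mem_iInter.1 hw i).pow 2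
  have hqF : ∀ y, ∑ i, (c.toFun y i).toReal ^ 2 = F (c.z y) := fun y => by
    simp only [F, c.z_apply, TropReal.log_exp]
  have hW : IsOpen (⋂ i, {w : Fin c.dim → ℝ | w i ≠ 0}) := isOpen_iInter_of_finite fun i =>
    isOpen_ne.preimage (continuous_apply i)
  have hxW : c.z x ∈ ⋂ i, {w : Fin c.dim → ℝ | w i ≠ 0} := mem_iInter.2 fun i => by
    change c.z x i ≠ 0
    rw [hz]; exact one_ne_zero
  have hF0 : F (c.z x) = 0 := by simp [F, hz]
  have hs : c.IsSmoothAt (fun y => ∑ i, (c.toFun y i).toReal ^ 2) x :=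
    ⟨hc.mem, _, F, hW, hxW, hsF, .of_forall hqF⟩
  refine ⟨by rw [hqF, hF0], hs.isWeaklySmoothAt, ?_,
    .of_forall fun y => Finset.sum_nonneg fun i _ => sq_nonneg _, ?_⟩
  · have hd : IsPrimitiveDatum (fun y => ∑ i, (c.toFun y i).toReal ^ 2) (c.restrict
        ⟨_, c.continuousOn_z.isOpen_inter_preimage c.source.isOpen hW⟩) _
        (fun w => Real.exp (F w)) :=
      ⟨hW, Real.contDiff_exp.comp_contDiffOn hsF, fun _ _ => Real.exp_pos _, fun y hy => hy.2.2,
        fun y _ => by rw [Real.log_exp]; exact hqF y⟩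
    obtain ⟨ξ, hξ, hξv⟩ := hd.exists_hasDifferentialAt (x := x) ⟨hc.mem, hc.mem, hxW⟩
    have hmin : IsLocalMin F (c.z x) := .of_forall fun w => by
      rw [hF0]
      exact Finset.sum_nonneg fun i _ => sq_nonneg _
    have : ξ = 0 := LinearMap.ext fun v => by
      rw [hξv]
      simp only [Real.log_exp]
      change fderiv ℝ F (c.z x) _ = _
      rw [hmin.fderiv_eq_zero]
      rfl
    rwa [this] at hξ
  · have hsmall : ∀ᶠ y in 𝓝 x, ∀ i, |2 * c.dim * (c.toFun y i).toReal| < 1 := by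
      refine eventually_all.2 fun i => ?_
      have h1 : ContinuousAt (fun y => (c.toFun y i).toReal) x :=
        ContinuousAt.comp (f := fun y => c.toFun y i) (g := TropReal.toReal)
          (TropReal.continuousAt_toReal (by rw [hc.eq_zero]; exact WithBot.coe_ne_bot))
          ((continuousAt_apply i _).comp (c.continuousAt hc.mem))
      have h2 : ContinuousAt (fun y => |2 * c.dim * (c.toFun y i).toReal|) x :=
        (continuousAt_const.mul h1).abs
      refine h2.eventually (gt_mem_nhds ?_)
      simp [hc.eq_zero]
    filter_upwards [nhdsWithin_le_nhds (hc.eventually univ_mem), self_mem_nhdsWithin,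
      nhdsWithin_le_nhds hsmall] with y hy hyx hys
    rcases hy with h | ⟨ℓ, A, i, hyA, -, hA, hℓ, hne, hcoord⟩
    · exact absurd h hyx
    have hdim : (1 : ℝ) ≤ c.dim := by exact_mod_cast i.pos
    -- On a positive ray one coordinate varies and `k = 1`; on the diagonal ray all of them do and
    -- `k` is the dimension.
    have key : ∃ k : ℝ, 0 < k ∧ k ≤ c.dim ∧
        ∀ y ∈ ℓ.source, ∑ i, (c.toFun y i).toReal ^ 2 = k * ℓ.coord y ^ 2 := by
      rcases hcoord with h | h
      · refine ⟨1, one_pos, hdim, fun y hy => ?_⟩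
        simp [h y hy]
      · refine ⟨c.dim, by linarith, le_rfl, fun y hy => ?_⟩
        simp [h y hy]
    obtain ⟨k, hk0, hk, hq⟩ := key
    have hyℓ := hA.subset_source hyA
    refine ⟨ℓ, fun s => k * s ^ 2, hyℓ, hA.ne_bot y hyA, by fun_prop, ?_, fun n => ?_⟩
    · filter_upwards [ℓ.source.isOpen.mem_nhds hyℓ] with y' hy' using hq y' hy'
    · have hd : deriv (fun s : ℝ => k * s ^ 2) (ℓ.coord y) = 2 * k * ℓ.coord y := by
        rw [deriv_const_mul _ (by fun_prop), deriv_pow_field]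
        push_cast
        ring
      rw [hd]
      refine Int.ne_cast_of_abs_lt_one (by positivity) (lt_of_le_of_lt ?_ (hys i)) n
      have : (c.toFun y i).toReal = ℓ.coord y := by rw [LineChart.coord, hℓ]
      rw [this, abs_mul, abs_mul (2 * (c.dim : ℝ)), abs_of_pos (by positivity : 0 < 2 * k),
        abs_of_nonneg (by positivity : (0 : ℝ) ≤ 2 * c.dim)]
      gcongr

lemma exists_isStandardAt (hC : IsTropicalCurve O) {x : S} (hx : ¬ IsRealPoint O x) :
    ∃ q : S → ℝ, IsStandardAt O q x := by
  rcases exists_lineChart_or_isStarAt hC x with ⟨ℓ, hℓ⟩ | ⟨c, hc⟩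
  · refine ⟨_, ℓ.isStandardAt hℓ ?_⟩
    by_contra h
    exact hx ⟨ℓ, hℓ, h⟩
  · exact ⟨_, hc.isStandardAt⟩

lemma eventually_isRealPoint (hC : IsTropicalCurve O) (x : S) :
    ∀ᶠ y in 𝓝[≠] x, IsRealPoint O y := by
  by_cases hx : IsRealPoint O x
  · exact nhdsWithin_le_nhds hx.eventually
  · obtain ⟨q, hq⟩ := exists_isStandardAt hC hx
    refine hq.profile.mono ?_
    rintro y ⟨ℓ, F, h₁, h₂, -⟩
    exact ⟨ℓ, h₁, h₂⟩

lemma finite_of_eventually_notMem [CompactSpace S] {Z : Set S}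
    (h : ∀ x, ∀ᶠ y in 𝓝[≠] x, y ∉ Z) : Z.Finite := by
  obtain ⟨T, -, hT⟩ := isCompact_univ.elim_nhds_subcover (fun x => {y | y ≠ x → y ∉ Z})
    fun x _ => eventually_nhdsWithin_iff.1 (h x)
  refine T.finite_toSet.subset fun y hy => ?_
  obtain ⟨x, hxT, hx⟩ := mem_iUnion₂.1 (hT (mem_univ y))
  by_contra hyT
  exact hx (fun h => hyT (h ▸ hxT)) hy

lemma finite_special [CompactSpace S] (hC : IsTropicalCurve O) :
    {x | ¬ IsRealPoint O x}.Finite :=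
  finite_of_eventually_notMem fun x => (eventually_isRealPoint hC x).mono fun _ h h' => h' h

end Spaces

end Tropical

end

noncomputable section

/-! ## Nondegenerate divisors -/

namespace Tropical

lemma isClosed_range_intCast : IsClosed (range ((↑) : ℤ → ℝ)) :=
  Int.isClosedEmbedding_coe_real.isClosed_range

lemma contDiffAt_deriv {F : ℝ → ℝ} {r : ℝ} (h : ContDiffAt ℝ 2 F r) :
    ContDiffAt ℝ 1 (deriv F) r := h.derivWithin (by rw [one_add_one_eq_two])

lemma continuousAt_deriv_deriv {F : ℝ → ℝ} {r : ℝ} (h : ContDiffAt ℝ 2 F r) :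
    ContinuousAt (deriv (deriv F)) r :=
  ((contDiffAt_deriv h).derivWithin (m := 0) (by rw [zero_add])).continuousAt

lemma eventually_contDiffAt {F : ℝ → ℝ} {r : ℝ} (h : ContDiffAt ℝ 2 F r) :
    ∀ᶠ s in 𝓝 r, ContDiffAt ℝ 2 F s := h.eventually (by decide)

/-- The derivative of `F` at `r` is not an integer, or `r` is a nondegenerate critical point of `F`
modulo linear functions with integral slope. -/
def IsMorseAt (F : ℝ → ℝ) (r : ℝ) : Prop := deriv F r ∉ range ((↑) : ℤ → ℝ) ∨ deriv (deriv F) r ≠ 0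

lemma deriv_add_mul {F B : ℝ → ℝ} {r : ℝ} (hF : ContDiffAt ℝ 2 F r) (hB : ContDiffAt ℝ 2 B r)
    (ε : ℝ) : (∀ᶠ s in 𝓝 r, deriv (fun s => F s + ε * B s) s = deriv F s + ε * deriv B s) ∧
      deriv (deriv fun s => F s + ε * B s) r = deriv (deriv F) r + ε * deriv (deriv B) r := by
  have h₁ : ∀ᶠ s in 𝓝 r, deriv (fun s => F s + ε * B s) s = deriv F s + ε * deriv B s := by
    filter_upwards [eventually_contDiffAt hF, eventually_contDiffAt hB] with s h₁ h₂
    have h₃ := h₁.differentiableAt (by decide)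
    have h₄ := h₂.differentiableAt (by decide)
    exact (h₃.hasDerivAt.add (h₄.hasDerivAt.const_mul ε)).deriv
  refine ⟨h₁, ?_⟩
  rw [EventuallyEq.deriv_eq h₁]
  have h₃ := (contDiffAt_deriv hF).differentiableAt (by decide)
  have h₄ := (contDiffAt_deriv hB).differentiableAt (by decide)
  exact (h₃.hasDerivAt.add (h₄.hasDerivAt.const_mul ε)).deriv

/-- Both alternatives are open conditions, jointly in the parameter and the point, because the
integers are closed in `ℝ` and the first two derivatives are continuous. -/
lemma IsMorseAt.eventually_add {F B : ℝ → ℝ} {r : ℝ} (h : IsMorseAt F r) (hF : ContDiffAt ℝ 2 F r)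
    (hB : ContDiffAt ℝ 2 B r) :
    ∀ᶠ p : ℝ × ℝ in 𝓝 (0, r), IsMorseAt (fun s => F s + p.1 * B s) p.2 := by
  have hF2 : ∀ᶠ p : ℝ × ℝ in 𝓝 (0, r), ContDiffAt ℝ 2 F p.2 :=
    (continuousAt_snd (p := ((0 : ℝ), r))).eventually (eventually_contDiffAt hF)
  have hB2 : ∀ᶠ p : ℝ × ℝ in 𝓝 (0, r), ContDiffAt ℝ 2 B p.2 :=
    (continuousAt_snd (p := ((0 : ℝ), r))).eventually (eventually_contDiffAt hB)
  rcases h with h | h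
  · have hc : ContinuousAt (fun p : ℝ × ℝ => deriv F p.2 + p.1 * deriv B p.2) (0, r) := by
      have h₁ : ContinuousAt (fun p : ℝ × ℝ => deriv F p.2) (0, r) :=
        ContinuousAt.comp (f := Prod.snd) (g := deriv F) (contDiffAt_deriv hF).continuousAt continuousAt_snd
      have h₂ : ContinuousAt (fun p : ℝ × ℝ => deriv B p.2) (0, r) :=
        ContinuousAt.comp (f := Prod.snd) (g := deriv B) (contDiffAt_deriv hB).continuousAt continuousAt_snd
      exact h₁.add (continuousAt_fst.mul h₂)
    filter_upwards [hF2, hB2, hc.preimage_mem_nhds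
      (isClosed_range_intCast.isOpen_compl.mem_nhds (by simpa using h))] with p h₁ h₂ h₃
    left
    rw [(deriv_add_mul h₁ h₂ p.1).1.self_of_nhds]
    exact h₃
  · have hc : ContinuousAt (fun p : ℝ × ℝ => deriv (deriv F) p.2 + p.1 * deriv (deriv B) p.2)
        (0, r) := by
      have h₁ : ContinuousAt (fun p : ℝ × ℝ => deriv (deriv F) p.2) (0, r) :=
        ContinuousAt.comp (f := Prod.snd) (g := deriv (deriv F)) (continuousAt_deriv_deriv hF) continuousAt_snd
      have h₂ : ContinuousAt (fun p : ℝ × ℝ => deriv (deriv B) p.2) (0, r) :=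
        ContinuousAt.comp (f := Prod.snd) (g := deriv (deriv B)) (continuousAt_deriv_deriv hB) continuousAt_snd
      exact h₁.add (continuousAt_fst.mul h₂)
    filter_upwards [hF2, hB2, hc.eventually_ne (by simpa using h)] with p h₁ h₂ h₃
    right
    rw [(deriv_add_mul h₁ h₂ p.1).2]
    exact h₃

/-- If `F'` takes an integral value `n` at `r`, then `F'' ≠ 0` keeps it away from `n` at nearby
points, and continuity keeps it within distance 1 of `n`, so no other integer is reached. -/
lemma IsMorseAt.eventually_notMem {F : ℝ → ℝ} {r : ℝ} (h : IsMorseAt F r)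
    (hF : ContDiffAt ℝ 2 F r) : ∀ᶠ s in 𝓝[≠] r, deriv F s ∉ range ((↑) : ℤ → ℝ) := by
  have hcont := (contDiffAt_deriv hF).continuousAt
  by_cases hr : deriv F r ∈ range ((↑) : ℤ → ℝ)
  · obtain ⟨n, hn⟩ := hr
    have h2 : deriv (deriv F) r ≠ 0 := h.resolve_left fun h' => h' ⟨n, hn⟩
    have hd := ((contDiffAt_deriv hF).differentiableAt (by decide)).hasDerivAt
    have h3 : ∀ᶠ s in 𝓝 r, |deriv F s - n| < 1 := by
      refine (hcont.sub continuousAt_const).abs.eventually (gt_mem_nhds ?_)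
      simp [hn]
    filter_upwards [hd.eventually_ne (c := (n : ℝ)) h2, nhdsWithin_le_nhds h3] with s h₁ h₂
    rintro ⟨m, hm⟩
    rw [← hm, ← Int.cast_sub, ← Int.cast_abs, ← Int.cast_one, Int.cast_lt,
      Int.abs_lt_one_iff, sub_eq_zero] at h₂
    exact h₁ (by rw [← hm, h₂])
  · exact nhdsWithin_le_nhds (hcont.preimage_mem_nhds
      (isClosed_range_intCast.isOpen_compl.mem_nhds hr))

/-- Sard's theorem: adding almost any linear function makes a `C²` function Morse. -/
lemma volume_not_isMorseAt_add {F : ℝ → ℝ} {J : Set ℝ} (hF : ∀ r ∈ J, ContDiffAt ℝ 2 F r) :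
    MeasureTheory.volume {ε : ℝ | ∃ r ∈ J, ¬ IsMorseAt (fun s => F s + ε * s) r} = 0 := by
  -- The parameter `ε` is bad at `r` when `F' r + ε` is an integer `n` and `F'' r = 0`. Then `ε` is
  -- a critical value of the C¹ function `n - F'`, and there are countably many `n`.
  refine MeasureTheory.measure_mono_null
    (t := ⋃ n : ℤ, (fun r => n - deriv F r) '' {r ∈ J | deriv (deriv F) r = 0}) ?_
    (MeasureTheory.measure_iUnion_null fun n => ?_)
  · rintro ε ⟨r, hr, hm⟩
    rw [IsMorseAt, not_or, not_not, not_not] at hm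
    have hd := deriv_add_mul (hF r hr) contDiffAt_id ε
    obtain ⟨⟨n, hn⟩, h0⟩ := hm
    have h1 := hd.1.self_of_nhds
    have h2 := hd.2
    simp only [id_eq, deriv_id', deriv_const, mul_zero, add_zero, mul_one, deriv_id] at h1 h2
    refine mem_iUnion.2 ⟨n, r, ⟨hr, ?_⟩, ?_⟩
    · rw [← h2]; exact h0
    · change (n : ℝ) - deriv F r = ε
      rw [hn, h1]; ring
  · refine MeasureTheory.addHaar_image_eq_zero_of_det_fderivWithin_eq_zero _
      (f' := fun _ => 0) (fun r hr => ?_) fun r _ => by simp [ContinuousLinearMap.det]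
    have h := ((contDiffAt_deriv (hF r hr.1)).differentiableAt (by decide)).hasDerivAt.const_sub
      (n : ℝ)
    rw [hr.2, neg_zero] at h
    have h' := h.hasFDerivAt
    have h0 : ContinuousLinearMap.toSpanSingleton ℝ (0 : ℝ) = 0 := by ext; simp
    rw [h0] at h'
    exact h'.hasFDerivWithinAt

section Spaces

variable {S : Type u} [TopologicalSpace S] {O : FunctionSheaf S}

namespace CInftyDivisor

/-- The sum of a divisor and a principal divisor. -/
def addPrincipal (hC : IsTropicalCurve O) (s : CInftyDivisor O) (g : S → ℝ)
    (hg : ∀ x, IsWeaklySmoothAt O g x) : CInftyDivisor O where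
  toFun x := s.toFun x + QuotientAddGroup.mk (g : Germ (𝓝 x) ℝ)
  locally_weaklySmooth x := by
    obtain ⟨U, f, hx, hf, h⟩ := s.locally_weaklySmooth x
    refine ⟨U, f + g, hx, fun y hy => (hf y hy).add hC (hg y), fun y hy => ?_⟩
    rw [h y hy]
    rfl

/-- Near `x` the divisor `s` is represented by the function `f`. -/
def RepAt (s : CInftyDivisor O) (f : S → ℝ) (x : S) : Prop :=
  ∀ᶠ y in 𝓝 x, IsWeaklySmoothAt O f y ∧ s.toFun y = QuotientAddGroup.mk (f : Germ (𝓝 y) ℝ)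

lemma exists_repAt (s : CInftyDivisor O) (x : S) : ∃ f, s.RepAt f x := by
  obtain ⟨U, f, hx, hf, h⟩ := s.locally_weaklySmooth x
  refine ⟨f, ?_⟩
  filter_upwards [U.isOpen.mem_nhds hx] with y hy using ⟨hf y hy, h y hy⟩

lemma RepAt.eventually {s : CInftyDivisor O} {f : S → ℝ} {x : S} (h : s.RepAt f x) :
    ∀ᶠ y in 𝓝 x, s.RepAt f y := eventually_eventually_nhds.2 h

lemma RepAt.isWeaklySmoothAt {s : CInftyDivisor O} {f : S → ℝ} {x : S} (h : s.RepAt f x) :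
    IsWeaklySmoothAt O f x := h.self_of_nhds.1

lemma RepAt.addPrincipal (hC : IsTropicalCurve O) {s : CInftyDivisor O} {f : S → ℝ} {x : S}
    (h : s.RepAt f x) {g : S → ℝ} (hg : ∀ x, IsWeaklySmoothAt O g x) :
    (s.addPrincipal hC g hg).RepAt (f + g) x := by
  filter_upwards [h] with y hy
  refine ⟨hy.1.add hC (hg y), ?_⟩
  change s.toFun y + _ = _
  rw [hy.2]
  rfl

lemma RepAt.congr (hC : IsTropicalCurve O) {s : CInftyDivisor O} {f f' : S → ℝ} {x : S}
    (h : s.RepAt f x) (hf : f =ᶠ[𝓝 x] f') : s.RepAt f' x := by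
  filter_upwards [h, eventually_eventually_nhds.2 hf] with y hy hy'
  exact ⟨hy.1.congr hC hy', by rw [hy.2, Germ.coe_eq.2 hy']⟩

lemma LinearlyEquivalent.refl (hC : IsTropicalCurve O) (s : CInftyDivisor O) :
    s.LinearlyEquivalent s :=
  ⟨fun _ => 0, fun x _ => isWeaklySmoothAt_const hC 0 x, fun x => by
    rw [sub_self]
    rfl⟩

lemma LinearlyEquivalent.addPrincipal (hC : IsTropicalCurve O) {s s' : CInftyDivisor O}
    (h : s'.LinearlyEquivalent s) {g : S → ℝ} (hg : ∀ x, IsWeaklySmoothAt O g x) :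
    (s'.addPrincipal hC g hg).LinearlyEquivalent s := by
  obtain ⟨f, hf, h⟩ := h
  refine ⟨f + g, fun x hx => (hf x hx).add hC (hg x), fun x => ?_⟩
  change s'.toFun x + QuotientAddGroup.mk (g : Germ (𝓝 x) ℝ) - s.toFun x = _
  rw [add_sub_right_comm, h x]
  rfl

/-- The divisor `s` is nondegenerate at `x`. -/
def IsNondegenerateAt (s : CInftyDivisor O) (x : S) : Prop :=
  (∃ (ℓ : LineChart O) (f : S → ℝ) (F : ℝ → ℝ), x ∈ ℓ.source ∧ ℓ.toFun x ≠ ⊥ ∧ s.RepAt f x ∧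
    ContDiffAt ℝ 2 F (ℓ.coord x) ∧ (∀ᶠ y in 𝓝 x, f y = F (ℓ.coord y)) ∧
      IsMorseAt F (ℓ.coord x)) ∨
    ¬ IsRealPoint O x ∧ ∃ q, IsStandardAt O q x ∧ s.RepAt q x

/-- Stability of nondegeneracy under small perturbations by principal divisors that vanish near
the points that are not real. -/
lemma IsNondegenerateAt.eventually_addPrincipal (hC : IsTropicalCurve O) {s : CInftyDivisor O}
    {x : S} (h : s.IsNondegenerateAt x) {β : S → ℝ} (hβ : ∀ x, IsWeaklySmoothAt O β x)
    (hε : ∀ (ε : ℝ) x, IsWeaklySmoothAt O (fun y => ε * β y) x)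
    (h0 : ¬ IsRealPoint O x → ∀ᶠ y in 𝓝 x, β y = 0) :
    ∀ᶠ p : ℝ × S in 𝓝 (0, x),
      (s.addPrincipal hC (fun y => p.1 * β y) (hε p.1)).IsNondegenerateAt p.2 := by
  rcases h with ⟨ℓ, f, F, hx, hr, hf, hF, hfF, hm⟩ | ⟨hx, q, hq, hsq⟩
  · obtain ⟨B, hB, hβB⟩ := (hβ x).exists_profile ℓ hx hr
    have hsnd : Tendsto (Prod.snd : ℝ × S → S) (𝓝 (0, x)) (𝓝 x) := continuous_snd.tendsto _
    have hcoord : Tendsto (fun p : ℝ × S => (p.1, ℓ.coord p.2)) (𝓝 (0, x)) (𝓝 (0, ℓ.coord x)) := by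
      rw [nhds_prod_eq, nhds_prod_eq]
      exact tendsto_id.prodMap (ℓ.continuousAt_coord hx hr)
    have hcoord' : Tendsto (fun p : ℝ × S => ℓ.coord p.2) (𝓝 (0, x)) (𝓝 (ℓ.coord x)) :=
      (ℓ.continuousAt_coord hx hr).tendsto.comp hsnd
    filter_upwards [hcoord.eventually (hm.eventually_add hF hB),
      hsnd.eventually (ℓ.eventually_real hx hr), hsnd.eventually hf.eventually,
      hsnd.eventually (eventually_eventually_nhds.2 hfF),
      hsnd.eventually (eventually_eventually_nhds.2 hβB),
      hcoord'.eventually (eventually_contDiffAt hF),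
      hcoord'.eventually (eventually_contDiffAt hB)] with p h₁ h₂ h₃ h₄ h₅ h₆ h₇
    refine Or.inl ⟨ℓ, _, fun s => F s + p.1 * B s, h₂.1, h₂.2, h₃.addPrincipal hC (hε p.1),
      h₆.add (contDiffAt_const.mul h₇), ?_, h₁⟩
    filter_upwards [h₄, h₅] with y hy hy'
    rw [Pi.add_apply, hy, hy']
  -- At a non-real point the perturbation vanishes nearby, so `q` still represents the divisor for
  -- every `ε`. The nearby points are nondegenerate because `q` has non-integral slope there.
  · have hpt : ∀ᶠ y in 𝓝 x, ∀ ε : ℝ,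
        (s.addPrincipal hC (fun y => ε * β y) (hε ε)).IsNondegenerateAt y := by
      have hrep : ∀ᶠ y in 𝓝 x, ∀ ε : ℝ,
          (s.addPrincipal hC (fun y => ε * β y) (hε ε)).RepAt q y := by
        filter_upwards [hsq.eventually, eventually_eventually_nhds.2 (h0 hx)] with y h₁ h₂ ε
        refine (h₁.addPrincipal hC (hε ε)).congr hC ?_
        filter_upwards [h₂] with y' hy'
        rw [Pi.add_apply, hy', mul_zero, add_zero]
      filter_upwards [eventually_nhdsWithin_iff.1 hq.profile, hrep] with y h₁ h₂ ε
      by_cases hy : y = x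
      · subst hy
        exact Or.inr ⟨hx, q, hq, h₂ ε⟩
      · obtain ⟨ℓ, F, h₃, h₄, h₅, h₆, h₇⟩ := h₁ hy
        exact Or.inl ⟨ℓ, q, F, h₃, h₄, h₂ ε, h₅, h₆, Or.inl fun ⟨n, hn⟩ => h₇ n hn.symm⟩
    have hsnd : Tendsto (Prod.snd : ℝ × S → S) (𝓝 (0, x)) (𝓝 x) := continuous_snd.tendsto _
    exact (hsnd.eventually hpt).mono fun p hp => hp p.1

lemma IsNondegenerateAt.congr {s s' : CInftyDivisor O} {x : S} (h : s.IsNondegenerateAt x)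
    (hs : ∀ᶠ y in 𝓝 x, s.toFun y = s'.toFun y) : s'.IsNondegenerateAt x := by
  have hrep : ∀ f, s.RepAt f x → s'.RepAt f x := fun f hf => by
    filter_upwards [hf, hs] with y h₁ h₂ using ⟨h₁.1, h₂ ▸ h₁.2⟩
  rcases h with ⟨ℓ, f, F, hx, hr, hf, h⟩ | ⟨hx, q, hq, hsq⟩
  · exact Or.inl ⟨ℓ, f, F, hx, hr, hrep f hf, h⟩
  · exact Or.inr ⟨hx, q, hq, hrep q hsq⟩

/-- This is stability under the zero perturbation, restricted to the slice `ε = 0`. -/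
lemma IsNondegenerateAt.eventually (hC : IsTropicalCurve O) {s : CInftyDivisor O} {x : S}
    (h : s.IsNondegenerateAt x) : ∀ᶠ y in 𝓝 x, s.IsNondegenerateAt y := by
  have hz : ∀ (ε : ℝ) (x : S), IsWeaklySmoothAt O (fun _ => ε * 0) x := fun ε x =>
    isWeaklySmoothAt_const hC _ x
  have h₁ := h.eventually_addPrincipal hC (β := fun _ => 0)
    (fun x => isWeaklySmoothAt_const hC 0 x) hz fun _ => .of_forall fun _ => rfl
  have h₂ : Tendsto (fun y : S => ((0 : ℝ), y)) (𝓝 x) (𝓝 (0, x)) :=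
    (Continuous.prodMk_right (0 : ℝ)).tendsto x
  filter_upwards [h₂.eventually h₁] with y hy
  refine hy.congr (.of_forall fun y' => ?_)
  refine _root_.add_eq_left.2 ((QuotientAddGroup.eq_zero_iff _).2 ?_)
  simp only [mul_zero]
  exact (O.stalk y').zero_mem

end CInftyDivisor

end Spaces

end Tropical

end

noncomputable section

/-! ## Existence of nondegenerate divisors -/

namespace Tropical

section Spaces

variable {S : Type u} [TopologicalSpace S] {O : FunctionSheaf S}

namespace CInftyDivisor

/-- Adding the global function `ρ (q - f)`, with `ρ` a bump equal to 1 near `x`, replaces the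
representative `f` by the standard one. The support of `ρ` avoids the points already treated. -/
lemma exists_nondegenerate_on_finite [T2Space S] [CompactSpace S] (hC : IsTropicalCurve O)
    (s : CInftyDivisor O) {T : Set S} (hT : T.Finite) (hTr : ∀ x ∈ T, ¬ IsRealPoint O x) :
    ∃ s' : CInftyDivisor O, s'.LinearlyEquivalent s ∧ ∀ x ∈ T, s'.IsNondegenerateAt x := by
  induction T, hT using Set.Finite.induction_on with
  | empty => exact ⟨s, .refl hC s, fun x hx => absurd hx (notMem_empty x)⟩
  | @insert x T hxT hT ih =>
    obtain ⟨s', hs', hnd⟩ := ih fun y hy => hTr y (mem_insert_of_mem x hy)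
    obtain ⟨q, hq⟩ := exists_isStandardAt hC (hTr x (mem_insert x T))
    obtain ⟨f, hf⟩ := s'.exists_repAt x
    have hN : {y | IsWeaklySmoothAt O (q - f) y} ∩ Tᶜ ∈ 𝓝 x := by
      refine inter_mem ?_ (hT.isClosed.isOpen_compl.mem_nhds hxT)
      filter_upwards [hq.smooth.eventually, hf.isWeaklySmoothAt.eventually] with y h₁ h₂
        using h₁.sub hC h₂
    obtain ⟨ρ, hρ, hρ1, hρN, -⟩ := exists_bump hC hN
    have hg : ∀ y, IsWeaklySmoothAt O (ρ * (q - f)) y := fun y =>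
      isWeaklySmoothAt_mul_of_tsupport hC (hρ y) fun hy => (hρN hy).1
    refine ⟨s'.addPrincipal hC _ hg, hs'.addPrincipal hC hg, fun y hy => ?_⟩
    rcases mem_insert_iff.1 hy with rfl | hy
    · refine Or.inr ⟨hTr y (mem_insert y T), q, hq, (hf.addPrincipal hC hg).congr hC ?_⟩
      filter_upwards [hρ1] with z hz
      simp [hz]
    · refine (hnd y hy).congr ?_
      have h0 : y ∉ tsupport ρ := fun h => (hρN h).2 hy
      filter_upwards [eventually_eventually_nhds.2 (notMem_tsupport_iff_eventuallyEq.1 h0)]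
        with z hz
      refine (_root_.add_eq_left.2 ((QuotientAddGroup.eq_zero_iff _).2 ?_)).symm
      have : ((ρ * (q - f) : S → ℝ) : Germ (𝓝 z) ℝ) = 0 := Germ.coe_eq.2 (by
        filter_upwards [hz] with w hw
        rw [Pi.mul_apply, hw, Pi.zero_apply, zero_mul])
      rw [this]
      exact (O.stalk z).zero_mem

/-- Adding almost every small multiple of the coordinate makes a divisor nondegenerate. -/
lemma ae_isNondegenerateAt_addPrincipal (hC : IsTropicalCurve O) (s : CInftyDivisor O)
    (ℓ : LineChart O) {β : S → ℝ} (hε : ∀ (ε : ℝ) x, IsWeaklySmoothAt O (fun y => ε * β y) x)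
    {A : Set S} (hA : IsCompact A) (hAℓ : ∀ x ∈ A, x ∈ ℓ.source ∧ ℓ.toFun x ≠ ⊥)
    (hβ : ∀ x ∈ A, ∀ᶠ y in 𝓝 x, β y = ℓ.coord y) :
    ∀ᵐ ε : ℝ, ∀ x ∈ A, (s.addPrincipal hC (fun y => ε * β y) (hε ε)).IsNondegenerateAt x := by
  -- Being good for almost every `ε` passes to finite unions, so it suffices to work near one point,
  -- where one profile `F` serves all points.
  refine hA.induction_on (p := fun A => ∀ᵐ ε : ℝ, ∀ x ∈ A,
    (s.addPrincipal hC (fun y => ε * β y) (hε ε)).IsNondegenerateAt x)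
    (.of_forall fun ε x hx => absurd hx (notMem_empty x))
    (fun t t' htt' h => h.mono fun ε h x hx => h x (htt' hx))
    (fun t t' h h' => by
      filter_upwards [h, h'] with ε h h' x hx using hx.elim (h x) (h' x)) fun x hx => ?_
  obtain ⟨hxs, hxr⟩ := hAℓ x hx
  obtain ⟨f, hf⟩ := s.exists_repAt x
  obtain ⟨F, hF, hfF⟩ := hf.isWeaklySmoothAt.exists_profile ℓ hxs hxr
  have hev : ∀ᶠ y in 𝓝 x, (y ∈ ℓ.source ∧ ℓ.toFun y ≠ ⊥) ∧ s.RepAt f y ∧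
      (∀ᶠ y' in 𝓝 y, f y' = F (ℓ.coord y')) ∧ ContDiffAt ℝ 2 F (ℓ.coord y) ∧
      ∀ᶠ y' in 𝓝 y, β y' = ℓ.coord y' := by
    filter_upwards [ℓ.eventually_real hxs hxr, hf.eventually, eventually_eventually_nhds.2 hfF,
      (ℓ.continuousAt_coord hxs hxr).eventually (eventually_contDiffAt hF),
      eventually_eventually_nhds.2 (hβ x hx)] with y h₁ h₂ h₃ h₄ h₅ using ⟨h₁, h₂, h₃, h₄, h₅⟩
  refine ⟨_, nhdsWithin_le_nhds hev, ?_⟩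
  have hnull := volume_not_isMorseAt_add (F := F) (J := {r | ContDiffAt ℝ 2 F r}) fun r hr => hr
  have hae : ∀ᵐ ε : ℝ, ε ∉ {ε : ℝ | ∃ r ∈ {r | ContDiffAt ℝ 2 F r},
      ¬ IsMorseAt (fun s => F s + ε * s) r} := MeasureTheory.measure_eq_zero_iff_ae_notMem.1 hnull
  filter_upwards [hae] with ε h y hy
  obtain ⟨h₁, h₂, h₃, h₄, h₅⟩ := hy
  refine Or.inl ⟨ℓ, _, fun s => F s + ε * s, h₁.1, h₁.2, h₂.addPrincipal hC (hε ε),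
    h₄.add (contDiffAt_const.mul contDiffAt_id), ?_, ?_⟩
  · filter_upwards [h₃, h₅] with y' h h'
    rw [Pi.add_apply, h, h']
  · by_contra hm
    exact h ⟨_, h₄, hm⟩

/-- Non-real points are treated first. The rest is covered by finitely many small closed sets, and
each perturbation is generic on the new set and small enough for the old ones. -/
lemma exists_nondegenerate [T2Space S] [CompactSpace S] (hC : IsTropicalCurve O)
    (s : CInftyDivisor O) :
    ∃ s' : CInftyDivisor O, s'.LinearlyEquivalent s ∧ ∀ x, s'.IsNondegenerateAt x := by
  obtain ⟨s₁, hs₁, hnd₁⟩ := s.exists_nondegenerate_on_finite hC (finite_special hC) fun x hx => hx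
  -- Nondegeneracy is open, so it holds on the closure of a neighbourhood `u` of the non-real
  -- points; only the compact set `uᶜ`, all of whose points are real, remains.
  obtain ⟨u, hu, hTu, huN⟩ := normal_exists_closure_subset (finite_special hC).isClosed
    (isOpen_iff_eventually.2 fun x (hx : s₁.IsNondegenerateAt x) => hx.eventually hC) hnd₁
  have hX : IsCompact uᶜ := hu.isClosed_compl.isCompact
  -- The induction quantifies over the closed set `K` already treated and the current divisor, so
  -- that the steps for two pieces can be chained. Closures keep the treated set compact.
  have key : ∀ K : Set S, IsClosed K → ∀ s' : CInftyDivisor O, s'.LinearlyEquivalent s →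
      (∀ x ∈ K, s'.IsNondegenerateAt x) → ∃ s'' : CInftyDivisor O, s''.LinearlyEquivalent s ∧
        ∀ x ∈ K ∪ closure uᶜ, s''.IsNondegenerateAt x := by
    refine hX.induction_on (p := fun A => ∀ K : Set S, IsClosed K → ∀ s' : CInftyDivisor O,
      s'.LinearlyEquivalent s → (∀ x ∈ K, s'.IsNondegenerateAt x) →
      ∃ s'' : CInftyDivisor O, s''.LinearlyEquivalent s ∧
        ∀ x ∈ K ∪ closure A, s''.IsNondegenerateAt x) ?_ ?_ ?_ ?_
    · intro K _ s' hs' hK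
      exact ⟨s', hs', by simpa using hK⟩
    · intro A A' hAA' h K hK s' hs' hnd
      obtain ⟨s'', h₁, h₂⟩ := h K hK s' hs' hnd
      exact ⟨s'', h₁, fun x hx => h₂ x (union_subset_union_right K (closure_mono hAA') hx)⟩
    · intro A A' h h' K hK s' hs' hnd
      obtain ⟨s'', h₁, h₂⟩ := h K hK s' hs' hnd
      obtain ⟨s''', h₃, h₄⟩ := h' _ (hK.union isClosed_closure) s'' h₁ h₂
      exact ⟨s''', h₃, by rwa [closure_union, ← union_assoc]⟩
    · intro x hx
      have hxr : IsRealPoint O x := by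
        by_contra h
        exact hx (hTu h)
      obtain ⟨ℓ, hxs, hxb⟩ := hxr
      obtain ⟨ρ, hρ, hρ1, hρN, -⟩ := exists_bump hC (ℓ.eventually_real hxs hxb)
      have hβ : ∀ y, IsWeaklySmoothAt O (ρ * ℓ.coord) y := fun y =>
        isWeaklySmoothAt_mul_of_tsupport hC (hρ y) fun hy =>
          ℓ.isWeaklySmoothAt_coord (hρN hy).1 (hρN hy).2
      have hε : ∀ (ε : ℝ) y, IsWeaklySmoothAt O (fun y => ε * (ρ * ℓ.coord) y) y := fun ε y =>
        (isWeaklySmoothAt_const hC ε y).mul hC (hβ y)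
      obtain ⟨A, hA, hAc, hAN⟩ := exists_mem_nhds_isClosed_subset (inter_mem
        (ℓ.eventually_real hxs hxb) (eventually_eventually_nhds.2 hρ1))
      refine ⟨A, nhdsWithin_le_nhds hA, fun K hK s' hs' hnd => ?_⟩
      rw [hAc.closure_eq]
      have hKε : ∀ᶠ ε in 𝓝 (0 : ℝ), ∀ y ∈ K,
          (s'.addPrincipal hC (fun y => ε * (ρ * ℓ.coord) y) (hε ε)).IsNondegenerateAt y := by
        refine hK.isCompact.eventually_forall_of_forall_eventually (P := fun ε y =>
          (s'.addPrincipal hC (fun y => ε * (ρ * ℓ.coord) y) (hε ε)).IsNondegenerateAt y)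
          fun y hy => (hnd y hy).eventually_addPrincipal hC hβ hε fun hyr => ?_
        -- The support of `ρ` consists of real points, so the perturbation vanishes near every
        -- non-real point.
        have h0 : y ∉ tsupport ρ := fun h => hyr ⟨ℓ, hρN h⟩
        filter_upwards [notMem_tsupport_iff_eventuallyEq.1 h0] with z hz
        rw [Pi.mul_apply, hz, Pi.zero_apply, zero_mul]
      have hAε := s'.ae_isNondegenerateAt_addPrincipal hC ℓ hε hAc.isCompact
        (fun y hy => (hAN hy).1) fun y hy => by
          filter_upwards [(hAN hy).2] with z hz
          rw [Pi.mul_apply, hz, one_mul]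
      -- The parameters good on `A` have full measure, hence are dense, and those good on `K`
      -- contain a neighbourhood of 0.
      obtain ⟨ε, h₁, h₂⟩ := (MeasureTheory.Measure.dense_of_ae hAε).inter_nhds_nonempty hKε
      exact ⟨_, hs'.addPrincipal hC (hε ε), fun y hy => hy.elim (h₂ y) (h₁ y)⟩
  obtain ⟨s₂, hs₂, hnd₂⟩ := key _ isClosed_closure s₁ hs₁ fun x hx => huN hx
  refine ⟨s₂, hs₂, fun x => hnd₂ x ?_⟩
  by_cases hx : x ∈ u
  · exact Or.inl (subset_closure hx)
  · exact Or.inr (subset_closure hx)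

end CInftyDivisor

end Spaces

end Tropical

end

noncomputable section

/-! ## Nondegenerate divisors are permissible -/

namespace Tropical

open MorseSheaf

/-- The second derivative test decides which case holds. Strictness is needed only for a maximum,
where the sublevel set must be the whole punctured neighbourhood; a second point with the same value
would give a critical point in between by Rolle. -/
lemma exists_strict_extremum {F : ℝ → ℝ} {r : ℝ} (hF : ContDiffAt ℝ 2 F r) (h1 : deriv F r = 0)
    (h2 : deriv (deriv F) r ≠ 0) :
    (∀ᶠ s in 𝓝 r, F r ≤ F s) ∨ ∀ᶠ s in 𝓝 r, s ≠ r → F s < F r := by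
  rcases lt_or_gt_of_ne h2 with h | h
  · right
    have hmax : ∀ᶠ s in 𝓝 r, F s ≤ F r :=
      isLocalMax_of_deriv_deriv_neg h h1 hF.continuousAt
    have hne : ∀ᶠ s in 𝓝 r, s ≠ r → deriv F s ≠ 0 := eventually_nhdsWithin_iff.1
      (((contDiffAt_deriv hF).differentiableAt (by decide)).hasDerivAt.eventually_ne h2)
    obtain ⟨ε, hε, hb⟩ := Metric.eventually_nhds_iff_ball.1
      (hmax.and (hne.and (eventually_contDiffAt hF)))
    filter_upwards [Metric.ball_mem_nhds r hε] with s hs hsr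
    refine lt_of_le_of_ne (hb s hs).1 fun heq => ?_
    have hsub : uIcc r s ⊆ Metric.ball r ε :=
      (convex_ball r ε).ordConnected.uIcc_subset (Metric.mem_ball_self hε) hs
    have hcont : ContinuousOn F (uIcc r s) := fun t ht =>
      (hb t (hsub ht)).2.2.continuousAt.continuousWithinAt
    rcases lt_or_gt_of_ne hsr with hlt | hlt
    · rw [uIcc_of_ge hlt.le] at hsub hcont
      obtain ⟨t, ht, h0⟩ := exists_deriv_eq_zero hlt hcont heq
      exact (hb t (hsub (Ioo_subset_Icc_self ht))).2.1 ht.2.ne h0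
    · rw [uIcc_of_le hlt.le] at hsub hcont
      obtain ⟨t, ht, h0⟩ := exists_deriv_eq_zero hlt hcont heq.symm
      exact (hb t (hsub (Ioo_subset_Icc_self ht))).2.1 ht.1.ne' h0
  · left
    exact isLocalMin_of_deriv_deriv_pos h h1 hF.continuousAt

section Spaces

variable {S : Type u} [TopologicalSpace S] {O : FunctionSheaf S}

lemma LineChart.isOpenEmbedding_coord (ℓ : LineChart O) {U : Opens S} (hU : U ≤ ℓ.source)
    (hr : ∀ y ∈ U, ℓ.toFun y ≠ ⊥) : IsOpenEmbedding (fun y : U => ℓ.coord y) := by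
  refine IsOpenEmbedding.of_comp _ TropReal.isOpenEmbedding_coe ?_
  have : ((↑) : ℝ → TropReal) ∘ (fun y : U => ℓ.coord y) = fun y : U => ℓ.toFun y :=
    funext fun y => TropReal.coe_toReal (hr y y.2)
  rw [this]
  have hinc : IsOpenEmbedding (Opens.toTopCat (TopCat.of S) |>.map (homOfLE hU)) :=
    Opens.isOpenEmbedding_of_le hU
  exact ℓ.isOpenEmbedding.comp hinc

namespace CInftyDivisor

variable {s : CInftyDivisor O}

/-- Two representatives differ by an integral affine function, which shifts the derivative by an
integer. The criterion can therefore be tested on the chosen `f`. -/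
lemma deriv_mem_of_mem_zeroIntersection {ℓ : LineChart O} {x : S} (hx : x ∈ ℓ.source)
    (hr : ℓ.toFun x ≠ ⊥) {f : S → ℝ} {F : ℝ → ℝ} (hf : s.RepAt f x)
    (hF : ∀ᶠ y in 𝓝 x, f y = F (ℓ.coord y)) (hd : DifferentiableAt ℝ F (ℓ.coord x))
    (h : x ∈ s.zeroIntersection) : deriv F (ℓ.coord x) ∈ range ((↑) : ℤ → ℝ) := by
  obtain ⟨U, f', hxU, hf', ξ, hξ, hdiff⟩ := h
  have hmem : (f' - f : S → ℝ) ∈ {g : S → ℝ | (g : Germ (𝓝 x) ℝ) ∈ O.stalk x} := by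
    have h₁ := QuotientAddGroup.eq.1 (hf.self_of_nhds.2.symm.trans (hf'.2 x hxU))
    rw [neg_add_eq_sub] at h₁
    exact h₁
  obtain ⟨m, a, -, hm⟩ := (ℓ.stalk_iff x hx _).1 hmem
  have hF' : ∀ᶠ y in 𝓝 x, f' y = (fun t => F t + (a + m * t)) (ℓ.coord y) := by
    filter_upwards [hF, hm] with y h₁ h₂
    rw [Pi.sub_apply, sub_eq_iff_eq_add] at h₂
    rw [h₂, h₁, add_comm]
    rfl
  obtain ⟨n, hn⟩ := (ℓ.mem_integralCovectors_iff hx hr hdiff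
    (F := fun t => F t + (a + m * t)) hF').1 hξ
  have hder : deriv (fun t => F t + (a + m * t)) (ℓ.coord x) = deriv F (ℓ.coord x) + m := by
    have h₁ : HasDerivAt (fun t : ℝ => a + m * t) m (ℓ.coord x) := by
      simpa using ((hasDerivAt_id (ℓ.coord x)).const_mul (m : ℝ)).const_add a
    exact (hd.hasDerivAt.add h₁).deriv
  exact ⟨n - m, by rw [Int.cast_sub, ← hn, hder, add_sub_cancel_right]⟩

lemma RepAt.exists_isRepresentedOn {f : S → ℝ} {x : S} (h : s.RepAt f x) {P : S → Prop}
    (hP : ∀ᶠ y in 𝓝 x, P y) : ∃ U : Opens S, x ∈ U ∧ s.IsRepresentedOn U f ∧ ∀ y ∈ U, P y := by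
  obtain ⟨V, hV, hVo, hxV⟩ := mem_nhds_iff.1 (h.and hP)
  exact ⟨⟨V, hVo⟩, hxV, ⟨fun y hy => (hV hy).1.1, fun y hy => (hV hy).1.2⟩, fun y hy => (hV hy).2⟩

lemma eventually_notMem_zeroIntersection {x : S} (h : s.IsNondegenerateAt x) :
    ∀ᶠ y in 𝓝[≠] x, y ∉ s.zeroIntersection := by
  rcases h with ⟨ℓ, f, F, hx, hr, hf, hF, hfF, hm⟩ | ⟨hx, q, hq, hsq⟩
  · have hinj : Tendsto ℓ.coord (𝓝[≠] x) (𝓝[≠] (ℓ.coord x)) := by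
      refine tendsto_nhdsWithin_iff.2
        ⟨(ℓ.continuousAt_coord hx hr).tendsto.mono_left nhdsWithin_le_nhds, ?_⟩
      filter_upwards [nhdsWithin_le_nhds (ℓ.eventually_real hx hr), self_mem_nhdsWithin]
        with y hy hyx h
      refine hyx (ℓ.injOn hy.1 hx ?_)
      rw [← TropReal.coe_toReal hy.2, ← TropReal.coe_toReal hr]
      exact congrArg _ h
    filter_upwards [hinj.eventually (hm.eventually_notMem hF),
      nhdsWithin_le_nhds (ℓ.eventually_real hx hr), nhdsWithin_le_nhds hf.eventually,
      nhdsWithin_le_nhds (eventually_eventually_nhds.2 hfF),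
      nhdsWithin_le_nhds ((ℓ.continuousAt_coord hx hr).eventually (eventually_contDiffAt hF))]
      with y h₁ h₂ h₃ h₄ h₅ h₆
    exact h₁ (deriv_mem_of_mem_zeroIntersection h₂.1 h₂.2 h₃ h₄ (h₅.differentiableAt (by decide)) h₆)
  · filter_upwards [hq.profile, nhdsWithin_le_nhds hsq.eventually] with y h₁ h₂ h₃
    obtain ⟨ℓ, F, hy, hyr, hF, hqF, hn⟩ := h₁
    obtain ⟨n, hn'⟩ := deriv_mem_of_mem_zeroIntersection hy hyr h₂ hqF
      (hF.differentiableAt (by decide)) h₃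
    exact hn n hn'.symm

/-- At real points the condition is automatic. At a non-real point the standard representative has
differential 0, which is integral, so `SS` need not be computed at vertices or at infinity. -/
lemma exists_prepermissible_representative (hC : IsTropicalCurve O) {x : S}
    (h : s.IsNondegenerateAt x) : ∃ (U : Opens S) (f : S → ℝ), x ∈ U ∧ s.IsRepresentedOn U f ∧
      ∀ y ∈ U, IsPrepermissibleAt O f y := by
  have hreal : ∀ (f : S → ℝ) (y : S), IsRealPoint O y → IsWeaklySmoothAt O f y →
      IsPrepermissibleAt O f y := fun f y ⟨ℓ, hy, hr⟩ hf => ℓ.isPrepermissibleAt hy hr hf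
  rcases h with ⟨ℓ, f, F, hx, hr, hf, -⟩ | ⟨hx, q, hq, hsq⟩
  · obtain ⟨U, hxU, hU, hUP⟩ := hf.exists_isRepresentedOn (IsRealPoint.eventually ⟨ℓ, hx, hr⟩)
    exact ⟨U, f, hxU, hU, fun y hy => hreal f y (hUP y hy) (hU.1 y hy)⟩
  · obtain ⟨U, hxU, hU, hUP⟩ := hsq.exists_isRepresentedOn
      (eventually_nhdsWithin_iff.1 (eventually_isRealPoint hC x))
    refine ⟨U, q, hxU, hU, fun y hy => ?_⟩
    by_cases hyx : y = x
    · subst hyx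
      exact ⟨0, hq.critical, fun h => h.2 (zero_mem _)⟩
    · exact hreal q y (hUP y hy hyx) (hU.1 y hy)

/-- At a real point, subtracting the tangent affine function makes the point an isolated
nondegenerate critical point, either a minimum or a strict maximum. At a non-real point the standard
function is already normalized and has a minimum. -/
lemma exists_intersection_datum (hC : IsTropicalCurve O) {p : S} (h : s.IsNondegenerateAt p) (hp : p ∈ s.zeroIntersection) :
    ∃ (U : Opens S) (f : S → ℝ) (hpU : p ∈ U), s.IsRepresentedOn U f ∧
      (∀ y ∈ U, IsCriticalPoint O f y ↔ y = p) ∧ f p = 0 ∧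
      CyclicLMD (constZ (TopCat.of U)) (fun y => f y.1) ⟨p, hpU⟩ := by
  rcases h with ⟨ℓ, f, F, hx, hr, hf, hF, hfF, hm⟩ | ⟨hx, q, hq, hsq⟩
  · obtain ⟨n, hn⟩ := deriv_mem_of_mem_zeroIntersection hx hr hf hfF
      (hF.differentiableAt (by decide)) hp
    -- The function `a + n t` is the tangent line of `F` at the point. Its slope is integral, so
    -- subtracting it does not change the divisor.
    let a : ℝ := F (ℓ.coord p) - n * ℓ.coord p
    let G : ℝ → ℝ := fun t => F t - (a + n * t)
    let g : S → ℝ := fun y => f y - (a + n * ℓ.coord y)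
    have hG : ContDiffAt ℝ 2 G (ℓ.coord p) := hF.sub (by fun_prop)
    have hG1 : ∀ᶠ t in 𝓝 (ℓ.coord p), deriv G t = deriv F t - n := by
      filter_upwards [eventually_contDiffAt hF] with t ht
      have h₁ : HasDerivAt (fun t : ℝ => a + n * t) n t := by
        simpa using ((hasDerivAt_id t).const_mul (n : ℝ)).const_add a
      exact ((ht.differentiableAt (by decide)).hasDerivAt.sub h₁).deriv
    have hG0 : deriv G (ℓ.coord p) = 0 := by rw [hG1.self_of_nhds, hn, sub_self]
    have hG2 : deriv (deriv G) (ℓ.coord p) ≠ 0 := by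
      rw [EventuallyEq.deriv_eq hG1, deriv_sub_const]
      exact hm.resolve_left fun h => h ⟨n, hn⟩
    have hgG : ∀ᶠ y in 𝓝 p, g y = G (ℓ.coord y) := hfF.mono fun y hy => by
      simp only [g, G, hy]
    have hrep : s.RepAt g p := by
      filter_upwards [hf, ℓ.eventually_real hx hr] with y hy hyr
      have hmem : ((fun y => a + n * ℓ.coord y : S → ℝ) : Germ (𝓝 y) ℝ) ∈ O.stalk y :=
        (ℓ.stalk_iff y hyr.1 _).2 ⟨n, a, fun h => absurd h hyr.2, .of_forall fun _ => rfl⟩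
      refine ⟨hy.1.sub hC (isWeaklySmoothAt_of_mem_stalk hC hmem), hy.2.trans ?_⟩
      refine QuotientAddGroup.eq.2 ?_
      have : -(f : Germ (𝓝 y) ℝ) + (g : Germ (𝓝 y) ℝ) =
          -((fun y => a + n * ℓ.coord y : S → ℝ) : Germ (𝓝 y) ℝ) := by
        refine Germ.coe_eq.2 (.of_forall fun z => ?_)
        change -f z + (f z - (a + n * ℓ.coord z)) = -(a + n * ℓ.coord z)
        ring
      rw [this]
      exact neg_mem hmem
    have hcrit : ∀ᶠ y in 𝓝 p, IsCriticalPoint O g y ↔ y = p := by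
      have hne := eventually_nhdsWithin_iff.1
        (((contDiffAt_deriv hG).differentiableAt (by decide)).hasDerivAt.eventually_ne
          (c := 0) hG2)
      filter_upwards [(ℓ.continuousAt_coord hx hr).eventually hne, hrep.eventually,
        ℓ.eventually_real hx hr, eventually_eventually_nhds.2 hgG] with y h₁ h₂ h₃ h₄
      rw [ℓ.isCriticalPoint_iff h₃.1 h₃.2 h₂.isWeaklySmoothAt h₄]
      refine ⟨fun h => ?_, fun h => h ▸ hG0⟩
      by_contra hyp
      refine h₁ (fun h' => hyp (ℓ.injOn h₃.1 hx ?_)) h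
      rw [← TropReal.coe_toReal h₃.2, ← TropReal.coe_toReal hr]
      exact congrArg _ h'
    have hgp : g p = 0 := by simp only [g, a, hfF.self_of_nhds]; ring
    rcases exists_strict_extremum hG hG0 hG2 with hext | hext
    · obtain ⟨U, hpU, hU, hUP⟩ := hrep.exists_isRepresentedOn (hcrit.and
        (hgG.and ((ℓ.continuousAt_coord hx hr).eventually hext)))
      refine ⟨U, g, hpU, hU, fun y hy => (hUP y hy).1, hgp,
        cyclicLMD_of_min (SheafSection.isGenerator_constOne _) fun y => ?_⟩
      change g p ≤ g y
      rw [(hUP y y.2).2.1, (hUP p hpU).2.1]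
      exact (hUP y y.2).2.2
    · obtain ⟨U, hpU, hU, hUP⟩ := hrep.exists_isRepresentedOn (hcrit.and
        (hgG.and (((ℓ.continuousAt_coord hx hr).eventually hext).and (ℓ.eventually_real hx hr))))
      have hφ := ℓ.isOpenEmbedding_coord (U := U) (fun y hy => (hUP y hy).2.2.2.1)
        fun y hy => (hUP y hy).2.2.2.2
      refine ⟨U, g, hpU, hU, fun y hy => (hUP y hy).1, hgp,
        cyclicLMD_of_strict_max (X := TopCat.of U) (φ := fun y => ℓ.coord y.1) hφ
          (SheafSection.isGenerator_constOne _) fun y hy => ?_⟩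
      change g y.1 < g p
      rw [(hUP y.1 y.2).2.1, (hUP p hpU).2.1]
      exact (hUP y.1 y.2).2.2.1 fun h => hy (hφ.injective h)
  · have hcrit : ∀ᶠ y in 𝓝 p, IsCriticalPoint O q y ↔ y = p := by
      filter_upwards [eventually_nhdsWithin_iff.1 hq.profile, hsq.eventually] with y h₁ h₂
      refine ⟨fun h => ?_, fun h => h ▸ hq.critical⟩
      by_contra hyp
      obtain ⟨ℓ, F, h₃, h₄, -, h₅, h₆⟩ := h₁ hyp
      exact h₆ 0 (by rw [(ℓ.isCriticalPoint_iff h₃ h₄ h₂.isWeaklySmoothAt h₅).1 h, Int.cast_zero])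
    obtain ⟨U, hpU, hU, hUP⟩ := hsq.exists_isRepresentedOn (hcrit.and hq.nonneg)
    refine ⟨U, q, hpU, hU, fun y hy => (hUP y hy).1, hq.eq_zero,
      cyclicLMD_of_min (SheafSection.isGenerator_constOne _) fun y => ?_⟩
    change q p ≤ q y.1
    rw [hq.eq_zero]
    exact (hUP y.1 y.2).2

lemma isPermissible_of_isNondegenerateAt [CompactSpace S] (hC : IsTropicalCurve O)
    (h : ∀ x, s.IsNondegenerateAt x) : s.IsPermissible := by
  classical
  have hfin : s.zeroIntersection.Finite :=
    finite_of_eventually_notMem fun x => eventually_notMem_zeroIntersection (h x)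
  refine ⟨?_, hfin, ?_⟩
  · choose U f hxU hU hf using fun x => exists_prepermissible_representative hC (h x)
    exact ⟨S, U, f, ⟨fun x => ⟨x, hxU x⟩, hU⟩, hf⟩
  · choose U f hpU hU hcrit h0 hLMD using fun p : s.zeroIntersection =>
      exists_intersection_datum hC (h p) p.2
    have := hfin.to_subtype
    refine ⟨⟨U, f, hpU, hU, hcrit, h0⟩, ?_⟩
    exact finite_directSum_of_cyclic _ (fun q => (hLMD q.1).1 q.2) fun p n => (hLMD p).2 n

end CInftyDivisor

end Spaces

end Tropical

end

noncomputable section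

/-! ## Divisors of line bundles -/

namespace Tropical

section Spaces

variable {S : Type u} [TopologicalSpace S] {O : FunctionSheaf S}

namespace CInftyDivisor

/-- Adding the same global function to all local representatives leaves their differences unchanged.
-/
lemma HasClass.of_linearlyEquivalent (hC : IsTropicalCurve O) {s s' : CInftyDivisor O}
    {L : LineBundle O} (h : s.HasClass L) (h' : s'.LinearlyEquivalent s) : s'.HasClass L := by
  obtain ⟨κ, V, r, f, hV, ⟨hcov, hrep⟩, htrans⟩ := h
  obtain ⟨g, hg, hgs⟩ := h'
  refine ⟨κ, V, r, fun k => f k + g, hV, ⟨hcov, fun k => ⟨fun x hx => ?_, fun x hx => ?_⟩⟩,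
    fun k l y hy => ?_⟩
  · exact ((hrep k).1 x hx).add hC (hg x trivial)
  · rw [eq_add_of_sub_eq (hgs x), (hrep k).2 x hx, add_comm]
    rfl
  · rw [← htrans k l y hy]
    exact add_sub_add_right_eq_sub _ _ _

/-- This is the usual splitting of a cocycle: averaging the transition functions into index `j` with
a partition of unity gives `f j`. The cocycle identity and `∑ ρ = 1` give `f l - f k = trans k l`,
so the `f j` define one divisor. -/
lemma exists_hasClass [T2Space S] [CompactSpace S] (hC : IsTropicalCurve O) (L : LineBundle O) :
    ∃ s : CInftyDivisor O, s.HasClass L := by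
  choose i hi using L.covers
  obtain ⟨T, ρ, hρ, hρN, hρ1⟩ := exists_partitionOfUnity hC (fun x => (L.cover (i x) : Set S))
    fun x => (L.cover (i x)).isOpen.mem_nhds (hi x)
  let f : L.index → S → ℝ := fun j => ∑ x ∈ T, ρ x * L.trans (i x) j
  have hf : ∀ j, IsWeaklySmoothOn O (f j) (L.cover j) := fun j y hy =>
    IsWeaklySmoothAt.sum hC T fun x _ => isWeaklySmoothAt_mul_of_tsupport hC (hρ x y) fun hyx =>
      isWeaklySmoothAt_of_mem_stalk hC (L.trans_mem (i x) j y ⟨hρN x hyx, hy⟩)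
  have hsub : ∀ k l, ∀ y ∈ L.cover k ⊓ L.cover l, f l y - f k y = L.trans k l y := by
    intro k l y hy
    have : ∀ x ∈ T, ρ x y * L.trans (i x) l y - ρ x y * L.trans (i x) k y =
        ρ x y * L.trans k l y := by
      intro x _
      by_cases h0 : ρ x y = 0
      · simp [h0]
      · rw [← L.cocycle (i x) k l y ⟨⟨hρN x (subset_tsupport _ h0), hy.1⟩, hy.2⟩]
        ring
    simp only [f, Finset.sum_apply, Pi.mul_apply]
    rw [← Finset.sum_sub_distrib, Finset.sum_congr rfl this, ← Finset.sum_mul, hρ1, one_mul]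
  have hmk : ∀ k l, ∀ y ∈ L.cover k ⊓ L.cover l,
      (QuotientAddGroup.mk (f k : Germ (𝓝 y) ℝ) : Germ (𝓝 y) ℝ ⧸ O.stalk y) =
        QuotientAddGroup.mk (f l : Germ (𝓝 y) ℝ) := by
    intro k l y hy
    refine QuotientAddGroup.eq.2 ?_
    have : -(f k : Germ (𝓝 y) ℝ) + (f l : Germ (𝓝 y) ℝ) = (L.trans k l : Germ (𝓝 y) ℝ) := by
      refine Germ.coe_eq.2 ?_
      filter_upwards [(L.cover k ⊓ L.cover l).isOpen.mem_nhds hy] with z hz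
      rw [← hsub k l z hz, sub_eq_neg_add]
      rfl
    rw [this]
    exact L.trans_mem k l y hy
  refine ⟨⟨fun y => QuotientAddGroup.mk (f (i y) : Germ (𝓝 y) ℝ), fun x =>
    ⟨L.cover (i x), f (i x), hi x, hf _, fun y hy => hmk _ _ y ⟨hi y, hy⟩⟩⟩,
    L.index, L.cover, id, f, fun _ => le_rfl,
    ⟨L.covers, fun j => ⟨hf j, fun y hy => hmk _ _ y ⟨hi y, hy⟩⟩⟩, hsub⟩

end CInftyDivisor

end Spaces

end Tropical

end

theorem mainTheorem5 {C : Type*} [TopologicalSpace C] [T2Space C] [CompactSpace C]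
    (O : Tropical.FunctionSheaf C) (hC : Tropical.IsTropicalCurve O) :
    (∀ s : Tropical.CInftyDivisor O, ∃ s' : Tropical.CInftyDivisor O,
      s'.IsPrepermissible ∧ s'.LinearlyEquivalent s ∧ s'.zeroIntersection.Finite) ∧
    (∀ L : Tropical.LineBundle O, ∃ s : Tropical.CInftyDivisor O,
      s.IsPermissible ∧ s.HasClass L) := by
  refine ⟨fun s => ?_, fun L => ?_⟩
  · obtain ⟨s', hs', hnd⟩ := s.exists_nondegenerate hC
    have h := Tropical.CInftyDivisor.isPermissible_of_isNondegenerateAt hC hnd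
    exact ⟨s', h.1, hs', h.2.1⟩
  · obtain ⟨s, hs⟩ := Tropical.CInftyDivisor.exists_hasClass hC L
    obtain ⟨s', hs', hnd⟩ := s.exists_nondegenerate hC
    exact ⟨s', Tropical.CInftyDivisor.isPermissible_of_isNondegenerateAt hC hnd,
      hs.of_linearlyEquivalent hC hs'⟩
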